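/- Let $L$ be a finite set, let $I\subseteq L\times L$ be an irreflexive symmetric relation (independence), and for each $\alpha\in L$ let $G_\alpha$ be a group generated by a finite set $\Sigma_\alpha=\Sigma_\alpha^{-1}\subseteq G_\alpha\setminus\{1\}$. Let $\Gamma$ be the disjoint union of the (possibly infinite) alphabets $\Gamma_\alpha=G_\alpha\setminus\{1\}$. The dependence graph $D(w)$ of a word $w=a_1\cdots a_n\in\Gamma^*$ with $a_i\in\Gamma_{\alpha_i}$ is the directed graph with vertices $1,\dots,n$, where vertex $i$ is labelled by the letter $a_i$, and with an arc from $i$ to $j$ if and only if $i<j$ and $(\alpha_i,\alpha_j)\notin I$. Write $w\equiv w'$ if $D(w)$ and $D(w')$ are isomorphic as node-labelled directed graphs. A word $a_1\cdots a_n\in\Gamma^*$ is given as input in the form $[u_1]\cdots[u_n]$, where $u_i$ is a word over $\Sigma_{\alpha_i}$ with value $a_i$ in $G_{\alpha_i}$; a pair of words is given by two such strings with a separator between them. A problem is in logspace if it is decided by a deterministic Turing machine with a read-only input tape that halts on every input and uses $O(\log n)$ cells of its work tapes on inputs of length $n$. Proposition (pattern matching on dependence graphs). Let $G=G(L,I;(G_\alpha)_{\alpha\in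 L})$ be the graph product of the groups $G_\alpha$, and suppose that for every $\alpha\in L$ the word problem of $G_\alpha$, that is $\{w\in\Sigma_\alpha^*: w=1\text{ in }G_\alpha\}$, is in logspace. Then the following problem is in logspace. Input: words $p,t\in\Gamma^*$. Question: do words $x,y\in\Gamma^*$ exist such that $t\equiv x\,p\,y$? -/

import Mathlib

universe u v

/-! ### Deterministic logarithmic space -/

namespace Logspace

/-- A head movement. -/
inductive Move : Type
  | left
  | stay
  | right

/-- What the input head can see: an end marker or a letter of the input. -/
inductive InSym (A : Type u) : Type u
  | leftEnd
  | rightEnd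
  | letter (a : A)

/-- The cell `i` of the input tape, which holds `w` between two end markers: cell `0` is the left
end marker, cells `1, …, |w|` hold the letters of `w`, and cell `|w| + 1` is the right end marker. -/
def inputCell {A : Type u} (w : List A) : ℕ → InSym A
  | 0 => InSym.leftEnd
  | i + 1 =>
    match w[i]? with
    | some a => InSym.letter a
    | none => InSym.rightEnd

/-- The input head moves within the cells `0, …, n + 1`, where `n` is the input length. -/
def moveInput (n : ℕ) : Move → ℕ → ℕ
  | Move.left, i => i - 1
  | Move.stay, i => i
  | Move.right, i => min (i + 1) (n + 1)

/-- The head of a work tape moves on a two-way infinite tape. -/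
def moveWork : Move → ℤ → ℤ
  | Move.left, i => i - 1
  | Move.stay, i => i
  | Move.right, i => i + 1

/-- A deterministic Turing machine with a read-only two-way input tape over `A` and finitely many
read-write work tapes. The machine halts when the transition function returns `none`. -/
structure Machine (A : Type u) where
  State : Type
  finite_state : Finite State
  WorkSym : Type
  finite_workSym : Finite WorkSym
  blank : WorkSym
  tapes : ℕ
  start : State
  accept : Set State
  trans : State → InSym A → (Fin tapes → WorkSym) →
    Option (State × Move × (Fin tapes → WorkSym × Move))

namespace Machine

variable {A : Type u}

/-- A configuration: the state, the position of the input head, and the contents and the head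
position of each work tape. -/
structure Cfg (M : Machine A) where
  state : M.State
  inputHead : ℕ
  work : Fin M.tapes → ℤ → M.WorkSym
  workHead : Fin M.tapes → ℤ

/-- The initial configuration: all work tapes are blank. -/
def initCfg (M : Machine A) : M.Cfg where
  state := M.start
  inputHead := 0
  work := fun _ _ => M.blank
  workHead := fun _ => 0

/-- One step of the machine on the input `w`; `none` if the machine has halted. -/
def step (M : Machine A) (w : List A) (c : M.Cfg) : Option M.Cfg :=
  (M.trans c.state (inputCell w c.inputHead) (fun i => c.work i (c.workHead i))).map
    fun r =>
      { state := r.1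
        inputHead := moveInput w.length r.2.1 c.inputHead
        work := fun i => Function.update (c.work i) (c.workHead i) (r.2.2 i).1
        workHead := fun i => moveWork (r.2.2 i).2 (c.workHead i) }

/-- The configuration `c` occurs in the run of the machine on the input `w`. -/
def Visits (M : Machine A) (w : List A) (c : M.Cfg) : Prop :=
  Relation.ReflTransGen (fun c₁ c₂ => M.step w c₁ = some c₂) M.initCfg c

/-- The machine halts on every input, and it accepts exactly the words of `X`. -/
def Decides (M : Machine A) (X : Language A) : Prop :=
  ∀ w : List A, ∃ c : M.Cfg, M.Visits w c ∧ M.step w c = none ∧ (c.state ∈ M.accept ↔ w ∈ X)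

/-- On inputs of length `n` the machine uses `O(log n)` cells of its work tapes. -/
def RunsInLogspace (M : Machine A) : Prop :=
  ∃ C : ℕ, ∀ (w : List A) (c : M.Cfg), M.Visits w c →
    ∀ i, (c.workHead i).natAbs ≤ C * (Nat.log 2 w.length + 1)

end Machine

/-- The language `X` over the finite alphabet `A` belongs to deterministic logspace. -/
def InLogspace {A : Type u} [Finite A] (X : Language A) : Prop :=
  ∃ M : Machine A, M.Decides X ∧ M.RunsInLogspace

end Logspace

/-! ### Words over the node groups of a graph product and their dependence graphs -/

namespace GraphProduct

/-- The word problem of a group with respect to a finite set `S` of generators. -/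
def wordProblem {H : Type v} [Group H] (S : Finset H) : Language S :=
  {w | (w.map Subtype.val).prod = 1}

section

variable {L : Type u} (G : L → Type v) [∀ α, Group (G α)]

/-- The (in general infinite) alphabet `Γ`: the disjoint union of the sets `G α \ {1}`. -/
def Letter : Type (max u v) :=
  {x : Σ α, G α // x.2 ≠ 1}

end

section

variable {L : Type u} {G : L → Type v} [∀ α, Group (G α)]

/-- The node of the independence graph to which a letter belongs. -/
def Letter.node (a : Letter G) : L := a.1.1

/-- The arcs of the dependence graph of a word `w` over `Γ`. Its vertices are the positions of `w`,
and there is an arc from `i` to `j` if `i < j` and the letters at `i` and `j` belong to nodes that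
are not independent (in particular if they belong to the same node). -/
def dependenceGraph (I : SimpleGraph L) (w : List (Letter G)) : Digraph (Fin w.length) where
  Adj i j := i < j ∧ ¬ I.Adj (w.get i).node (w.get j).node

/-- `w ≡ w'`: the dependence graphs of `w` and `w'` are isomorphic as node-labelled directed
graphs, where a position is labelled by the letter at this position. -/
def DepEquiv (I : SimpleGraph L) (w w' : List (Letter G)) : Prop :=
  ∃ e : Fin w.length ≃ Fin w'.length,
    (∀ i, w'.get (e i) = w.get i) ∧
    ∀ i j, (dependenceGraph I w').Adj (e i) (e j) ↔ (dependenceGraph I w).Adj i j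

/-- The finite alphabet in which inputs are written: the generators of the node groups, two
brackets, and a separator. -/
inductive Token (S : ∀ α, Finset (G α)) : Type (max u v)
  | gen (α : L) (s : S α)
  | opening
  | closing
  | sep

instance Token.instFinite [Finite L] (S : ∀ α, Finset (G α)) : Finite (Token S) := by
  refine Finite.of_surjective
    (fun x : (Σ α, S α) ⊕ Fin 3 =>
      match x with
      | Sum.inl y => Token.gen y.1 y.2
      | Sum.inr 0 => Token.opening
      | Sum.inr 1 => Token.closing
      | Sum.inr 2 => Token.sep) ?_
  intro t
  cases t with
  | gen α s => exact ⟨Sum.inl ⟨α, s⟩, rfl⟩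
  | opening => exact ⟨Sum.inr 0, rfl⟩
  | closing => exact ⟨Sum.inr 1, rfl⟩
  | sep => exact ⟨Sum.inr 2, rfl⟩

/-- The string `[u₁]⋯[uₙ]`, where each `uᵢ` is a word over the generators of one node group. -/
def code {S : ∀ α, Finset (G α)} (b : List (Σ α, List (S α))) : List (Token S) :=
  b.flatMap fun x => Token.opening :: (x.2.map (Token.gen x.1) ++ [Token.closing])

/-- `[u₁]⋯[uₙ]` represents `w = a₁⋯aₙ`: the word `uᵢ` over the generators of `G α` has the value
`aᵢ ∈ G α \ {1}`. -/
def Represents {S : ∀ α, Finset (G α)} (b : List (Σ α, List (S α))) (w : List (Letter G)) : Prop :=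
  b.map (fun x => (⟨x.1, (x.2.map Subtype.val).prod⟩ : Σ α, G α)) = w.map Subtype.val

/-- Factor pattern matching on dependence graphs: the inputs are the pairs `p`, `t` of words over
`Γ`, written as `[u₁]⋯[uₘ] sep [v₁]⋯[vₙ]`, and the question is whether `t ≡ x p y` for some words
`x`, `y` over `Γ`. -/
def patternMatching (I : SimpleGraph L) (S : ∀ α, Finset (G α)) : Language (Token S) :=
  {z | ∃ (bp bt : List (Σ α, List (S α))) (p t : List (Letter G)),
    z = code bp ++ Token.sep :: code bt ∧ Represents bp p ∧ Represents bt t ∧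
    ∃ x y : List (Letter G), DepEquiv I t (x ++ p ++ y)}

end

end GraphProduct

/-! Combinatorially, everything is decided by projections to two nodes. Call two nodes dependent if
they are not adjacent in `I`; every node is dependent on itself. The letters of two dependent nodes
form a chain in the dependence graph, so an isomorphism preserves their order (`DepEquiv.proj_eq`);
conversely, the projections to all dependent pairs determine the dependence graph up to isomorphism
(`depEquiv_of_proj`). Hence `t ≡ x p y` is solvable if and only if there is a single vector `κ`, the
number of letters of each node in `x`, such that for every dependent pair the projection of `p` is a
factor of the projection of `t`, preceded by exactly `κ α` and `κ β` letters of the two nodes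
(`exists_depEquiv_append_iff`). The factors found for different pairs fit together because their
cuts agree node by node.

Since `L` is finite, `κ` is a tuple of fixed length whose entries are at most the input length, so
all candidates can be tried in logarithmic space. For a fixed `κ` the condition speaks only of
positions and counts: a letter of a projection is identified by how many letters of the two nodes
precede it (`occurs_iff`, `mem_patternMatching_iff`). The only group theory is the comparison of two
letters of one node: `u` and `v` have the same value exactly if `u v⁻¹` has value 1, and this is an
instance of the word problem because the generators are closed under inversion.

On the machine side, the model is first replaced by register programs with polynomially bounded
registers. A register becomes a binary counter on its own tape, which takes logarithmic space
(`exists_impl`, `inLogspace_of_exec`). `LS` is the class of functions computed by such programs and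
`LSP` the class of predicates; they are closed under composition, iteration with polynomially
bounded iterates (`LS.while`), bounded recursion, counting and bounded quantification. The word
problem has to be queried on words that are too long to be written down. `InLogspace.lsp` simulates
its machine on a virtual input: a configuration is packed into a tuple of polynomially bounded
numbers, and each letter is recomputed when the head reads it. Running times are never estimated;
only the sizes of the registers matter. -/

namespace Logspace

/-! ### Register programs over an input word -/

/-- A test of a register program. -/
inductive Test (A : Type u) : Type u
  | nonzero (i : ℕ)
  | sees (p : InSym A → Bool)

/-- Register programs that can move a head on the input. -/
inductive Cmd (A : Type u) : Type u
  | inc (i : ℕ)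
  | dec (i : ℕ)
  | move (d : Move)
  | seq (c c' : Cmd A)
  | cond (t : Test A) (c : Cmd A)
  | loop (t : Test A) (c : Cmd A)

/-- The position of the input head and the contents of the registers. -/
abbrev Store := ℕ × (ℕ → ℕ)

/-- The test `t` succeeds in the store `s`. -/
def Test.Holds {A : Type u} (w : List A) : Test A → Store → Prop
  | nonzero i, s => s.2 i ≠ 0
  | sees p, s => p (inputCell w s.1) = true

/-- Big-step semantics of register programs in which no register is incremented beyond `B`. -/
inductive Exec {A : Type u} (w : List A) (B : ℕ) : Cmd A → Store → Store → Prop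
  | inc (i : ℕ) (s : Store) (h : s.2 i + 1 ≤ B) :
      Exec w B (.inc i) s (s.1, Function.update s.2 i (s.2 i + 1))
  | dec (i : ℕ) (s : Store) (h : s.2 i ≠ 0) :
      Exec w B (.dec i) s (s.1, Function.update s.2 i (s.2 i - 1))
  | move (d : Move) (s : Store) : Exec w B (.move d) s (moveInput w.length d s.1, s.2)
  | seq {c c' : Cmd A} {s s' s'' : Store} (h : Exec w B c s s') (h' : Exec w B c' s' s'') :
      Exec w B (.seq c c') s s''
  | cond_true {t : Test A} {c : Cmd A} {s s' : Store} (ht : t.Holds w s) (h : Exec w B c s s') :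
      Exec w B (.cond t c) s s'
  | cond_false {t : Test A} {c : Cmd A} {s : Store} (ht : ¬ t.Holds w s) :
      Exec w B (.cond t c) s s
  | loop_true {t : Test A} {c : Cmd A} {s s' s'' : Store} (ht : t.Holds w s)
      (h : Exec w B c s s') (h' : Exec w B (.loop t c) s' s'') : Exec w B (.loop t c) s s''
  | loop_false {t : Test A} {c : Cmd A} {s : Store} (ht : ¬ t.Holds w s) :
      Exec w B (.loop t c) s s

theorem Exec.mono {A : Type u} {w : List A} {B B' : ℕ} (hB : B ≤ B') {c : Cmd A} {s s' : Store}
    (h : Exec w B c s s') : Exec w B' c s s' := by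
  induction h with
  | inc i s h => exact .inc i s (h.trans hB)
  | dec i s h => exact .dec i s h
  | move d s => exact .move d s
  | seq _ _ ih ih' => exact .seq ih ih'
  | cond_true ht _ ih => exact .cond_true ht ih
  | cond_false ht => exact .cond_false ht
  | loop_true ht _ _ ih ih' => exact .loop_true ht ih ih'
  | loop_false ht => exact .loop_false ht

/-! ### Machine components with exits -/

/-- The input head and the work tapes of a machine. -/
structure Data (K : ℕ) where
  inputHead : ℕ
  work : Fin K → ℤ → Option Bool
  workHead : Fin K → ℤ

namespace Data

variable {K : ℕ}

/-- Carry out the head movements and the writing of one step. -/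
def apply (n : ℕ) (D : Data K) (r : Move × (Fin K → Option Bool × Move)) : Data K where
  inputHead := moveInput n r.1 D.inputHead
  work := fun i => Function.update (D.work i) (D.workHead i) (r.2 i).1
  workHead := fun i => moveWork (r.2 i).2 (D.workHead i)

/-- All work heads are at distance at most `R` from the origin. -/
def Within (R : ℕ) (D : Data K) : Prop := ∀ i, (D.workHead i).natAbs ≤ R

/-- The symbols under the work heads. -/
def reads (D : Data K) : Fin K → Option Bool := fun i => D.work i (D.workHead i)

/-- Replace the tape `i` and the position of its head. -/
def withTape (D : Data K) (i : Fin K) (f : ℤ → Option Bool) (h : ℤ) : Data K where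
  inputHead := D.inputHead
  work := Function.update D.work i f
  workHead := Function.update D.workHead i h

/-- The action that writes `s` on tape `i`, moves the head of this tape, and changes nothing
else. -/
def only (i : Fin K) (x : Fin K → Option Bool) (s : Option Bool) (m : Move) :
    Move × (Fin K → Option Bool × Move) :=
  (Move.stay, Function.update (fun j => (x j, Move.stay)) i (s, m))

theorem withTape_self (D : Data K) (i : Fin K) : D.withTape i (D.work i) (D.workHead i) = D := by
  simp [withTape]

@[simp]
theorem reads_withTape (D : Data K) (i : Fin K) (f : ℤ → Option Bool) (h : ℤ) :
    (D.withTape i f h).reads i = f h := by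
  simp [withTape, reads]

theorem apply_only (n : ℕ) (D : Data K) (i : Fin K) (f : ℤ → Option Bool) (h : ℤ) (s : Option Bool)
    (m : Move) :
    (D.withTape i f h).apply n (only i (D.withTape i f h).reads s m) =
      D.withTape i (Function.update f h s) (moveWork m h) := by
  simp only [apply, only, withTape, reads, moveInput, Data.mk.injEq, true_and]
  constructor <;> funext j <;> rcases eq_or_ne j i with rfl | hj <;> simp [*, moveWork]

theorem apply_stay (n : ℕ) (D : Data K) (d : Move) :
    D.apply n (d, fun j => (D.reads j, Move.stay)) =
      { D with inputHead := moveInput n d D.inputHead } := by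
  simp [apply, reads, moveWork]

theorem Within.withTape {R : ℕ} {D : Data K} (hD : D.Within R) (i : Fin K)
    (f : ℤ → Option Bool) {h : ℤ} (hh : h.natAbs ≤ R) : (D.withTape i f h).Within R := by
  intro j
  rcases eq_or_ne j i with rfl | hj
  · simpa [Data.withTape] using hh
  · simpa [Data.withTape, hj] using hD j

end Data

/-- A part of a machine that can be left through several exits. -/
structure Component (A : Type u) (K : ℕ) (E : Type) where
  State : Type
  finite_state : Finite State
  start : State
  trans : State → InSym A → (Fin K → Option Bool) →
    (State ⊕ E) × (Move × (Fin K → Option Bool × Move))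

namespace Component

variable {A : Type u} {K : ℕ} {E E₁ E₂ : Type}

/-- One step of a component. -/
def next (M : Component A K E) (w : List A) (q : M.State) (D : Data K) :
    (M.State ⊕ E) × Data K :=
  ((M.trans q (inputCell w D.inputHead) D.reads).1,
    D.apply w.length (M.trans q (inputCell w D.inputHead) D.reads).2)

/-- The component `M` started in `(q, D)` is left through the exit `e` with `D'`, and the work
heads remain within distance `R` of the origin. -/
inductive Run (M : Component A K E) (w : List A) (R : ℕ) : M.State → Data K → E → Data K → Prop
  | exit {q : M.State} {D D' : Data K} {e : E} (hD : D.Within R) (hD' : D'.Within R)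
      (h : M.next w q D = (Sum.inr e, D')) : Run M w R q D e D'
  | step {q q' : M.State} {D D' D'' : Data K} {e : E} (hD : D.Within R)
      (h : M.next w q D = (Sum.inl q', D')) (h' : Run M w R q' D' e D'') : Run M w R q D e D''

/-- The state in which a linked component continues: the start of the first or the second part, or
an exit. -/
def route (M₁ : Component A K E₁) (M₂ : Component A K E₂) :
    Bool ⊕ E → (M₁.State ⊕ M₂.State) ⊕ E
  | Sum.inl false => Sum.inl (Sum.inl M₁.start)
  | Sum.inl true => Sum.inl (Sum.inr M₂.start)
  | Sum.inr e => Sum.inr e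

/-- Two components whose exits lead to the start of one of them (`false` for the first, `true` for
the second) or to an exit. -/
def link (M₁ : Component A K E₁) (M₂ : Component A K E₂) (r₁ : E₁ → Bool ⊕ E)
    (r₂ : E₂ → Bool ⊕ E) : Component A K E where
  State := M₁.State ⊕ M₂.State
  finite_state := by
    have := M₁.finite_state
    have := M₂.finite_state
    infer_instance
  start := Sum.inl M₁.start
  trans q a x :=
    match q with
    | Sum.inl q =>
      ((M₁.trans q a x).1.elim (fun q' => Sum.inl (Sum.inl q')) (fun e => route M₁ M₂ (r₁ e)),
        (M₁.trans q a x).2)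
    | Sum.inr q =>
      ((M₂.trans q a x).1.elim (fun q' => Sum.inl (Sum.inr q')) (fun e => route M₁ M₂ (r₂ e)),
        (M₂.trans q a x).2)

section link

variable {M₁ : Component A K E₁} {M₂ : Component A K E₂} {r₁ : E₁ → Bool ⊕ E}
  {r₂ : E₂ → Bool ⊕ E} {w : List A} {R : ℕ}

theorem Run.link_left_exit {q : M₁.State} {D D' : Data K} {e₁ : E₁} {e : E}
    (h : M₁.Run w R q D e₁ D') (hr : r₁ e₁ = Sum.inr e) :
    (link M₁ M₂ r₁ r₂).Run w R (Sum.inl q) D e D' := by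
  induction h with
  | exit hD hD' h =>
    refine .exit hD hD' ?_
    simp only [next, Prod.mk.injEq] at h
    simp [next, link, h.1, h.2, hr, route]
  | step hD h _ ih =>
    refine .step hD ?_ (ih hr)
    simp only [next, Prod.mk.injEq] at h
    simp [next, link, h.1, h.2]

theorem Run.link_right_exit {q : M₂.State} {D D' : Data K} {e₂ : E₂} {e : E}
    (h : M₂.Run w R q D e₂ D') (hr : r₂ e₂ = Sum.inr e) :
    (link M₁ M₂ r₁ r₂).Run w R (Sum.inr q) D e D' := by
  induction h with
  | exit hD hD' h =>
    refine .exit hD hD' ?_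
    simp only [next, Prod.mk.injEq] at h
    simp [next, link, h.1, h.2, hr, route]
  | step hD h _ ih =>
    refine .step hD ?_ (ih hr)
    simp only [next, Prod.mk.injEq] at h
    simp [next, link, h.1, h.2]

theorem Run.link_left {q : M₁.State} {D D' D'' : Data K} {e₁ : E₁} {e : E} {b : Bool ⊕ E}
    {q' : M₁.State ⊕ M₂.State}
    (h : M₁.Run w R q D e₁ D') (hr : r₁ e₁ = b) (hb : route M₁ M₂ b = Sum.inl q')
    (h' : (link M₁ M₂ r₁ r₂).Run w R q' D' e D'') :
    (link M₁ M₂ r₁ r₂).Run w R (Sum.inl q) D e D'' := by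
  induction h with
  | exit hD hD' h =>
    refine .step hD ?_ h'
    simp only [next, Prod.mk.injEq] at h
    simp [next, link, h.1, h.2, hr, hb]
  | step hD h _ ih =>
    refine .step hD ?_ (ih hr h')
    simp only [next, Prod.mk.injEq] at h
    simp [next, link, h.1, h.2]

theorem Run.link_right {q : M₂.State} {D D' D'' : Data K} {e₂ : E₂} {e : E} {b : Bool ⊕ E}
    {q' : M₁.State ⊕ M₂.State}
    (h : M₂.Run w R q D e₂ D') (hr : r₂ e₂ = b) (hb : route M₁ M₂ b = Sum.inl q')
    (h' : (link M₁ M₂ r₁ r₂).Run w R q' D' e D'') :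
    (link M₁ M₂ r₁ r₂).Run w R (Sum.inr q) D e D'' := by
  induction h with
  | exit hD hD' h =>
    refine .step hD ?_ h'
    simp only [next, Prod.mk.injEq] at h
    simp [next, link, h.1, h.2, hr, hb]
  | step hD h _ ih =>
    refine .step hD ?_ (ih hr h')
    simp only [next, Prod.mk.injEq] at h
    simp [next, link, h.1, h.2]

end link

/-- The component with one state that moves the input head and branches on the symbol it sees. -/
def look (d : Move) (f : InSym A → E) : Component A K E where
  State := Unit
  finite_state := inferInstance
  start := ()
  trans _ a x := (Sum.inr (f a), (d, fun j => (x j, Move.stay)))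

theorem look_run (d : Move) (f : InSym A → E) (w : List A) {R : ℕ} {D : Data K}
    (hD : D.Within R) :
    (look d f : Component A K E).Run w R () D (f (inputCell w D.inputHead))
      { D with inputHead := moveInput w.length d D.inputHead } := by
  refine .exit hD hD ?_
  rw [← Data.apply_stay]
  rfl

/-- Walk to the right on tape `i`, applying `g` to the cells, until `go` returns an exit; then walk
back to the left end of the word on the tape. -/
def walk [Finite E] (i : Fin K) (go : Option Bool → Option E) (g : Option Bool → Option Bool) :
    Component A K E where
  State := Option E
  finite_state := inferInstance
  start := none
  trans q _ x :=
    match q with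
    | none =>
      match go (x i) with
      | none => (Sum.inl none, Data.only i x (g (x i)) Move.right)
      | some e => (Sum.inl (some e), Data.only i x (g (x i)) Move.left)
    | some e =>
      match x i with
      | none => (Sum.inr e, Data.only i x none Move.right)
      | some b => (Sum.inl (some e), Data.only i x (some b) Move.left)

end Component

/-- The tape that holds the word `l` in the cells `0, 1, …` and is blank elsewhere. -/
def listTape (l : List Bool) : ℤ → Option Bool := fun z => if 0 ≤ z then l[z.toNat]? else none

theorem listTape_append (l l' : List Bool) : listTape (l ++ l') l.length = l'.head? := by
  cases l' <;> simp [listTape]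

theorem update_listTape (l : List Bool) (b : Bool) (l' : List Bool) :
    Function.update (listTape (l ++ l')) l.length (some b) = listTape (l ++ b :: l'.tail) := by
  funext z
  rcases eq_or_ne z l.length with rfl | hz
  · simp [listTape]
  · rw [Function.update_of_ne hz]
    unfold listTape
    split_ifs with h
    · obtain ⟨n, rfl⟩ := Int.eq_ofNat_of_zero_le h
      simp only [Int.toNat_natCast]
      rcases lt_trichotomy n l.length with h1 | h1 | h1
      · rw [List.getElem?_append_left h1, List.getElem?_append_left h1]
      · exact absurd (by rw [h1]) hz
      · rw [List.getElem?_append_right h1.le, List.getElem?_append_right h1.le]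
        obtain ⟨k, hk⟩ : ∃ k, n - l.length = k + 1 := ⟨n - l.length - 1, by omega⟩
        rw [hk]
        cases l' <;> simp
    · rfl

/-! ### Correctness of walking along a tape and back. -/

namespace Component

variable {A : Type u} {K : ℕ} {E : Type}

/-- The effect of `walk` on the word on the tape. -/
inductive Walks (go : Option Bool → Option E) (g : Option Bool → Option Bool) :
    List Bool → List Bool → E → Prop
  | nil {e : E} (h : go none = some e) : Walks go g [] (g none).toList e
  | halt {b b' : Bool} {l : List Bool} {e : E} (h : go (some b) = some e)
      (h' : g (some b) = some b') : Walks go g (b :: l) (b' :: l) e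
  | cont {b b' : Bool} {l l' : List Bool} {e : E} (h : go (some b) = none)
      (h' : g (some b) = some b') (hl : Walks go g l l' e) : Walks go g (b :: l) (b' :: l') e

variable [Finite E] {i : Fin K} {go : Option Bool → Option E} {g : Option Bool → Option Bool}
  {w : List A} {R : ℕ}

/-- The blank cell `-1` serves as the left end marker: the head overshoots onto it, recognises the
blank and steps back to cell `0`. The head is at `k - 1`, so `k` cells of the word remain to be
crossed. -/
theorem walk_back {D : Data K} (hD : D.Within R) (l : List Bool) (hR : l.length + 1 ≤ R) (e : E)
    (k : ℕ) (hk : k ≤ l.length) :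
    (walk i go g : Component A K E).Run w R (some e) (D.withTape i (listTape l) ((k : ℤ) - 1)) e
      (D.withTape i (listTape l) 0) := by
  induction k with
  | zero =>
    have h1 : listTape l ((0 : ℕ) - 1) = none := by simp [listTape]
    refine .exit (hD.withTape _ _ (by omega)) (hD.withTape _ _ (by simp)) ?_
    simp only [next, walk, Data.reads_withTape, h1, Data.apply_only]
    have h2 : Function.update (listTape l) ((0 : ℕ) - 1) none = listTape l := by
      rw [← h1, Function.update_eq_self]
    rw [h2]
    simp [moveWork]
  | succ k ih =>
    have h1 : listTape l ((k + 1 : ℕ) - 1) = some (l[k]'(by omega)) := by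
      have : (((k + 1 : ℕ) : ℤ) - 1) = (k : ℤ) := by push_cast; ring
      rw [this]
      simp [listTape]
    refine .step (hD.withTape _ _ (by omega)) ?_ (ih (by omega))
    simp only [next, walk, Data.reads_withTape, h1, Data.apply_only]
    rw [← h1, Function.update_eq_self]
    simp [moveWork]

/-- The induction needs a prefix `l₀` of cells already rewritten. Two spare cells suffice: one for a
digit appended at the right end and one for the overshoot to the left. -/
theorem walk_run {D : Data K} (hD : D.Within R) {l l' : List Bool} {e : E}
    (h : Walks go g l l' e) (l₀ : List Bool) (hR : l₀.length + l.length + 2 ≤ R) :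
    (walk i go g : Component A K E).Run w R none (D.withTape i (listTape (l₀ ++ l)) l₀.length) e
      (D.withTape i (listTape (l₀ ++ l')) 0) := by
  induction h generalizing l₀ with
  | @nil e h =>
    have h1 := listTape_append l₀ []
    refine .step (q' := some e) (D' := D.withTape i (listTape (l₀ ++ (g none).toList))
      ((l₀.length : ℤ) - 1)) (hD.withTape _ _ (by simp at hR ⊢; omega)) ?_
      (walk_back hD _ ?_ e _ (by simp))
    · simp only [next, walk, Data.reads_withTape, h1, List.head?_nil, h, Data.apply_only]
      cases hg : g none with
      | none =>
        have : Function.update (listTape (l₀ ++ [])) l₀.length none = listTape (l₀ ++ []) := by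
          conv_lhs => rw [← List.head?_nil (α := Bool), ← h1, Function.update_eq_self]
        rw [this]
        simp [moveWork]
      | some b =>
        rw [update_listTape]
        simp [moveWork]
    · cases g none <;> simp at hR ⊢ <;> omega
  | @halt b b' l e h h' =>
    have h1 := listTape_append l₀ (b :: l)
    refine .step (q' := some e) (D' := D.withTape i (listTape (l₀ ++ b' :: l))
      ((l₀.length : ℤ) - 1)) (hD.withTape _ _ (by simp at hR ⊢; omega)) ?_
      (walk_back hD _ (by simp at hR ⊢; omega) e _ (by simp))
    simp only [next, walk, Data.reads_withTape, h1, List.head?_cons, h, h', Data.apply_only,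
      update_listTape]
    simp [moveWork]
  | @cont b b' l l' e h h' hl ih =>
    have h1 := listTape_append l₀ (b :: l)
    have := ih (l₀ ++ [b']) (by simp at hR ⊢; omega)
    simp only [List.append_assoc, List.cons_append, List.nil_append] at this
    refine .step (hD.withTape _ _ (by simp at hR ⊢; omega)) ?_ this
    simp only [next, walk, Data.reads_withTape, h1, List.head?_cons, h, h', Data.apply_only,
      update_listTape]
    simp [moveWork]

end Component

/-! ### Binary counters -/

/-- The number with the binary digits `l`, least significant digit first. -/
def bitsVal : List Bool → ℕ
  | [] => 0
  | b :: l => 2 * bitsVal l + b.toNat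

/-- The result of adding one to (`x = true`) or subtracting one from (`x = false`) a counter. -/
def bump (x : Bool) : List Bool → List Bool
  | [] => [x]
  | b :: l => if b = x then (!x) :: bump x l else x :: l

theorem bitsVal_bump_true (l : List Bool) : bitsVal (bump true l) = bitsVal l + 1 := by
  induction l with
  | nil => rfl
  | cons b l ih => cases b <;> simp [bump, bitsVal, ih]; ring

/-- The word gets longer only if all its digits are `true`, and then the new value is a power of two
whose top digit is the new one. Decrementing keeps leading zeros, so the length reflects the largest
value ever allowed and not the current one. -/
theorem length_bump_true (l : List Bool) :
    2 ^ (bump true l).length ≤ max (2 ^ l.length) (2 * bitsVal (bump true l)) := by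
  induction l with
  | nil => simp [bump, bitsVal]
  | cons b l ih =>
    cases b
    · simp [bump]
    · simp only [bump, if_true, bitsVal, List.length_cons, pow_succ, Bool.not_true,
        Bool.toNat_false]
      omega

theorem bitsVal_bump_false (l : List Bool) (h : bitsVal l ≠ 0) :
    bitsVal (bump false l) = bitsVal l - 1 ∧ (bump false l).length = l.length := by
  induction l with
  | nil => exact absurd rfl h
  | cons b l ih =>
    cases b
    · simp only [bitsVal, Bool.toNat_false, add_zero] at h
      obtain ⟨h1, h2⟩ := ih (by omega)
      simp only [bump, if_true, bitsVal, h1, Bool.not_false, Bool.toNat_true, Bool.toNat_false,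
        List.length_cons, h2, and_true]
      omega
    · simp [bump, bitsVal]

/-- The carry (or borrow) travels over the digits equal to `x`, flipping them, and stops at the
first other digit or at the end of the word. -/
theorem walks_bump (x : Bool) (l : List Bool) :
    Component.Walks (fun s => if s = some x then none else some ())
      (fun s => if s = some x then some (!x) else some x) l (bump x l) () := by
  induction l with
  | nil => exact .nil (by simp)
  | cons b l ih =>
    rcases eq_or_ne b x with rfl | hb
    · simpa [bump] using Component.Walks.cont (by simp) (by simp) ih
    · simpa [bump, hb] using Component.Walks.halt (by simp [hb]) (by simp [hb])

theorem walks_test (l : List Bool) :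
    Component.Walks (fun s => if s = some false then none else some s.isSome) id l l
      (decide (bitsVal l ≠ 0)) := by
  induction l with
  | nil => exact .nil (by simp [bitsVal])
  | cons b l ih =>
    cases b
    · convert Component.Walks.cont (b := false) (b' := false) (by simp) (by simp) ih using 2
      simp [bitsVal]
    · have : decide (bitsVal (true :: l) ≠ 0) = true := by simp [bitsVal]
      rw [this]
      exact .halt rfl rfl

/-! ### Compilation of register programs -/

/-- The data `D` represents the store `s`: the register `i` is written in binary on tape `i`. -/
def Rep {K : ℕ} (B : ℕ) (s : Store) (D : Data K) : Prop :=
  D.inputHead = s.1 ∧ ∀ i : Fin K, ∃ l : List Bool, bitsVal l = s.2 i ∧ 2 ^ l.length ≤ 2 * B ∧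
    D.work i = listTape l ∧ D.workHead i = 0

theorem Rep.within {K B R : ℕ} {s : Store} {D : Data K} (h : Rep B s D) : D.Within R := by
  intro i
  obtain ⟨l, -, -, -, h⟩ := h.2 i
  simp [h]

theorem Rep.withTape {K B : ℕ} {s : Store} {D : Data K} (h : Rep B s D) (i : Fin K) (x : ℕ)
    (l : List Bool) (hl : bitsVal l = x) (hB : 2 ^ l.length ≤ 2 * B) :
    Rep B (s.1, Function.update s.2 i x) (D.withTape i (listTape l) 0) := by
  refine ⟨h.1, fun j => ?_⟩
  rcases eq_or_ne j i with rfl | hj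
  · exact ⟨l, by simpa using hl, hB, by simp [Data.withTape], by simp [Data.withTape]⟩
  · obtain ⟨l', h1, h2, h3, h4⟩ := h.2 j
    refine ⟨l', ?_, h2, ?_, ?_⟩
    · simpa [Function.update_of_ne (fun h' => hj (Fin.ext h'))] using h1
    · simpa [Data.withTape, hj] using h3
    · simpa [Data.withTape, hj] using h4

/-- The space needed for registers with values at most `B`. -/
def spaceBound (B : ℕ) : ℕ := Nat.log 2 (2 * B) + 2

theorem length_le_spaceBound {B : ℕ} {l : List Bool} (h : 2 ^ l.length ≤ 2 * B) :
    l.length + 2 ≤ spaceBound B := by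
  have := Nat.le_log_of_pow_le (by norm_num) h
  unfold spaceBound
  omega

/-- Walking on the tape of a register. -/
theorem Rep.walk_run {A : Type u} {K B : ℕ} {E : Type} [Finite E] {s : Store} {D : Data K}
    (h : Rep B s D) (i : Fin K) {go : Option Bool → Option E} {g : Option Bool → Option Bool}
    (w : List A) {f : List Bool → List Bool} {e : List Bool → E}
    (hw : ∀ l, Component.Walks go g l (f l) (e l)) :
    ∃ l, bitsVal l = s.2 i ∧ 2 ^ l.length ≤ 2 * B ∧ D.withTape i (listTape l) 0 = D ∧
      (Component.walk i go g : Component A K E).Run w (spaceBound B) none D (e l)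
        (D.withTape i (listTape (f l)) 0) := by
  obtain ⟨l, h1, h2, h3, h4⟩ := h.2 i
  have h5 : D.withTape i (listTape l) 0 = D := by rw [← h3, ← h4, Data.withTape_self]
  refine ⟨l, h1, h2, h5, ?_⟩
  have := Component.walk_run (A := A) (i := i) (w := w) (R := spaceBound B) (D := D) h.within
    (hw l) [] (by simpa using length_le_spaceBound h2)
  simp only [List.nil_append, List.length_nil, Nat.cast_zero] at this
  rwa [h5] at this

/-- The component `M` implements the test `t`. -/
def ImplTest {A : Type u} {K : ℕ} (t : Test A) (M : Component A K Bool) : Prop :=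
  ∀ (w : List A) (B : ℕ) (s : Store) (D : Data K), Rep B s D →
    ∃ b : Bool, (b = true ↔ t.Holds w s) ∧ M.Run w (spaceBound B) M.start D b D

theorem exists_implTest {A : Type u} (t : Test A) :
    ∃ K₀, ∀ K, K₀ ≤ K → ∃ M : Component A K Bool, ImplTest t M := by
  cases t with
  | nonzero i =>
    refine ⟨i + 1, fun K hK => ⟨Component.walk ⟨i, hK⟩
      (fun s => if s = some false then none else some s.isSome) id, fun w B s D h => ?_⟩⟩
    obtain ⟨l, h1, h2, h3, h4⟩ := h.walk_run (A := A) ⟨i, hK⟩ w (f := id) walks_test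
    rw [id, h3] at h4
    exact ⟨_, by simp [Test.Holds, h1], h4⟩
  | sees p =>
    refine ⟨0, fun K _ => ⟨Component.look Move.stay p, fun w B s D h => ?_⟩⟩
    exact ⟨_, by simp [Test.Holds, h.1], Component.look_run Move.stay p w h.within⟩

/-- The component `M` implements the program `c`. -/
def Impl {A : Type u} {K : ℕ} (c : Cmd A) (M : Component A K Unit) : Prop :=
  ∀ (w : List A) (B : ℕ) (s s' : Store) (D : Data K), Exec w B c s s' → Rep B s D →
    ∃ D', Rep B s' D' ∧ M.Run w (spaceBound B) M.start D () D'

/-- Components can be linked only if they have the same number of tapes, so the induction produces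
an implementation for every sufficiently large `K`. -/
theorem exists_impl {A : Type u} (c : Cmd A) :
    ∃ K₀, ∀ K, K₀ ≤ K → ∃ M : Component A K Unit, Impl c M := by
  induction c with
  | inc i =>
    refine ⟨i + 1, fun K hK => ⟨Component.walk ⟨i, hK⟩
      (fun s => if s = some true then none else some ())
      (fun s => if s = some true then some (!true) else some true), fun w B s s' D hs h => ?_⟩⟩
    obtain ⟨l, h1, h2, h3, h4⟩ := h.walk_run (A := A) ⟨i, hK⟩ w (walks_bump true)
    cases hs with
    | inc _ _ hB =>
      have h5 : bitsVal (bump true l) = s.2 i + 1 := by rw [bitsVal_bump_true, h1]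
      exact ⟨_, h.withTape ⟨i, hK⟩ _ _ h5
        ((length_bump_true l).trans (max_le h2 (by rw [h5]; omega))), h4⟩
  | dec i =>
    refine ⟨i + 1, fun K hK => ⟨Component.walk ⟨i, hK⟩
      (fun s => if s = some false then none else some ())
      (fun s => if s = some false then some (!false) else some false), fun w B s s' D hs h => ?_⟩⟩
    obtain ⟨l, h1, h2, h3, h4⟩ := h.walk_run (A := A) ⟨i, hK⟩ w (walks_bump false)
    cases hs with
    | dec _ _ h0 =>
      obtain ⟨h5, h6⟩ := bitsVal_bump_false l (by rwa [h1])
      exact ⟨_, h.withTape ⟨i, hK⟩ _ _ (h5.trans (by rw [h1])) (by rwa [h6]), h4⟩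
  | move d =>
    refine ⟨0, fun K _ => ⟨Component.look d (fun _ => ()), fun w B s s' D hs h => ?_⟩⟩
    cases hs
    exact ⟨{ D with inputHead := moveInput w.length d D.inputHead },
      ⟨congrArg (moveInput w.length d) h.1, h.2⟩, Component.look_run d _ w h.within⟩
  | seq c c' ih ih' =>
    obtain ⟨K₁, ih⟩ := ih
    obtain ⟨K₂, ih'⟩ := ih'
    refine ⟨max K₁ K₂, fun K hK => ?_⟩
    obtain ⟨M, hM⟩ := ih K (le_trans (le_max_left _ _) hK)
    obtain ⟨M', hM'⟩ := ih' K (le_trans (le_max_right _ _) hK)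
    refine ⟨Component.link M M' (fun _ => Sum.inl true) Sum.inr, fun w B s s' D hs h => ?_⟩
    cases hs with
    | seq h1 h2 =>
      obtain ⟨D₁, hD₁, hr₁⟩ := hM w B _ _ D h1 h
      obtain ⟨D₂, hD₂, hr₂⟩ := hM' w B _ _ D₁ h2 hD₁
      exact ⟨D₂, hD₂, hr₁.link_left rfl rfl (hr₂.link_right_exit rfl)⟩
  | cond t c ih =>
    obtain ⟨K₁, ht⟩ := exists_implTest t
    obtain ⟨K₂, ih⟩ := ih
    refine ⟨max K₁ K₂, fun K hK => ?_⟩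
    obtain ⟨M, hM⟩ := ht K (le_trans (le_max_left _ _) hK)
    obtain ⟨M', hM'⟩ := ih K (le_trans (le_max_right _ _) hK)
    refine ⟨Component.link M M' (fun b => if b then Sum.inl true else Sum.inr ()) Sum.inr,
      fun w B s s' D hs h => ?_⟩
    obtain ⟨b, hb, hr⟩ := hM w B s D h
    cases hs with
    | cond_true ht h1 =>
      obtain ⟨D', hD', hr'⟩ := hM' w B _ _ D h1 h
      exact ⟨D', hD', hr.link_left (if_pos (hb.2 ht)) rfl (hr'.link_right_exit rfl)⟩
    | cond_false ht =>
      exact ⟨D, h, hr.link_left_exit (if_neg fun hb' => ht (hb.1 hb'))⟩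
  | loop t c ih =>
    obtain ⟨K₁, ht⟩ := exists_implTest t
    obtain ⟨K₂, ih⟩ := ih
    refine ⟨max K₁ K₂, fun K hK => ?_⟩
    obtain ⟨M, hM⟩ := ht K (le_trans (le_max_left _ _) hK)
    obtain ⟨M', hM'⟩ := ih K (le_trans (le_max_right _ _) hK)
    refine ⟨Component.link M M' (fun b => if b then Sum.inl true else Sum.inr ())
      (fun _ => Sum.inl false), fun w B s s' D hs h => ?_⟩
    -- The number of rounds is not visible in the program, so a loop needs a second induction, on
    -- its execution.
    generalize hc : Cmd.loop t c = c' at hs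
    induction hs generalizing D with
    | inc => cases hc
    | dec => cases hc
    | move => cases hc
    | seq => cases hc
    | cond_true => cases hc
    | cond_false => cases hc
    | @loop_true t c s s' s'' ht h1 h2 _ ih2 =>
      cases hc
      obtain ⟨b, hb, hr⟩ := hM w B _ D h
      obtain ⟨D₁, hD₁, hr₁⟩ := hM' w B _ _ D h1 h
      obtain ⟨D₂, hD₂, hr₂⟩ := ih2 D₁ hD₁ rfl
      exact ⟨D₂, hD₂, hr.link_left (if_pos (hb.2 ht)) rfl (hr₁.link_right rfl rfl hr₂)⟩
    | loop_false ht =>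
      cases hc
      obtain ⟨b, hb, hr⟩ := hM w B _ D h
      exact ⟨D, h, hr.link_left_exit (if_neg fun hb' => ht (hb.1 hb'))⟩

/-! ### From components to machines -/

namespace Component

variable {A : Type u} {K : ℕ}

/-- The machine that runs a component and accepts if it is left through the exit `true`. -/
def toMachine (M : Component A K Bool) : Machine A where
  State := M.State ⊕ Bool
  finite_state := by
    have := M.finite_state
    infer_instance
  WorkSym := Option Bool
  finite_workSym := inferInstance
  blank := none
  tapes := K
  start := Sum.inl M.start
  accept := {Sum.inr true}
  trans q a x :=
    match q with
    | Sum.inl q => some (M.trans q a x)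
    | Sum.inr _ => none

/-- The configuration of `M.toMachine` with the given state and data. -/
def cfg (M : Component A K Bool) (q : M.State ⊕ Bool) (D : Data K) : M.toMachine.Cfg where
  state := q
  inputHead := D.inputHead
  work := D.work
  workHead := D.workHead

theorem toMachine_step (M : Component A K Bool) (w : List A) (q : M.State) (D : Data K) :
    M.toMachine.step w (M.cfg (Sum.inl q) D) =
      some (M.cfg (M.next w q D).1 (M.next w q D).2) := rfl

/-- The machine is deterministic, so every reachable configuration lies on the given run. This turns
a space bound along one run into a bound for all visited configurations. -/
theorem Run.toMachine {M : Component A K Bool} {w : List A} {R : ℕ} {q : M.State} {D D' : Data K}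
    {b : Bool} (h : M.Run w R q D b D') :
    Relation.ReflTransGen (fun c₁ c₂ => M.toMachine.step w c₁ = some c₂)
        (M.cfg (Sum.inl q) D) (M.cfg (Sum.inr b) D') ∧
      ∀ c, Relation.ReflTransGen (fun c₁ c₂ => M.toMachine.step w c₁ = some c₂)
        (M.cfg (Sum.inl q) D) c → ∀ i, (c.workHead i).natAbs ≤ R := by
  induction h with
  | @exit q D D' e hD hD' h =>
    have hs := M.toMachine_step w q D
    rw [h] at hs
    refine ⟨.single hs, fun c hc => ?_⟩
    rcases hc.cases_head with rfl | ⟨c', h1, h2⟩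
    · exact hD
    · rw [hs] at h1
      cases h1
      rcases h2.cases_head with rfl | ⟨c', h1, h2⟩
      · exact hD'
      · exact absurd h1 (by simp [Machine.step, Component.toMachine, cfg])
  | @step q q' D D' D'' e hD h _ ih =>
    have hs := M.toMachine_step w q D
    rw [h] at hs
    refine ⟨.head hs ih.1, fun c hc => ?_⟩
    rcases hc.cases_head with rfl | ⟨c', h1, h2⟩
    · exact hD
    · rw [hs] at h1
      cases h1
      exact ih.2 c h2

end Component

theorem spaceBound_le (d n : ℕ) :
    spaceBound ((n + 2) ^ d) ≤ (3 * d + 3) * (Nat.log 2 n + 1) := by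
  have h1 : n + 2 ≤ 2 ^ (Nat.log 2 n + 2) := by
    have := Nat.lt_pow_succ_log_self (b := 2) (by norm_num) n
    have h2 := Nat.one_le_two_pow (n := Nat.log 2 n + 1)
    rw [pow_succ]
    have h3 : 2 ≤ 2 ^ (Nat.log 2 n + 1) := by
      rw [pow_succ]; have := Nat.one_le_two_pow (n := Nat.log 2 n); omega
    simp only [Nat.succ_eq_add_one] at this
    omega
  have h2 : 2 * (n + 2) ^ d ≤ 2 ^ ((Nat.log 2 n + 2) * d + 1) := by
    rw [pow_succ, pow_mul, mul_comm]
    exact Nat.mul_le_mul_right 2 (Nat.pow_le_pow_left h1 d)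
  have h3 : Nat.log 2 (2 * (n + 2) ^ d) ≤ (Nat.log 2 n + 2) * d + 1 := by
    calc _ ≤ Nat.log 2 (2 ^ ((Nat.log 2 n + 2) * d + 1)) := Nat.log_mono_right h2
      _ = _ := Nat.log_pow (by norm_num) _
  unfold spaceBound
  nlinarith

/-- A language decided by a register program with polynomially bounded registers is in logspace. -/
theorem inLogspace_of_exec {A : Type u} [Finite A] (X : Language A) (c : Cmd A) (d : ℕ)
    (h : ∀ w : List A, ∃ s, Exec w ((w.length + 2) ^ d) c (0, fun _ => 0) s ∧
      (s.2 0 ≠ 0 ↔ w ∈ X)) : InLogspace X := by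
  obtain ⟨K₁, h₁⟩ := exists_impl c
  obtain ⟨K₂, h₂⟩ := exists_implTest (A := A) (.nonzero 0)
  obtain ⟨M₁, hM₁⟩ := h₁ (max K₁ K₂) (le_max_left _ _)
  obtain ⟨M₂, hM₂⟩ := h₂ (max K₁ K₂) (le_max_right _ _)
  let M : Component A (max K₁ K₂) Bool :=
    Component.link M₁ M₂ (fun _ => Sum.inl true) Sum.inr
  let D₀ : Data (max K₁ K₂) := ⟨0, fun _ _ => none, fun _ => 0⟩
  have key : ∀ w : List A, ∃ b D, (b = true ↔ w ∈ X) ∧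
      M.Run w (spaceBound ((w.length + 2) ^ d)) M.start D₀ b D := by
    intro w
    obtain ⟨s, hs, hX⟩ := h w
    have hD₀ : Rep ((w.length + 2) ^ d) (0, fun _ => 0) D₀ := by
      refine ⟨rfl, fun i => ⟨[], rfl, ?_, ?_, rfl⟩⟩
      · have : 0 < (w.length + 2) ^ d := by positivity
        simp only [List.length_nil, pow_zero]
        omega
      · funext z
        simp [listTape, D₀]
    obtain ⟨D₁, hD₁, hr₁⟩ := hM₁ w _ _ _ _ hs hD₀
    obtain ⟨b, hb, hr₂⟩ := hM₂ w _ _ _ hD₁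
    exact ⟨b, D₁, hb.trans hX, hr₁.link_left rfl rfl (hr₂.link_right_exit rfl)⟩
  refine ⟨M.toMachine, fun w => ?_, 3 * d + 3, fun w c hc i => ?_⟩
  · obtain ⟨b, D, hb, hr⟩ := key w
    refine ⟨M.cfg (Sum.inr b) D, hr.toMachine.1, rfl, ?_⟩
    rw [← hb]
    show (Sum.inr b : M.State ⊕ Bool) ∈ ({Sum.inr true} : Set _) ↔ _
    simp
  · obtain ⟨b, D, hb, hr⟩ := key w
    exact (hr.toMachine.2 c hc i).trans (spaceBound_le d w.length)

end Logspace

namespace Logspace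

variable {A : Type u}

/-! ### Programs with polynomially bounded registers -/

/-- Whenever `P w σ σ'` holds, the program `c` transforms the registers `σ` into `σ'` on the input
`w`, and all register values are bounded by a fixed power of each bound on `|w| + 2` and `σ`. -/
def Spec (c : Cmd A) (P : List A → (ℕ → ℕ) → (ℕ → ℕ) → Prop) : Prop :=
  ∃ d, ∀ (w : List A) (N pos : ℕ) (σ σ' : ℕ → ℕ), w.length + 2 ≤ N → (∀ i, σ i ≤ N) → P w σ σ' →
    ∃ pos', Exec w (N ^ d) c (pos, σ) (pos', σ')

/-- Only increments enlarge a register, and they are guarded by `B`. The resulting bound on the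
final registers is what lets a subsequent program start. -/
theorem Exec.le {w : List A} {B : ℕ} {c : Cmd A} {s s' : Store} (h : Exec w B c s s')
    (hs : ∀ i, s.2 i ≤ B) : ∀ i, s'.2 i ≤ B := by
  induction h with
  | inc i s h =>
    intro j
    rcases eq_or_ne j i with rfl | hj
    · simpa using h
    · simpa [hj] using hs j
  | dec i s h =>
    intro j
    rcases eq_or_ne j i with rfl | hj
    · simpa using (Nat.sub_le _ _).trans (hs j)
    · simpa [hj] using hs j
  | move d s => exact hs
  | seq _ _ ih ih' => exact ih' (ih hs)
  | cond_true ht _ ih => exact ih hs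
  | cond_false ht => exact hs
  | loop_true ht _ _ ih ih' => exact ih' (ih hs)
  | loop_false ht => exact hs

theorem self_le_pow_succ (N d : ℕ) (h : 1 ≤ N) : N ≤ N ^ (d + 1) := by
  rw [pow_succ]
  exact Nat.le_mul_of_pos_left _ (Nat.pow_pos h)

/-- The exponent in `Spec` can be chosen positive. -/
theorem Spec.exists_succ {c : Cmd A} {P : List A → (ℕ → ℕ) → (ℕ → ℕ) → Prop} (h : Spec c P) :
    ∃ d, ∀ (w : List A) (N pos : ℕ) (σ σ' : ℕ → ℕ), w.length + 2 ≤ N → (∀ i, σ i ≤ N) → P w σ σ' →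
      (∀ i, σ' i ≤ N ^ (d + 1)) ∧ ∃ pos', Exec w (N ^ (d + 1)) c (pos, σ) (pos', σ') := by
  obtain ⟨d, hd⟩ := h
  refine ⟨d, fun w N pos σ σ' hN hσ hP => ?_⟩
  obtain ⟨pos', h⟩ := hd w N pos σ σ' hN hσ hP
  have h := h.mono (Nat.pow_le_pow_right (by omega) (Nat.le_succ d))
  exact ⟨h.le fun i => (hσ i).trans (self_le_pow_succ N d (by omega)), pos', h⟩

theorem Spec.mono {c : Cmd A} {P P' : List A → (ℕ → ℕ) → (ℕ → ℕ) → Prop} (h : Spec c P)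
    (hP : ∀ w σ σ', P' w σ σ' → P w σ σ') : Spec c P' := by
  obtain ⟨d, hd⟩ := h
  exact ⟨d, fun w N pos σ σ' hN hσ h' => hd w N pos σ σ' hN hσ (hP _ _ _ h')⟩

/-- The second program starts from registers bounded by a power of `N`, and this power plays the
role of `N` for it; so the exponents multiply. -/
theorem Spec.seq {c c' : Cmd A} {P P' : List A → (ℕ → ℕ) → (ℕ → ℕ) → Prop} (h : Spec c P)
    (h' : Spec c' P') : Spec (.seq c c') (fun w σ σ'' => ∃ σ', P w σ σ' ∧ P' w σ' σ'') := by
  obtain ⟨d, hd⟩ := h.exists_succ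
  obtain ⟨d', hd'⟩ := h'.exists_succ
  refine ⟨(d + 1) * (d' + 1), ?_⟩
  rintro w N pos σ σ'' hN hσ ⟨σ', hP, hP'⟩
  obtain ⟨h1, pos', h2⟩ := hd w N pos σ σ' hN hσ hP
  have hN' := self_le_pow_succ N d (by omega)
  obtain ⟨-, pos'', h3⟩ := hd' w (N ^ (d + 1)) pos' σ' σ'' (hN.trans hN') h1 hP'
  rw [← pow_mul] at h3
  exact ⟨pos'', .seq (h2.mono (Nat.pow_le_pow_right (by omega) (Nat.le_mul_of_pos_right _
    (by omega)))) h3⟩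

theorem Spec.inc (i : ℕ) :
    Spec (A := A) (.inc i) (fun _ σ σ' => σ' = Function.update σ i (σ i + 1)) := by
  refine ⟨2, ?_⟩
  rintro w N pos σ _ hN hσ rfl
  refine ⟨pos, .inc i (pos, σ) ?_⟩
  have := hσ i
  show σ i + 1 ≤ _
  nlinarith

theorem Spec.dec (i : ℕ) :
    Spec (A := A) (.dec i) (fun _ σ σ' => σ i ≠ 0 ∧ σ' = Function.update σ i (σ i - 1)) := by
  refine ⟨2, ?_⟩
  rintro w N pos σ _ hN hσ ⟨h, rfl⟩
  exact ⟨pos, .dec i (pos, σ) h⟩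

theorem Spec.cond {c : Cmd A} {P : List A → (ℕ → ℕ) → (ℕ → ℕ) → Prop} (h : Spec c P) (r : ℕ) :
    Spec (.cond (.nonzero r) c)
      (fun w σ σ' => (σ r ≠ 0 ∧ P w σ σ') ∨ (σ r = 0 ∧ σ' = σ)) := by
  obtain ⟨d, hd⟩ := h
  refine ⟨d, ?_⟩
  rintro w N pos σ σ' hN hσ (⟨h0, h1⟩ | ⟨h0, rfl⟩)
  · obtain ⟨pos', h⟩ := hd w N pos σ σ' hN hσ h1
    exact ⟨pos', .cond_true h0 h⟩
  · exact ⟨pos, .cond_false (fun h => h h0)⟩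

/-- Applying the bound of the body round after round would multiply exponents without limit.
Therefore one exponent `e`, valid for all intermediate states `f j`, is demanded from outside; each
round then costs only the exponent of the body over `N ^ (e + 1)`. -/
theorem Spec.loop {c : Cmd A} {P : List A → (ℕ → ℕ) → (ℕ → ℕ) → Prop} (h : Spec c P) (r e : ℕ) :
    Spec (.loop (.nonzero r) c) (fun w σ σ' => ∃ (t : ℕ) (f : ℕ → ℕ → ℕ), f 0 = σ ∧ f t = σ' ∧
      (∀ j < t, f j r ≠ 0 ∧ P w (f j) (f (j + 1))) ∧ σ' r = 0 ∧
      ∀ N, w.length + 2 ≤ N → (∀ i, σ i ≤ N) → ∀ j ≤ t, ∀ i, f j i ≤ N ^ e) := by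
  obtain ⟨d, hd⟩ := h
  refine ⟨(e + 1) * d, ?_⟩
  rintro w N pos σ σ' hN hσ ⟨t, f, h0, ht, hj, hr, hb⟩
  have hb := hb N hN hσ
  have key : ∀ k j pos, j + k = t →
      ∃ pos', Exec w (N ^ ((e + 1) * d)) (.loop (.nonzero r) c) (pos, f j) (pos', σ') := by
    intro k
    induction k with
    | zero =>
      intro j pos hjk
      obtain rfl : j = t := hjk
      rw [ht]
      exact ⟨pos, .loop_false (fun h => h hr)⟩
    | succ k ih =>
      intro j pos hjk
      obtain ⟨hn, hP⟩ := hj j (by omega)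
      have hN' := self_le_pow_succ N e (by omega)
      obtain ⟨pos', h1⟩ := hd w (N ^ (e + 1)) pos _ _ (hN.trans hN')
        (fun i => (hb j (by omega) i).trans (Nat.pow_le_pow_right (by omega) (by omega))) hP
      obtain ⟨pos'', h2⟩ := ih (j + 1) pos' (by omega)
      rw [← pow_mul] at h1
      exact ⟨pos'', .loop_true hn h1 h2⟩
  rw [← h0]
  exact key t 0 pos (by omega)

/-- Set the register `r` to zero. -/
def Cmd.clear (r : ℕ) : Cmd A := .loop (.nonzero r) (.dec r)

theorem Spec.clear (r : ℕ) :
    Spec (A := A) (.clear r) (fun _ σ σ' => σ' = Function.update σ r 0) := by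
  refine ((Spec.dec r).loop r 1).mono ?_
  rintro w σ _ rfl
  refine ⟨σ r, fun j => Function.update σ r (σ r - j), by simp, by simp, fun j hj => ⟨?_, ?_, ?_⟩,
    by simp, fun N _ hσ j _ i => ?_⟩
  · simp; omega
  · simp; omega
  · funext i
    rcases eq_or_ne i r with rfl | hi <;> simp [*]
    omega
  · rcases eq_or_ne i r with rfl | hi
    · simpa using (hσ i).trans (Nat.le_add_right _ _)
    · simpa [hi] using hσ i

/-- Move the contents of the register `r` to the register `s`. -/
def Cmd.mv (r s : ℕ) : Cmd A :=
  .seq (.clear s) (.loop (.nonzero r) (.seq (.dec r) (.inc s)))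

theorem two_mul_le_sq {N x y n : ℕ} (hN : n + 2 ≤ N) (hx : x ≤ N) (hy : y ≤ N) :
    x + y ≤ N ^ 2 := by
  nlinarith

theorem Spec.mv {r s : ℕ} (hrs : r ≠ s) : Spec (A := A) (.mv r s)
    (fun _ σ σ' => σ' = Function.update (Function.update σ s (σ r)) r 0) := by
  refine ((Spec.clear s).seq (((Spec.dec r).seq (Spec.inc s)).loop r 2)).mono ?_
  rintro w σ _ rfl
  refine ⟨_, rfl, σ r, fun j => Function.update (Function.update σ s j) r (σ r - j), ?_, by simp,
    fun j hj => ⟨?_, ?_⟩, by simp, fun N hN hσ j hj i => ?_⟩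
  · funext i
    rcases eq_or_ne i r with rfl | hi <;> simp [*]
  · simp; omega
  · refine ⟨_, ⟨by simp; omega, rfl⟩, ?_⟩
    funext i
    rcases eq_or_ne i r with rfl | hi
    · simp [hrs]; omega
    · rcases eq_or_ne i s with rfl | hi' <;> simp [*]
  · have h1 := hσ r
    have h2 := hσ i
    have h3 := hσ s
    simp only [Function.update_apply, hrs, if_false] at h1 h2
    split_ifs at h2 <;> simp only [Function.update_apply] <;> split_ifs <;>
      first | contradiction | nlinarith [Nat.sub_le (σ r) j]

/-- Copy the register `r` to the register `s`, with the help of the register `t`. -/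
def Cmd.copy (r s t : ℕ) : Cmd A :=
  .seq (.loop (.nonzero r) (.seq (.dec r) (.seq (.inc s) (.inc t)))) (.mv t r)

theorem Spec.copy {r s t : ℕ} (hrs : r ≠ s) (hrt : r ≠ t) (hst : s ≠ t) :
    Spec (A := A) (.copy r s t)
      (fun _ σ σ' => σ s = 0 ∧ σ t = 0 ∧ σ' = Function.update σ s (σ r)) := by
  refine ((((Spec.dec r).seq ((Spec.inc s).seq (Spec.inc t))).loop r 2).seq
    (Spec.mv hrt.symm)).mono ?_
  rintro w σ _ ⟨hs, ht, rfl⟩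
  refine ⟨_, ⟨σ r, fun j => Function.update (Function.update (Function.update σ t j) s j) r
    (σ r - j), ?_, rfl, fun j hj => ⟨?_, ?_⟩, by simp, fun N hN hσ j hj i => ?_⟩, ?_⟩
  · funext i
    rcases eq_or_ne i r with rfl | hi
    · simp
    · rcases eq_or_ne i s with rfl | hi'
      · simp [hi, hs]
      · rcases eq_or_ne i t with rfl | hi'' <;> simp [*]
  · simp; omega
  · refine ⟨_, ⟨by simp; omega, rfl⟩, _, rfl, ?_⟩
    funext i
    rcases eq_or_ne i r with rfl | hi
    · simp [hrs, hrt]; omega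
    · rcases eq_or_ne i s with rfl | hi'
      · simp [*]
      · rcases eq_or_ne i t with rfl | hi'' <;> simp [*]
  · have h1 := hσ r
    have h2 := hσ i
    simp only [Function.update_apply]
    split_ifs <;> nlinarith [Nat.sub_le (σ r) j]
  · funext i
    rcases eq_or_ne i r with rfl | hi
    · simp [hrs, hrt, hrt.symm, hst.symm]
    · rcases eq_or_ne i s with rfl | hi'
      · simp [*]
      · rcases eq_or_ne i t with rfl | hi'' <;> simp [*]

/-- Do nothing. -/
def Cmd.skip : Cmd A := .cond (.sees fun _ => false) (.dec 0)

theorem Spec.skip : Spec (A := A) .skip (fun _ σ σ' => σ' = σ) := by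
  refine ⟨0, ?_⟩
  rintro w N pos σ _ hN hσ rfl
  exact ⟨pos, .cond_false (by simp [Test.Holds])⟩

/-- Set the registers `m, …, m + k - 1` to zero. -/
def Cmd.clearBlock (m : ℕ) : ℕ → Cmd A
  | 0 => .skip
  | k + 1 => .seq (.clearBlock m k) (.clear (m + k))

theorem Spec.clearBlock (m k : ℕ) : Spec (A := A) (.clearBlock m k)
    (fun _ σ σ' => σ' = fun i => if m ≤ i ∧ i < m + k then 0 else σ i) := by
  induction k with
  | zero =>
    refine Spec.skip.mono ?_
    rintro w σ _ rfl
    funext i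
    rw [if_neg (by omega)]
  | succ k ih =>
    refine (ih.seq (Spec.clear _)).mono ?_
    rintro w σ _ rfl
    refine ⟨_, rfl, ?_⟩
    funext i
    simp only [Function.update_apply]
    split_ifs <;> first | rfl | omega

/-- Shift the contents of the registers `m + δ, …, m + δ + k - 1` down by `δ`. -/
def Cmd.shift (m δ : ℕ) : ℕ → Cmd A
  | 0 => .skip
  | k + 1 => .seq (.shift m δ k) (.mv (m + k + δ) (m + k))

theorem Spec.shift (m δ k : ℕ) (hδ : δ = 0 → k = 0) : Spec (A := A) (.shift m δ k)
    (fun _ σ σ' => σ' = fun i => if m ≤ i ∧ i < m + k then σ (i + δ) else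
      if m + δ ≤ i ∧ i < m + δ + k then 0 else σ i) := by
  induction k with
  | zero =>
    refine Spec.skip.mono ?_
    rintro w σ _ rfl
    funext i
    rw [if_neg (by omega), if_neg (by omega)]
  | succ k ih =>
    refine ((ih (by omega)).seq (Spec.mv (by omega))).mono ?_
    rintro w σ _ rfl
    refine ⟨_, rfl, ?_⟩
    funext i
    simp only [Function.update_apply]
    rcases eq_or_ne i (m + k) with rfl | h
    · rw [if_pos (by omega), if_neg (by omega), if_pos rfl, if_neg (by omega), if_neg (by omega)]
    · rw [if_neg h]
      split_ifs <;> first | rfl | omega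

/-! ### Functions computable in logarithmic space -/

/-- Types whose elements are tuples of natural numbers. -/
class Ctx (α : Type v) where
  dim : ℕ
  get : α → ℕ → ℕ

namespace Ctx

instance : Ctx ℕ := ⟨1, fun n _ => n⟩

instance : Ctx Unit := ⟨0, fun _ _ => 0⟩

instance {α β : Type*} [Ctx α] [Ctx β] : Ctx (α × β) :=
  ⟨dim α + dim β, fun x i => if i < dim α then get x.1 i else get x.2 (i - dim α)⟩

instance (t : ℕ) : Ctx (Fin t → ℕ) := ⟨t, fun x i => if h : i < t then x ⟨i, h⟩ else 0⟩

end Ctx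

@[simp]
theorem Ctx.get_nat (n i : ℕ) : Ctx.get n i = n := rfl

/-- Write the values `v 0, …, v (k - 1)` into the registers `m, …, m + k - 1`. -/
def put (σ : ℕ → ℕ) (m k : ℕ) (v : ℕ → ℕ) : ℕ → ℕ :=
  fun i => if m ≤ i ∧ i < m + k then v (i - m) else σ i

theorem put_apply (σ : ℕ → ℕ) {m k : ℕ} (v : ℕ → ℕ) {i : ℕ} (hi : i < k) :
    put σ m k v (m + i) = v i := by
  simp [put, hi]

theorem put_of_lt (σ : ℕ → ℕ) {m : ℕ} (k : ℕ) (v : ℕ → ℕ) {i : ℕ} (hi : i < m) :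
    put σ m k v i = σ i := by
  simp only [put, if_neg (show ¬ (m ≤ i ∧ i < m + k) by omega)]

theorem put_of_ge (σ : ℕ → ℕ) {m k : ℕ} (v : ℕ → ℕ) {i : ℕ} (hi : m + k ≤ i) :
    put σ m k v i = σ i := by
  simp only [put, if_neg (show ¬ (m ≤ i ∧ i < m + k) by omega)]

theorem put_nat (σ : ℕ → ℕ) (m n : ℕ) :
    put σ m (Ctx.dim ℕ) (Ctx.get n) = Function.update σ m n := by
  funext i
  simp only [put, Ctx.get, Ctx.dim, Function.update_apply]
  split_ifs <;> first | rfl | omega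

open Ctx

/-- The registers `args` hold the value `a`, and the registers from `m` on are empty. -/
def Holds {α : Type v} [Ctx α] (σ : ℕ → ℕ) (args : ℕ → ℕ) (m : ℕ) (a : α) : Prop :=
  (∀ i < dim α, σ (args i) = get a i) ∧ ∀ i, m ≤ i → σ i = 0

/-- The function `f`, relative to an input word, is computed by register programs whose registers
are polynomially bounded: for any choice `args` of argument registers below `m`, there is a program
that writes the value of `f` into the registers from `m` on, using these registers as its memory. -/
def LS {α β : Type*} [Ctx α] [Ctx β] (f : List A → α → β) : Prop :=
  ∀ (args : ℕ → ℕ) (m : ℕ), (∀ i < dim α, args i < m) → ∃ c : Cmd A, Spec c fun w σ σ' =>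
    ∃ a, Holds σ args m a ∧ σ' = put σ m (dim β) (get (f w a))

/-- The values of `f` are polynomially bounded. -/
def PolyBdd {α β : Type*} [Ctx α] [Ctx β] (f : List A → α → β) : Prop :=
  ∃ d, ∀ (w : List A) (N : ℕ) (a : α), w.length + 2 ≤ N → (∀ i < dim α, get a i ≤ N) →
    ∀ i < dim β, get (f w a) i ≤ N ^ d

section

variable {α β γ : Type*} [Ctx α] [Ctx β] [Ctx γ]

/-- The values of `f` end up in registers, whose contents are polynomially bounded by the meaning of
`Spec`. It is enough to run one program, with the arguments in the first registers. -/
theorem LS.polyBdd {f : List A → α → β} (hf : LS f) : PolyBdd f := by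
  obtain ⟨c, hc⟩ := hf id (dim α) (fun i hi => hi)
  obtain ⟨d, hd⟩ := hc.exists_succ
  refine ⟨d + 1, fun w N a hN ha i hi => ?_⟩
  obtain ⟨h, -⟩ := hd w N 0 (fun i => if i < dim α then get a i else 0) _ hN
    (fun i => by split_ifs with h; exacts [ha i h, Nat.zero_le _])
    ⟨a, ⟨fun i hi => if_pos hi, fun i hi => if_neg (by omega)⟩, rfl⟩
  simpa [put_apply _ _ hi] using h (dim α + i)

theorem LS.congr {f g : List A → α → β} (hf : LS f)
    (h : ∀ w a, ∀ i < dim β, get (f w a) i = get (g w a) i) : LS g := by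
  intro args m hm
  obtain ⟨c, hc⟩ := hf args m hm
  refine ⟨c, hc.mono ?_⟩
  rintro w σ _ ⟨a, ha, rfl⟩
  refine ⟨a, ha, ?_⟩
  funext i
  simp only [put]
  split_ifs with hi
  · exact (h w a _ (by omega)).symm
  · rfl

theorem LS.comp {g : List A → β → γ} {f : List A → α → β} (hg : LS g) (hf : LS f) :
    LS fun w a => g w (f w a) := by
  intro args m hm
  -- The intermediate value is put at `m + 1` rather than `m`, so that the final shift has a
  -- positive offset even if `dim β = 0`.
  obtain ⟨c, hc⟩ := hf args (m + 1) (fun i hi => (hm i hi).trans (Nat.lt_succ_self m))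
  obtain ⟨c', hc'⟩ := hg (fun i => m + 1 + i) (m + 1 + dim β) (fun i hi => by omega)
  refine ⟨_, (((hc.seq hc').seq (Spec.shift m (1 + dim β) (dim γ) (by omega))).seq
    (Spec.clearBlock (m + dim γ) (1 + dim β))).mono ?_⟩
  rintro w σ _ ⟨a, ha, rfl⟩
  refine ⟨_, ⟨_, ⟨_, ⟨a, ⟨ha.1, fun i hi => ha.2 i (by omega)⟩, rfl⟩, f w a,
    ⟨fun i hi => put_apply _ _ hi, fun i hi => ?_⟩, rfl⟩, rfl⟩, ?_⟩
  · rw [put_of_ge _ _ hi]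
    exact ha.2 i (by omega)
  · funext i
    have h0 := ha.2 i
    simp only [put]
    split_ifs <;> first | rfl | omega | (congr 1; omega)

theorem LS.get (j : ℕ) (hj : j < dim α) : LS fun (_ : List A) (a : α) => Ctx.get a j := by
  intro args m hm
  have := hm j hj
  refine ⟨_, (Spec.copy (r := args j) (s := m) (t := m + 1) (by omega) (by omega)
    (by omega)).mono ?_⟩
  rintro w σ _ ⟨a, ha, rfl⟩
  exact ⟨ha.2 _ le_rfl, ha.2 _ (by omega), by rw [ha.1 j hj, put_nat]⟩

/-- The coordinates are computed one after the other, each directly above those already written. The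
arguments lie below `m` and are never overwritten, so they are available for every coordinate. -/
theorem LS.of_get {f : List A → α → β} (h : ∀ j < dim β, LS fun w a => Ctx.get (f w a) j) :
    LS f := by
  intro args m hm
  have key : ∀ k ≤ dim β, ∃ c : Cmd A, Spec c fun w σ σ' =>
      ∃ a, Holds σ args m a ∧ σ' = put σ m k (Ctx.get (f w a)) := by
    intro k
    induction k with
    | zero =>
      intro _
      refine ⟨_, Spec.skip.mono ?_⟩
      rintro w σ _ ⟨a, -, rfl⟩
      funext i
      rw [put, if_neg (by omega)]
    | succ k ih =>
      intro hk
      obtain ⟨c, hc⟩ := ih (by omega)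
      obtain ⟨c', hc'⟩ := h k (by omega) args (m + k) (fun i hi => (hm i hi).trans_le (by omega))
      refine ⟨_, (hc.seq hc').mono ?_⟩
      rintro w σ _ ⟨a, ha, rfl⟩
      refine ⟨_, ⟨a, ha, rfl⟩, a, ⟨fun i hi => ?_, fun i hi => ?_⟩, ?_⟩
      · rw [put_of_lt _ _ _ (hm i hi)]
        exact ha.1 i hi
      · rw [put_of_ge _ _ hi]
        exact ha.2 i (by omega)
      · funext i
        simp only [put, Ctx.get, dim]
        split_ifs <;> first | rfl | omega | (congr 1; omega)
  exact key _ le_rfl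

theorem LS.fst : LS fun (_ : List A) (x : α × β) => x.1 :=
  .of_get fun j hj => (LS.get (α := α × β) j (by simp only [dim]; omega)).congr fun w a i _ => by
    simp [Ctx.get, hj]

theorem LS.snd : LS fun (_ : List A) (x : α × β) => x.2 :=
  .of_get fun j hj => (LS.get (α := α × β) (dim α + j) (by simp only [dim]; omega)).congr
    fun w a i _ => by simp [Ctx.get]

theorem LS.id : LS fun (_ : List A) (x : α) => x := .of_get fun j hj => LS.get j hj

theorem LS.pair {f : List A → α → β} {g : List A → α → γ} (hf : LS f) (hg : LS g) :
    LS fun w a => (f w a, g w a) := by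
  refine .of_get fun j hj => ?_
  rcases lt_or_ge j (dim β) with h | h
  · exact ((LS.get j h).comp hf).congr fun w a i _ => by simp [Ctx.get, h]
  · simp only [dim] at hj
    exact ((LS.get (j - dim β) (by omega)).comp hg).congr fun w a i _ => by simp [Ctx.get, h]

theorem LS.pi {t : ℕ} {f : List A → α → Fin t → ℕ} (hf : ∀ i, LS fun w a => f w a i) :
    LS f := by
  refine .of_get fun j hj => ?_
  refine (hf ⟨j, hj⟩).congr fun w a i _ => ?_
  exact (dif_pos (c := j < t) (t := fun h => f w a ⟨j, h⟩) (e := fun _ => 0) hj).symm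

theorem LS.proj {t : ℕ} (i : Fin t) : LS fun (_ : List A) (x : Fin t → ℕ) => x i :=
  (LS.get (α := Fin t → ℕ) i.1 i.2).congr fun w a j _ => by simp [Ctx.get]

/-! ### Basic functions -/

theorem LS.const_nat (n : ℕ) : LS fun (_ : List A) (_ : α) => n := by
  intro args m hm
  have key : ∃ c : Cmd A, Spec c fun _ σ σ' => σ m = 0 ∧ σ' = Function.update σ m n := by
    induction n with
    | zero =>
      refine ⟨_, Spec.skip.mono ?_⟩
      rintro w σ _ ⟨h, rfl⟩
      rw [← h, Function.update_eq_self]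
    | succ n ih =>
      obtain ⟨c, hc⟩ := ih
      refine ⟨_, (hc.seq (Spec.inc m)).mono ?_⟩
      rintro w σ _ ⟨h, rfl⟩
      exact ⟨_, ⟨h, rfl⟩, by simp⟩
  obtain ⟨c, hc⟩ := key
  refine ⟨c, hc.mono ?_⟩
  rintro w σ _ ⟨a, ha, rfl⟩
  exact ⟨ha.2 _ le_rfl, put_nat _ _ _⟩

theorem LS.succ : LS fun (_ : List A) (n : ℕ) => n + 1 := by
  intro args m hm
  have := hm 0 Nat.one_pos
  refine ⟨_, ((Spec.copy (r := args 0) (s := m) (t := m + 1) (by omega) (by omega)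
    (by omega)).seq (Spec.inc m)).mono ?_⟩
  rintro w σ _ ⟨a, ha, rfl⟩
  refine ⟨_, ⟨ha.2 _ le_rfl, ha.2 _ (by omega), rfl⟩, ?_⟩
  rw [ha.1 0 Nat.one_pos]
  simp [put_nat]

theorem LS.pred : LS fun (_ : List A) (n : ℕ) => n - 1 := by
  intro args m hm
  have := hm 0 Nat.one_pos
  refine ⟨_, ((Spec.copy (r := args 0) (s := m) (t := m + 1) (by omega) (by omega)
    (by omega)).seq ((Spec.dec m).cond m)).mono ?_⟩
  rintro w σ _ ⟨a, ha, rfl⟩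
  refine ⟨_, ⟨ha.2 _ le_rfl, ha.2 _ (by omega), rfl⟩, ?_⟩
  rw [ha.1 0 Nat.one_pos]
  rw [put_nat]
  rcases Nat.eq_zero_or_pos a with rfl | h0
  · right
    simp
  · left
    simp [h0.ne']

theorem LS.isZero : LS fun (_ : List A) (n : ℕ) => if n = 0 then 1 else 0 := by
  intro args m hm
  have := hm 0 Nat.one_pos
  refine ⟨_, ((Spec.inc m).seq ((Spec.dec m).cond (args 0))).mono ?_⟩
  rintro w σ _ ⟨a, ha, rfl⟩
  refine ⟨_, rfl, ?_⟩
  have h1 : σ (args 0) = a := ha.1 0 Nat.one_pos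
  have h2 : σ m = 0 := ha.2 m le_rfl
  have h3 : args 0 ≠ m := by omega
  rw [put_nat]
  rcases Nat.eq_zero_or_pos a with rfl | h0
  · right
    simp [h1, h2, h3]
  · left
    simp [h1, h2, h3, h0.ne']

/-- Move the input head to the left end marker. -/
theorem exec_rewind (w : List A) (B pos : ℕ) (σ : ℕ → ℕ) :
    Exec w B (.loop (.sees fun | .leftEnd => false | _ => true) (.move .left)) (pos, σ) (0, σ) := by
  induction pos with
  | zero => exact .loop_false (by simp [Test.Holds, inputCell])
  | succ n ih =>
    refine .loop_true ?_ (.move _ _) ih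
    simp only [Test.Holds, inputCell]
    cases w[n]? <;> simp

theorem exec_advance (w : List A) (B pos m x : ℕ) (σ : ℕ → ℕ) (h : σ m = x) :
    Exec w B (.loop (.nonzero m) (.seq (.dec m) (.move .right))) (min pos (w.length + 1), σ)
      (min (pos + x) (w.length + 1), Function.update σ m 0) := by
  induction x generalizing pos σ with
  | zero =>
    rw [← h, Function.update_eq_self, h]
    exact .loop_false (by simp [Test.Holds, h])
  | succ x ih =>
    have := ih (pos + 1) (Function.update σ m x) (by simp)
    rw [Function.update_idem, add_assoc, add_comm 1 x] at this
    have h1 : min (min pos (w.length + 1) + 1) (w.length + 1) =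
      min (pos + 1) (w.length + 1) := by omega
    rw [← h1] at this
    refine .loop_true (by simp [Test.Holds, h]) (.seq (.dec m _ (by simp [h])) (.move _ _)) ?_
    simpa [h, moveInput] using this

theorem inputCell_min (w : List A) (x : ℕ) :
    inputCell w (min x (w.length + 1)) = inputCell w x := by
  rcases le_or_gt x (w.length + 1) with h | h
  · rw [min_eq_left h]
  · rw [min_eq_right h.le]
    obtain ⟨y, rfl⟩ : ∃ y, x = y + 1 := ⟨x - 1, by omega⟩
    simp only [inputCell]
    rw [List.getElem?_eq_none le_rfl, List.getElem?_eq_none (by omega)]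

/-- A `Spec` leaves the position of the input head open, so the head is first returned to the left
end marker and then advanced by counting down a copy of `x`. The copy ends at zero, which frees its
register for the answer. If `x` is too large the head stops at the right end marker, which by
`inputCell_min` is also what cell `x` shows. -/
theorem LS.sees (p : InSym A → Bool) :
    LS fun w (x : ℕ) => if p (inputCell w x) then 1 else 0 := by
  intro args m hm
  have := hm 0 Nat.one_pos
  obtain ⟨d, hd⟩ := Spec.copy (A := A) (r := args 0) (s := m) (t := m + 1) (by omega) (by omega)
    (by omega)
  refine ⟨.seq (.copy (args 0) m (m + 1))
    (.seq (.loop (.sees fun | .leftEnd => false | _ => true) (.move .left))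
      (.seq (.loop (.nonzero m) (.seq (.dec m) (.move .right))) (.cond (.sees p) (.inc m)))), d, ?_⟩
  rintro w N pos σ _ hN hσ ⟨a, ha, rfl⟩
  have ha0 : σ (args 0) = a := ha.1 0 Nat.one_pos
  have hm0 : σ m = 0 := ha.2 m le_rfl
  rw [put_nat]
  obtain ⟨pos', h1⟩ := hd w N pos σ _ hN hσ ⟨hm0, ha.2 _ (by omega), rfl⟩
  have h2 := exec_rewind w (N ^ d) pos' (Function.update σ m (σ (args 0)))
  have h3 := exec_advance w (N ^ d) 0 m a (Function.update σ m (σ (args 0))) (by simp [ha0])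
  have h4 : Function.update (Function.update σ m (σ (args 0))) m 0 = σ := by
    rw [Function.update_idem, ← hm0, Function.update_eq_self]
  rw [h4, zero_add, Nat.zero_min] at h3
  refine ⟨min a (w.length + 1), .seq h1 (.seq h2 (.seq h3 ?_))⟩
  have h5 : 1 ≤ N ^ d := Nat.one_le_pow _ _ (by omega)
  rcases hp : p (inputCell w a) with _ | _
  · have h6 : Function.update σ m (if p (inputCell w a) then 1 else 0) = σ := by
      simp [hp, ← hm0, Function.update_eq_self]
    simp only [h6]
    exact .cond_false (by simp [Test.Holds, inputCell_min, hp])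
  · have h6 := Exec.inc (w := w) (B := N ^ d) m (min a (w.length + 1), σ) (by simpa [hm0] using h5)
    refine .cond_true (by simp [Test.Holds, inputCell_min, hp]) ?_
    simpa [hm0, hp] using h6

/-! ### Iteration -/

/-- If `r w a` is obtained from `init w a` by iterating `step w a` as long as `cont w (a, ·)` is not
zero, then `r` is computable in logarithmic space. -/
theorem LS.while {init r : List A → α → β} {step : List A → α × β → β} {cont : List A → α × β → ℕ}
    (hi : LS init) (hs : LS step) (hc : LS cont) (e : ℕ)
    (h : ∀ w a, ∃ t, (fun b => step w (a, b))^[t] (init w a) = r w a ∧ cont w (a, r w a) = 0 ∧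
      (∀ j < t, cont w (a, (fun b => step w (a, b))^[j] (init w a)) ≠ 0) ∧
      ∀ N, w.length + 2 ≤ N → (∀ i < dim α, Ctx.get a i ≤ N) → ∀ j ≤ t, ∀ i < dim β,
        Ctx.get ((fun b => step w (a, b))^[j] (init w a)) i ≤ N ^ e) : LS r := by
  intro args m hm
  obtain ⟨ec, hec⟩ := hc.polyBdd
  -- Layout: register `m` is the loop flag, the next `dim β` registers hold the current state, and
  -- `step` and `cont` write above them.
  obtain ⟨c₁, h₁⟩ := hi args (m + 1) (fun i hi => (hm i hi).trans (Nat.lt_succ_self m))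
  have hargs : ∀ i < dim (α × β),
      (if i < dim α then args i else m + 1 + (i - dim α)) < m + 1 + dim β := by
    intro i hi
    simp only [dim] at hi
    split_ifs with h'
    · exact (hm i h').trans (by omega)
    · omega
  obtain ⟨c₂, h₂⟩ := hs _ (m + 1 + dim β) hargs
  obtain ⟨c₃, h₃⟩ := hc _ (m + 1 + dim β) hargs
  have h₃ := h₃.seq (Spec.mv (r := m + 1 + dim β) (s := m) (by omega))
  have h₂ := h₂.seq (Spec.shift (m + 1) (dim β) (dim β) (fun h => h))
  have holds : ∀ (w : List A) (σ : ℕ → ℕ) (a : α) (b : β) (x : ℕ), Holds σ args m a →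
      Holds (put (Function.update σ m x) (m + 1) (dim β) (Ctx.get b))
        (fun i => if i < dim α then args i else m + 1 + (i - dim α)) (m + 1 + dim β) (a, b) := by
    intro w σ a b x ha
    refine ⟨fun i hi => ?_, fun i hi => ?_⟩
    · simp only [dim] at hi
      simp only [Ctx.get]
      split_ifs with h'
      · have := hm i h'
        rw [put_of_lt _ _ _ (by omega), Function.update_of_ne (by omega)]
        exact ha.1 i h'
      · rw [put_apply _ _ (by omega)]
    · rw [put_of_ge _ _ hi, Function.update_of_ne (by omega)]
      exact ha.2 i (by omega)
  have flag : ∀ (w : List A) (σ : ℕ → ℕ) (a : α) (b : β) (x : ℕ), Holds σ args m a →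
      Function.update (Function.update (put (put (Function.update σ m x) (m + 1) (dim β)
        (Ctx.get b)) (m + 1 + dim β) (dim ℕ) (Ctx.get (cont w (a, b)))) m
          (put (put (Function.update σ m x) (m + 1) (dim β)
        (Ctx.get b)) (m + 1 + dim β) (dim ℕ) (Ctx.get (cont w (a, b))) (m + 1 + dim β)))
          (m + 1 + dim β) 0 =
      put (Function.update σ m (cont w (a, b))) (m + 1) (dim β) (Ctx.get b) := by
    intro w σ a b x ha
    have h0 := ha.2
    rw [put_nat]
    funext i
    simp only [put, Function.update_apply]
    split_ifs <;> first | rfl | omega | (rw [h0 _ (by omega)])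
  have shifted : ∀ (σ : ℕ → ℕ) (a : α) (b b' : β) (x : ℕ), Holds σ args m a →
      put (Function.update σ m x) (m + 1) (dim β) (Ctx.get b') = (fun i =>
        if m + 1 ≤ i ∧ i < m + 1 + dim β then
          put (put (Function.update σ m x) (m + 1) (dim β) (Ctx.get b)) (m + 1 + dim β) (dim β)
            (Ctx.get b') (i + dim β)
        else if m + 1 + dim β ≤ i ∧ i < m + 1 + dim β + dim β then 0
        else put (put (Function.update σ m x) (m + 1) (dim β) (Ctx.get b)) (m + 1 + dim β) (dim β)
            (Ctx.get b') i) := by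
    intro σ a b b' x ha
    have h0 := ha.2
    funext i
    simp only [put, Function.update_apply]
    split_ifs <;> first | rfl | omega | (rw [h0 _ (by omega)]) | (congr 1; omega)
  -- One round: the new state is computed above the old one and shifted down over it, then the flag
  -- is recomputed from the new state. Here `x` is the outdated flag.
  have body : Spec (.seq (.seq c₂ (.shift (m + 1) (dim β) (dim β)))
      (.seq c₃ (.mv (m + 1 + dim β) m))) fun w τ τ' => ∃ σ a b x, Holds σ args m a ∧
      τ = put (Function.update σ m x) (m + 1) (dim β) (Ctx.get b) ∧
      τ' = put (Function.update σ m (cont w (a, step w (a, b)))) (m + 1) (dim β)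
        (Ctx.get (step w (a, b))) := by
    refine (h₂.seq h₃).mono ?_
    rintro w _ _ ⟨σ, a, b, x, ha, rfl, rfl⟩
    refine ⟨_, ⟨_, ⟨(a, b), holds w σ a b x ha, rfl⟩, rfl⟩, ?_⟩
    rw [← shifted σ a b _ x ha]
    exact ⟨_, ⟨(a, step w (a, b)), holds w σ a _ x ha, rfl⟩, (flag w σ a _ x ha).symm⟩
  -- The exponent covers the states, bounded by `N ^ e`, and the flags, which are values of `cont`
  -- at arguments bounded by `N ^ (e + 1)`. After the loop the flag is zero, and the shift by one
  -- moves the state down onto its register.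
  refine ⟨_, (((h₁.seq h₃).seq (body.loop m ((e + 1) * (ec + 1)))).seq
    (Spec.shift m 1 (dim β) (by omega))).mono ?_⟩
  rintro w σ _ ⟨a, ha, rfl⟩
  obtain ⟨t, ht, h0, hj, hb⟩ := h w a
  have hput : put σ (m + 1) (dim β) (Ctx.get (init w a)) =
      put (Function.update σ m 0) (m + 1) (dim β) (Ctx.get (init w a)) := by
    rw [← ha.2 m le_rfl, Function.update_eq_self]
  refine ⟨put (Function.update σ m (cont w (a, r w a))) (m + 1) (dim β) (Ctx.get (r w a)),
    ⟨_, ⟨_, ⟨a, ⟨ha.1, fun i hi => ha.2 i (by omega)⟩, rfl⟩, _,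
      ⟨(a, init w a), ?_, rfl⟩, rfl⟩, t,
      fun j => put (Function.update σ m (cont w (a, (fun b => step w (a, b))^[j] (init w a)))) (m + 1)
        (dim β) (Ctx.get ((fun b => step w (a, b))^[j] (init w a))), ?_, ?_, ?_, ?_, ?_⟩, ?_⟩
  · rw [hput]
    exact holds w σ a _ 0 ha
  · rw [hput, flag w σ a _ 0 ha]
    rfl
  · simp only [ht]
  · intro j hjt
    refine ⟨?_, σ, a, _, _, ha, rfl, ?_⟩
    · show put _ _ _ _ m ≠ 0
      rw [put_of_lt _ _ _ (by omega), Function.update_self]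
      exact hj j hjt
    · simp only [Function.iterate_succ_apply']
  · rw [put_of_lt _ _ _ (by omega), Function.update_self, h0]
  · intro N hN hσ' j hjt i
    -- The given bound is for the registers at the entry of the loop. They agree with `σ` below `m`,
    -- and from `m` on `σ` is zero.
    have hσ : ∀ i, σ i ≤ N := by
      intro i
      rcases lt_or_ge i m with hi | hi
      · have := hσ' i
        rwa [hput, flag w σ a _ 0 ha, put_of_lt _ _ _ (by omega),
          Function.update_of_ne (by omega)] at this
      · rw [ha.2 i hi]
        exact Nat.zero_le _
    have hget : ∀ i < dim α, Ctx.get a i ≤ N := fun i hi => (ha.1 i hi).symm.trans_le (hσ _)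
    have hbj := hb N hN hget j hjt
    have hN1 : N ≤ N ^ (e + 1) := self_le_pow_succ N e (by omega)
    have hbj' : ∀ i < dim β, Ctx.get ((fun b => step w (a, b))^[j] (init w a)) i ≤ N ^ (e + 1) :=
      fun i hi => (hbj i hi).trans (Nat.pow_le_pow_right (by omega) (by omega))
    have hcj := hec w (N ^ (e + 1)) (a, (fun b => step w (a, b))^[j] (init w a)) (hN.trans hN1)
      (fun i hi => by
        simp only [Ctx.get]
        simp only [dim] at hi
        split_ifs with h'
        · exact (hget i h').trans hN1
        · exact hbj' _ (by omega)) 0 Nat.one_pos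
    rw [← pow_mul] at hcj
    have hE1 : N ^ ((e + 1) * ec) ≤ N ^ ((e + 1) * (ec + 1)) :=
      Nat.pow_le_pow_right (by omega) (by nlinarith)
    have hE2 : N ^ (e + 1) ≤ N ^ ((e + 1) * (ec + 1)) :=
      Nat.pow_le_pow_right (by omega) (by nlinarith)
    simp only [put, Function.update_apply]
    split_ifs
    · exact (hbj' _ (by omega)).trans hE2
    · exact hcj.trans hE1
    · exact (hσ i).trans (hN1.trans hE2)
  · have h0' := ha.2
    funext i
    simp only [put, Function.update_apply]
    split_ifs <;> first | rfl | omega | (rw [h0' _ (by omega)]; first | done | exact h0.symm) | (congr 1; omega)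

end

/-- A language with a characteristic function that is computable by polynomially bounded registers
is in logspace. -/
theorem LS.inLogspace [Finite A] {X : Language A} {f : List A → ℕ}
    (hf : LS fun w (_ : Unit) => f w) (hX : ∀ w, f w ≠ 0 ↔ w ∈ X) : InLogspace X := by
  obtain ⟨c, d, hd⟩ := hf (fun _ => 0) 0 (fun i hi => absurd hi (Nat.not_lt_zero i))
  refine inLogspace_of_exec X c d fun w => ?_
  obtain ⟨pos, h⟩ := hd w (w.length + 2) 0 (fun _ => 0) _ le_rfl (fun _ => Nat.zero_le _)
    ⟨(), ⟨fun i hi => absurd hi (Nat.not_lt_zero i), fun _ _ => rfl⟩, rfl⟩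
  exact ⟨_, h, by simpa [put_nat] using hX w⟩

end Logspace

/-! ### Polynomial bounds and bounded recursion. -/

namespace Logspace

open Ctx

variable {A : Type u} {α β γ : Type*} [Ctx α] [Ctx β] [Ctx γ]

theorem PolyBdd.of_nat {f : List A → α → ℕ} (d : ℕ)
    (h : ∀ (w : List A) (N : ℕ) (a : α), w.length + 2 ≤ N → (∀ i < dim α, get a i ≤ N) →
      f w a ≤ N ^ d) : PolyBdd f :=
  ⟨d, fun w N a hN ha _ _ => h w N a hN ha⟩

theorem PolyBdd.of_le {f g : List A → α → ℕ} (hg : LS g) (h : ∀ w a, f w a ≤ g w a) :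
    PolyBdd f := by
  obtain ⟨d, hd⟩ := hg.polyBdd
  exact ⟨d, fun w N a hN ha i hi => (h w a).trans (hd w N a hN ha i hi)⟩

theorem get_fst_le {x : α × β} {N : ℕ} (h : ∀ i < dim (α × β), get x i ≤ N) :
    ∀ i < dim α, get x.1 i ≤ N := fun i hi => by
  have := h i (by simp only [dim]; omega)
  simpa [Ctx.get, hi] using this

theorem get_snd_le {x : α × β} {N : ℕ} (h : ∀ i < dim (α × β), get x i ≤ N) :
    ∀ i < dim β, get x.2 i ≤ N := fun i hi => by
  have := h (dim α + i) (by simp only [dim]; omega)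
  simpa [Ctx.get] using this

theorem get_pair_le {x : α × β} {N : ℕ} (h₁ : ∀ i < dim α, get x.1 i ≤ N)
    (h₂ : ∀ i < dim β, get x.2 i ≤ N) : ∀ i < dim (α × β), get x i ≤ N := fun i hi => by
  simp only [dim] at hi
  simp only [Ctx.get]
  split_ifs with h
  · exact h₁ i h
  · exact h₂ _ (by omega)

/-- Primitive recursion with polynomially bounded values. -/
theorem LS.rec {r : List A → α → ℕ → β} {step : List A → α × (β × ℕ) → β}
    (h0 : LS fun w a => r w a 0) (hs : LS step)
    (h : ∀ w a i, r w a (i + 1) = step w (a, (r w a i, i)))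
    (hb : PolyBdd fun w (x : α × ℕ) => r w x.1 x.2) : LS fun w (x : α × ℕ) => r w x.1 x.2 := by
  obtain ⟨d, hd⟩ := hb
  -- The loop state is the current value, the index reached so far, and the number of rounds still
  -- to go; the last component is the loop condition.
  refine (LS.fst (α := β) (β := ℕ × ℕ)).comp (LS.while (α := α × ℕ) (β := β × (ℕ × ℕ))
    (init := fun w x => (r w x.1 0, (0, x.2))) (r := fun w x => (r w x.1 x.2, (x.2, 0)))
    (step := fun w y => (step w (y.1.1, (y.2.1, y.2.2.1)), (y.2.2.1 + 1, y.2.2.2 - 1)))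
    (cont := fun w y => y.2.2.2) ?_ ?_ ?_ (d + 1) ?_)
  · exact (h0.comp LS.fst).pair ((LS.const_nat 0).pair LS.snd)
  · have h1 : LS fun (_ : List A) (y : (α × ℕ) × (β × (ℕ × ℕ))) => y.2.2.1 :=
      LS.fst.comp (LS.snd.comp LS.snd)
    exact (hs.comp ((LS.fst.comp LS.fst).pair ((LS.fst.comp LS.snd).pair h1))).pair
      ((LS.succ.comp h1).pair (LS.pred.comp (LS.snd.comp (LS.snd.comp LS.snd))))
  · exact LS.snd.comp (LS.snd.comp LS.snd)
  · rintro w ⟨a, n⟩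
    have key : ∀ j ≤ n, (fun b : β × (ℕ × ℕ) =>
        ((step w (a, (b.1, b.2.1)), (b.2.1 + 1, b.2.2 - 1)) : β × (ℕ × ℕ)))^[j]
          (r w a 0, (0, n)) = (r w a j, (j, n - j)) := by
      intro j
      induction j with
      | zero => intro _; rfl
      | succ j ih =>
        intro hj
        rw [Function.iterate_succ_apply', ih (by omega), h]
        rfl
    refine ⟨n, by simpa using key n le_rfl, rfl, fun j hj => ?_, fun N hN ha j hj => ?_⟩
    · simp only [key j hj.le]
      omega
    · have hn : n ≤ N := get_snd_le ha 0 Nat.one_pos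
      have hN1 := self_le_pow_succ N d (by omega)
      simp only [key j hj]
      have := hd w N (a, j) hN (get_pair_le (get_fst_le (x := (a, n)) ha)
        (fun i hi => hj.trans hn))
      refine get_pair_le (fun i hi => (this i hi).trans
        (Nat.pow_le_pow_right (by omega) (by omega))) (get_pair_le (fun i _ => ?_) fun i _ => ?_)
      · exact (hj.trans hn).trans hN1
      · exact ((Nat.sub_le n j).trans hn).trans hN1

/-! ### Arithmetic -/

theorem LS.add {f g : List A → α → ℕ} (hf : LS f) (hg : LS g) : LS fun w a => f w a + g w a := by
  have : LS fun (_ : List A) (x : ℕ × ℕ) => x.1 + x.2 :=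
    LS.rec (r := fun _ a i => a + i) (step := fun _ y => y.2.1 + 1) LS.id
      (LS.succ.comp (LS.fst.comp LS.snd)) (fun _ _ _ => rfl)
      (.of_nat 2 fun w N x hN hx => two_mul_le_sq hN (get_fst_le hx 0 Nat.one_pos)
        (get_snd_le hx 0 Nat.one_pos))
  exact this.comp (hf.pair hg)

theorem LS.mul {f g : List A → α → ℕ} (hf : LS f) (hg : LS g) : LS fun w a => f w a * g w a := by
  have : LS fun (_ : List A) (x : ℕ × ℕ) => x.1 * x.2 :=
    LS.rec (r := fun _ a i => a * i) (step := fun _ y => y.2.1 + y.1) (LS.const_nat 0)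
      ((LS.fst.comp LS.snd).add LS.fst) (fun _ _ _ => rfl)
      (.of_nat 2 fun w N x hN hx => by
        rw [sq]
        exact Nat.mul_le_mul (get_fst_le hx 0 Nat.one_pos) (get_snd_le hx 0 Nat.one_pos))
  exact this.comp (hf.pair hg)

theorem LS.sub {f g : List A → α → ℕ} (hf : LS f) (hg : LS g) : LS fun w a => f w a - g w a := by
  have : LS fun (_ : List A) (x : ℕ × ℕ) => x.1 - x.2 :=
    LS.rec (r := fun _ a i => a - i) (step := fun _ y => y.2.1 - 1) LS.id
      (LS.pred.comp (LS.fst.comp LS.snd)) (fun _ _ _ => rfl)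
      (.of_le LS.fst fun _ _ => Nat.sub_le _ _)
  exact this.comp (hf.pair hg)

/-! ### Predicates decidable in logarithmic space -/

open Classical in
/-- The predicate `P`, relative to an input word, is decidable in logarithmic space. -/
def LSP (P : List A → α → Prop) : Prop := LS fun w a => if P w a then 1 else 0

theorem LSP.congr {P Q : List A → α → Prop} (hP : LSP P) (h : ∀ w a, P w a ↔ Q w a) : LSP Q := by
  obtain rfl : P = Q := funext fun w => funext fun a => propext (h w a)
  exact hP

theorem LSP.comp {P : List A → β → Prop} {f : List A → α → β} (hP : LSP P) (hf : LS f) :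
    LSP fun w a => P w (f w a) := LS.comp hP hf

theorem LS.eq_zero {f : List A → α → ℕ} (hf : LS f) : LSP fun w a => f w a = 0 :=
  (LS.isZero.comp hf).congr fun w a i _ => by split_ifs <;> rfl

theorem LSP.not {P : List A → α → Prop} (hP : LSP P) : LSP fun w a => ¬ P w a :=
  (LS.eq_zero hP).congr fun w a => by simp

theorem LSP.and {P Q : List A → α → Prop} (hP : LSP P) (hQ : LSP Q) :
    LSP fun w a => P w a ∧ Q w a :=
  (LS.mul hP hQ).congr fun w a i _ => by
    by_cases h : P w a <;> by_cases h' : Q w a <;> simp [h, h']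

theorem LSP.or {P Q : List A → α → Prop} (hP : LSP P) (hQ : LSP Q) :
    LSP fun w a => P w a ∨ Q w a :=
  (hP.not.and hQ.not).not.congr fun w a => by tauto

theorem LSP.imp {P Q : List A → α → Prop} (hP : LSP P) (hQ : LSP Q) :
    LSP fun w a => P w a → Q w a :=
  (hP.not.or hQ).congr fun w a => by tauto

theorem LSP.const (p : Prop) : LSP fun (_ : List A) (_ : α) => p := by
  by_cases hp : p
  · exact (LS.const_nat 1).congr fun w a i _ => by simp [hp]
  · exact (LS.const_nat 0).congr fun w a i _ => by simp [hp]

theorem LS.le {f g : List A → α → ℕ} (hf : LS f) (hg : LS g) : LSP fun w a => f w a ≤ g w a :=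
  (hf.sub hg).eq_zero.congr fun w a => by omega

theorem LS.lt {f g : List A → α → ℕ} (hf : LS f) (hg : LS g) : LSP fun w a => f w a < g w a :=
  (hg.le hf).not.congr fun w a => by omega

theorem LS.eq {f g : List A → α → ℕ} (hf : LS f) (hg : LS g) : LSP fun w a => f w a = g w a :=
  ((hf.le hg).and (hg.le hf)).congr fun w a => by omega

/-- Both branches are evaluated, and each coordinate is combined with the indicator functions of `P`
and its negation; no branching program is needed. -/
theorem LSP.ite {P : List A → α → Prop} [∀ w a, Decidable (P w a)] {f g : List A → α → β}
    (hP : LSP P) (hf : LS f) (hg : LS g) : LS fun w a => if P w a then f w a else g w a := by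
  refine .of_get fun j hj => ?_
  refine ((LS.mul hP ((LS.get j hj).comp hf)).add
    (LS.mul hP.not ((LS.get j hj).comp hg))).congr fun w a i _ => ?_
  by_cases h : P w a <;> simp [h]

theorem LSP.cell (p : InSym A → Prop) {f : List A → α → ℕ} (hf : LS f) :
    LSP fun w a => p (inputCell w (f w a)) := by
  classical
  exact ((LS.sees fun s => decide (p s)).comp hf).congr fun w a i _ => by simp

theorem LSP.count {P : List A → α → ℕ → Prop} [inst : ∀ w a, DecidablePred (P w a)]
    (hP : LSP fun w (x : α × ℕ) => P w x.1 x.2) {n : List A → α → ℕ} (hn : LS n) :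
    LS fun w a => Nat.count (P w a) (n w a) := by
  obtain rfl : inst = fun _ _ _ => Classical.propDecidable _ := Subsingleton.elim _ _
  classical
  have : LS fun w (x : α × ℕ) => Nat.count (P w x.1) x.2 :=
    LS.rec (r := fun w a i => Nat.count (P w a) i)
      (step := fun w y => y.2.1 + if P w y.1 y.2.2 then 1 else 0) (LS.const_nat 0)
      ((LS.fst.comp LS.snd).add (hP.comp (LS.fst.pair (LS.snd.comp LS.snd))))
      (fun w a i => Nat.count_succ _ _) (.of_le LS.snd fun w x => Nat.count_le _)
  exact this.comp (LS.id.pair hn)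

/-- The witnesses are counted, and the count is compared with zero; a single counter replaces the
search. -/
theorem LSP.exists_lt {P : List A → α → ℕ → Prop} (hP : LSP fun w (x : α × ℕ) => P w x.1 x.2)
    {n : List A → α → ℕ} (hn : LS n) : LSP fun w a => ∃ i < n w a, P w a i := by
  classical
  refine (hP.count hn).eq_zero.not.congr fun w a => ?_
  rw [Nat.count_eq_card_filter_range, Finset.card_eq_zero, ← ne_eq,
    ← Finset.nonempty_iff_ne_empty]
  simp [Finset.Nonempty]

theorem LSP.forall_lt {P : List A → α → ℕ → Prop} (hP : LSP fun w (x : α × ℕ) => P w x.1 x.2)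
    {n : List A → α → ℕ} (hn : LS n) : LSP fun w a => ∀ i < n w a, P w a i :=
  (LSP.exists_lt (P := fun w a i => ¬ P w a i) hP.not hn).not.congr fun w a => by
    push Not
    rfl

theorem LSP.exists_fin {ι : Type*} [Finite ι] {P : ι → List A → α → Prop} (hP : ∀ i, LSP (P i)) :
    LSP fun w a => ∃ i, P i w a := by
  have key : ∀ s : Set ι, s.Finite → LSP fun w a => ∃ i ∈ s, P i w a := by
    intro s hs
    induction s, hs using Set.Finite.induction_on with
    | empty => exact (LSP.const False).congr fun w a => by simp
    | @insert i _ _ _ ih => exact ((hP i).or ih).congr fun w a => by simp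
  exact (key Set.univ Set.finite_univ).congr fun w a => by simp

theorem LSP.forall_fin {ι : Type*} [Finite ι] {P : ι → List A → α → Prop} (hP : ∀ i, LSP (P i)) :
    LSP fun w a => ∀ i, P i w a :=
  (LSP.exists_fin fun i => (hP i).not).not.congr fun w a => by simp

/-- A function defined by cases according to the value of a function `h` with finitely many
values. -/
theorem LS.cases {ι : Type*} [Finite ι] {h : List A → α → ι} (hh : ∀ i, LSP fun w a => h w a = i)
    {F : ι → List A → α → β} (hF : ∀ i, LS (F i)) : LS fun w a => F (h w a) w a := by
  classical
  refine .of_get fun j hj => ?_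
  have key : ∀ s : Set ι, s.Finite → LS fun w a => if h w a ∈ s then Ctx.get (F (h w a) w a) j
      else 0 := by
    intro s hs
    induction s, hs using Set.Finite.induction_on with
    | empty => exact (LS.const_nat 0).congr fun w a => by simp
    | @insert i s _ _ ih =>
      refine ((hh i).ite ((LS.get j hj).comp (hF i)) ih).congr fun w a _ _ => ?_
      by_cases h1 : h w a = i
      · simp [h1]
      · simp [h1]
  exact (key Set.univ Set.finite_univ).congr fun w a => by simp

/-- Bounded quantification over tuples. -/
theorem LSP.exists_fun {t : ℕ} {P : List A → α → (Fin t → ℕ) → Prop}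
    (hP : LSP fun w (x : α × (Fin t → ℕ)) => P w x.1 x.2) {n : List A → α → ℕ} (hn : LS n) :
    LSP fun w a => ∃ κ : Fin t → ℕ, (∀ i, κ i < n w a) ∧ P w a κ := by
  induction t generalizing α with
  | zero =>
    refine (hP.comp (LS.id.pair (LS.pi (f := fun _ _ => Fin.elim0) fun i => i.elim0))).congr
      fun w a => ?_
    constructor
    · exact fun h => ⟨_, fun i => i.elim0, h⟩
    · rintro ⟨κ, -, h⟩
      rwa [Subsingleton.elim κ] at h
  | succ t ih =>
    have h1 : LSP fun w (x : (α × ℕ) × (Fin t → ℕ)) => P w x.1.1 (Fin.cons x.1.2 x.2) := by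
      refine hP.comp ((LS.fst.comp LS.fst).pair (LS.pi fun i => ?_))
      refine Fin.cases ?_ (fun i => ?_) i
      · exact LS.snd.comp LS.fst
      · exact (LS.proj i).comp LS.snd
    have h2 := LSP.exists_lt (P := fun w a i => ∃ κ : Fin t → ℕ, (∀ j, κ j < n w a) ∧
      P w a (Fin.cons i κ)) (ih (P := fun w x κ => P w x.1 (Fin.cons x.2 κ)) h1
        (hn.comp LS.fst)) hn
    refine h2.congr fun w a => ?_
    constructor
    · rintro ⟨i, hi, κ, hκ, h⟩
      exact ⟨_, fun j => Fin.cases (by simpa using hi) (fun j => by simpa using hκ j) j, h⟩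
    · rintro ⟨κ, hκ, h⟩
      exact ⟨κ 0, hκ 0, Fin.tail κ, fun j => hκ j.succ, by rwa [Fin.cons_self_tail]⟩

/-- Division by a constant. -/
theorem LS.div_const {f : List A → α → ℕ} (hf : LS f) (b : ℕ) : LS fun w a => f w a / b := by
  classical
  rcases Nat.eq_zero_or_pos b with rfl | hb
  · exact (LS.const_nat 0).congr fun w a => by simp
  have : LS fun (_ : List A) (x : Unit × ℕ) => x.2 / b := by
    refine LS.rec (r := fun _ _ i => i / b)
      (step := fun _ y => if (y.2.1 + 1) * b ≤ y.2.2 + 1 then y.2.1 + 1 else y.2.1)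
      ((LS.const_nat 0).congr fun w a => by simp) ?_ (fun w a i => ?_)
      (.of_le LS.snd fun w x => Nat.div_le_self _ _)
    · have h1 : LS fun (_ : List A) (y : Unit × (ℕ × ℕ)) => y.2.1 := LS.fst.comp LS.snd
      exact (((LS.succ.comp h1).mul (LS.const_nat b)).le
        (LS.succ.comp (LS.snd.comp LS.snd))).ite (LS.succ.comp h1) h1
    · simp only []
      have h1 := Nat.div_add_mod i b
      have h2 := Nat.mod_lt i hb
      split_ifs with h
      · exact Nat.div_eq_of_lt_le h (by nlinarith)
      · exact Nat.div_eq_of_lt_le ((Nat.div_mul_le_self i b).trans (Nat.le_succ i)) (by omega)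
  exact this.comp ((LS.of_get (β := Unit) (f := fun _ _ => ()) fun j hj => absurd hj (Nat.not_lt_zero j)).pair hf)

theorem LS.mod_const {f : List A → α → ℕ} (hf : LS f) (b : ℕ) : LS fun w a => f w a % b :=
  (hf.sub ((LS.const_nat b).mul (hf.div_const b))).congr fun w a i _ => by
    simp only [get_nat]
    have := Nat.div_add_mod (f w a) b
    omega

/-- The length of the input. -/
theorem LS.length : LS fun (w : List A) (_ : α) => w.length := by
  classical
  refine LS.while (init := fun _ _ => 0) (step := fun _ y => y.2 + 1)
    (cont := fun w y => if inputCell w (y.2 + 1) = .rightEnd then 0 else 1) (LS.const_nat 0)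
    (LS.succ.comp LS.snd) (LSP.ite (LSP.cell (· = .rightEnd) (LS.succ.comp LS.snd))
      (LS.const_nat 0) (LS.const_nat 1)) 1 fun w a => ⟨w.length, ?_, ?_, fun j hj => ?_, ?_⟩
  · simp
  · simp [inputCell]
  · simp [inputCell, hj]
  · intro N hN _ j hj i _
    simp
    omega

end Logspace

namespace Logspace

open Ctx

/-! ### Simulation of logspace machines on virtual inputs -/

/-- Giving `s₀` the code 0 makes the number 0 the encoding of an entirely blank tape. Since decoding
is constant from `b` on, any property of a decoded number is settled by a finite table, see
`LSP.of_eventually_const`. -/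
theorem exists_coding {T : Type*} [Finite T] (s₀ : T) :
    ∃ (b : ℕ) (code : T → ℕ) (dec : ℕ → T), (∀ s, code s < b) ∧ (∀ s, dec (code s) = s) ∧
      code s₀ = 0 ∧ ∀ n, b ≤ n → dec n = dec b := by
  classical
  obtain ⟨n, ⟨e⟩⟩ := Finite.exists_equiv_fin T
  have hn : 0 < n := (Nat.zero_le _).trans_lt (e s₀).2
  let e' := e.trans (Equiv.swap (e s₀) ⟨0, hn⟩)
  refine ⟨n, fun s => (e' s).1, fun k => if h : k < n then e'.symm ⟨k, h⟩ else s₀,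
    fun s => (e' s).2, fun s => by simp, by simp [e'], fun k hk => ?_⟩
  simp [not_lt.2 hk]

theorem LSP.of_eventually_const {A : Type u} {α : Type*} [Ctx α] {P : ℕ → Prop} (b : ℕ)
    (hP : ∀ n, b ≤ n → (P n ↔ P b)) {f : List A → α → ℕ} (hf : LS f) :
    LSP fun w a => P (f w a) := by
  refine (((hf.lt (LS.const_nat b)).and (LSP.exists_fin (ι := Fin b) (P := fun k w a =>
    f w a = k ∧ P k) fun k => (hf.eq (LS.const_nat k.1)).and (LSP.const _))).or
      (((LS.const_nat b).le hf).and (LSP.const (P b)))).congr fun w a => ?_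
  constructor
  · rintro (⟨-, k, hk, h⟩ | ⟨h1, h2⟩)
    · rwa [hk]
    · exact (hP _ h1).2 h2
  · intro h
    rcases lt_or_ge (f w a) b with h1 | h1
    · exact Or.inl ⟨h1, ⟨_, h1⟩, rfl, h⟩
    · exact Or.inr ⟨h1, (hP _ h1).1 h⟩

/-- The tape `f` with the head at `h` is encoded by two numbers: the digits of `r` in base `b` are
the symbols from the head on to the right, and the digits of `l` are the symbols to the left of the
head. -/
def TapeEnc {T : Type*} (b : ℕ) (code : T → ℕ) (f : ℤ → T) (h : ℤ) (l r : ℕ) : Prop :=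
  (∀ j : ℕ, r / b ^ j % b = code (f (h + j))) ∧ ∀ j : ℕ, l / b ^ j % b = code (f (h - 1 - j))

/-- The left half of a tape after writing the symbol with the code `s` and a move. -/
def newLeft (b s : ℕ) (l : ℕ) : Move → ℕ
  | .left => l / b
  | .stay => l
  | .right => b * l + s

/-- The right half of a tape after writing the symbol with the code `s` and a move. -/
def newRight (b s : ℕ) (l r : ℕ) : Move → ℕ
  | .left => b * (b * (r / b) + s) + l % b
  | .stay => b * (r / b) + s
  | .right => r / b

theorem digit_zero {b s : ℕ} (hs : s < b) (x : ℕ) : (b * x + s) / b ^ 0 % b = s := by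
  rw [pow_zero, Nat.div_one, Nat.mul_add_mod, Nat.mod_eq_of_lt hs]

theorem digit_succ {b s : ℕ} (hs : s < b) (x j : ℕ) :
    (b * x + s) / b ^ (j + 1) % b = x / b ^ j % b := by
  rw [pow_succ', ← Nat.div_div_eq_div_mul, Nat.mul_add_div (by omega), Nat.div_eq_of_lt hs,
    add_zero]

theorem digit_div (b x j : ℕ) : x / b / b ^ j % b = x / b ^ (j + 1) % b := by
  rw [pow_succ', ← Nat.div_div_eq_div_mul]

/-- The two halves are stacks with the least significant digit on top. Writing replaces the top of
the right stack, and a move pops a symbol from one stack and pushes it onto the other. -/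
theorem TapeEnc.update {T : Type*} {b : ℕ} {code : T → ℕ} (hb : ∀ s, code s < b) {f : ℤ → T} {h : ℤ}
    {l r : ℕ} (H : TapeEnc b code f h l r) (s : T) (m : Move) :
    TapeEnc b code (Function.update f h s) (moveWork m h) (newLeft b (code s) l m)
      (newRight b (code s) l r m) := by
  have hs := hb s
  have hright : ∀ j : ℕ, (b * (r / b) + code s) / b ^ j % b =
      code (Function.update f h s (h + j)) := by
    intro j
    cases j with
    | zero => rw [digit_zero hs]; simp
    | succ j =>
      rw [digit_succ hs, digit_div, H.1, Function.update_of_ne (by push_cast; omega)]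
  have hleft : ∀ j : ℕ, l / b ^ j % b = code (Function.update f h s (h - 1 - j)) := by
    intro j
    rw [H.2, Function.update_of_ne (by omega)]
  cases m with
  | stay => exact ⟨hright, hleft⟩
  | right =>
    refine ⟨fun j => ?_, fun j => ?_⟩
    · simp only [newRight, moveWork]
      rw [digit_div, H.1, Function.update_of_ne (by omega)]
      congr 2
      push_cast
      ring
    · simp only [newLeft, moveWork]
      cases j with
      | zero => rw [digit_zero hs]; simp
      | succ j =>
        rw [digit_succ hs, hleft]
        congr 2
        push_cast
        ring
  | left =>
    refine ⟨fun j => ?_, fun j => ?_⟩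
    · simp only [newRight, moveWork]
      have hl : l % b < b := Nat.mod_lt _ (by omega)
      cases j with
      | zero =>
        rw [digit_zero hl]
        simpa using hleft 0
      | succ j =>
        rw [digit_succ hl, hright]
        congr 2
        push_cast
        ring
    · simp only [newLeft, moveWork]
      rw [digit_div, hleft]
      congr 2
      push_cast
      ring

/-- Bounds for the encoding of a tape whose head is at `h`, within distance `K` of the origin. -/
def TapeBound (b : ℕ) (K : ℕ) (h : ℤ) (l r : ℕ) : Prop :=
  ∃ u v : ℕ, (u : ℤ) = K + h ∧ (v : ℤ) = K + 1 - h ∧ l < b ^ u ∧ r < b ^ v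

/-- Of the `2 * K + 1` cells between `-K` and `K`, `u` lie to the left of the head and `v` from the
head on; a move only transfers one digit from one half to the other. -/
theorem TapeBound.update {b K : ℕ} {h : ℤ} {l r s : ℕ} (hs : s < b) (H : TapeBound b K h l r)
    (hh : h.natAbs ≤ K) (m : Move) (hm : (moveWork m h).natAbs ≤ K) :
    TapeBound b K (moveWork m h) (newLeft b s l m) (newRight b s l r m) := by
  obtain ⟨u, v, hu, hv, hl, hr⟩ := H
  have push : ∀ {x k c : ℕ}, c < b → x < b ^ k → b * x + c < b ^ (k + 1) := by
    intro x k c hc hx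
    calc b * x + c < b * x + b := by omega
      _ = b * (x + 1) := by ring
      _ ≤ b * b ^ k := Nat.mul_le_mul_left _ hx
      _ = b ^ (k + 1) := by ring
  obtain ⟨v, rfl⟩ : ∃ v', v = v' + 1 := ⟨v - 1, by omega⟩
  have hr' : r / b < b ^ v := Nat.div_lt_of_lt_mul (by rwa [← pow_succ'])
  cases m with
  | stay => exact ⟨u, v + 1, hu, hv, hl, push hs hr'⟩
  | right =>
    simp only [moveWork] at hm
    exact ⟨u + 1, v, by push_cast [moveWork]; omega, by push_cast [moveWork] at hv ⊢; omega,
      push hs hl, hr'⟩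
  | left =>
    simp only [moveWork] at hm
    obtain ⟨u, rfl⟩ : ∃ u', u = u' + 1 := ⟨u - 1, by omega⟩
    refine ⟨u, v + 1 + 1, by push_cast [moveWork] at hu ⊢; omega,
      by push_cast [moveWork] at hv ⊢; omega, Nat.div_lt_of_lt_mul (by rwa [← pow_succ']),
      push (Nat.mod_lt _ (by omega)) (push hs hr')⟩

theorem TapeBound.le {b K : ℕ} (hb : 0 < b) {h : ℤ} {l r : ℕ} (H : TapeBound b K h l r) :
    l ≤ b ^ (2 * K + 1) ∧ r ≤ b ^ (2 * K + 1) := by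
  obtain ⟨u, v, hu, hv, hl, hr⟩ := H
  exact ⟨hl.le.trans (Nat.pow_le_pow_right hb (by omega)),
    hr.le.trans (Nat.pow_le_pow_right hb (by omega))⟩

/-- A tape segment of logarithmic length has polynomially many contents: after `b ≤ 2 ^ b`, the
exponent is a constant multiple of `log n + 1`, and `2 ^ (log n + 1)` is at most `N ^ (d + 2)`. -/
theorem pow_space_le {b C n N d : ℕ} (hN : 2 ≤ N) (hn : n ≤ N ^ d) :
    b ^ (2 * (C * (Nat.log 2 n + 1)) + 1) ≤ N ^ ((d + 2) * (b * (2 * C + 1))) := by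
  have h1 : 2 ^ (Nat.log 2 n + 1) ≤ N ^ (d + 2) := by
    have h2 : 2 ^ Nat.log 2 n ≤ n + 1 := by
      rcases Nat.eq_zero_or_pos n with rfl | h
      · simp
      · exact (Nat.pow_log_le_self 2 h.ne').trans (Nat.le_succ n)
    have h3 : 1 ≤ N ^ d := Nat.one_le_pow _ _ (by omega)
    calc 2 ^ (Nat.log 2 n + 1) = 2 * 2 ^ Nat.log 2 n := by ring
      _ ≤ 2 * (2 * N ^ d) := by omega
      _ = N ^ d * (2 * 2) := by ring
      _ ≤ N ^ d * (N * N) := Nat.mul_le_mul_left _ (Nat.mul_le_mul hN hN)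
      _ = N ^ (d + 2) := by ring
  calc b ^ (2 * (C * (Nat.log 2 n + 1)) + 1)
      ≤ (2 ^ b) ^ (2 * (C * (Nat.log 2 n + 1)) + 1) :=
        Nat.pow_le_pow_left Nat.lt_two_pow_self.le _
    _ = 2 ^ (b * (2 * (C * (Nat.log 2 n + 1)) + 1)) := by rw [← pow_mul]
    _ ≤ 2 ^ ((Nat.log 2 n + 1) * (b * (2 * C + 1))) := by
        refine Nat.pow_le_pow_right (by norm_num) ?_
        have : 2 * (C * (Nat.log 2 n + 1)) + 1 ≤ (Nat.log 2 n + 1) * (2 * C + 1) := by nlinarith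
        calc _ ≤ b * ((Nat.log 2 n + 1) * (2 * C + 1)) := Nat.mul_le_mul_left _ this
          _ = _ := by ring
    _ = (2 ^ (Nat.log 2 n + 1)) ^ (b * (2 * C + 1)) := by rw [pow_mul]
    _ ≤ (N ^ (d + 2)) ^ (b * (2 * C + 1)) := Nat.pow_le_pow_left h1 _
    _ = _ := by rw [← pow_mul]

theorem LS.newLeft {A : Type u} {α : Type*} [Ctx α] (b s : ℕ) {l : List A → α → ℕ} (hl : LS l)
    (m : Move) : LS fun w a => newLeft b s (l w a) m := by
  cases m
  · exact hl.div_const b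
  · exact hl
  · exact ((LS.const_nat b).mul hl).add (LS.const_nat s)

theorem LS.newRight {A : Type u} {α : Type*} [Ctx α] (b s : ℕ) {l r : List A → α → ℕ} (hl : LS l)
    (hr : LS r) (m : Move) : LS fun w a => newRight b s (l w a) (r w a) m := by
  have h := ((LS.const_nat (α := α) (A := A) b).mul (hr.div_const b)).add (LS.const_nat s)
  cases m
  · exact ((LS.const_nat b).mul h).add (hl.mod_const b)
  · exact h
  · exact hr.div_const b

theorem LS.moveInput {A : Type u} {α : Type*} [Ctx α] {n i : List A → α → ℕ} (hn : LS n) (hi : LS i)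
    (m : Move) : LS fun w a => moveInput (n w a) m (i w a) := by
  cases m
  · exact LS.pred.comp hi
  · exact hi
  · refine (((LS.succ.comp hi).le (LS.succ.comp hn)).ite (LS.succ.comp hi)
      (LS.succ.comp hn)).congr fun w a _ _ => ?_
    simp only [get_nat, Logspace.moveInput]
    split_ifs <;> omega

theorem LSP.virtualCell {A : Type u} {B : Type v} {α : Type*} [Ctx α] [Finite B]
    {V : List A → α → List B} (hV : ∀ b, LSP fun w (x : α × ℕ) => (V w x.1)[x.2]? = some b)
    (s : InSym B) : LSP fun w (x : α × ℕ) => inputCell (V w x.1) x.2 = s := by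
  have h0 : LSP fun (_ : List A) (x : α × ℕ) => x.2 = 0 := LS.snd.eq_zero
  have hp : LS fun (_ : List A) (x : α × ℕ) => (x.1, x.2 - 1) := LS.fst.pair (LS.pred.comp LS.snd)
  cases s with
  | leftEnd =>
    refine h0.congr fun w x => ?_
    rcases x with ⟨a, _ | i⟩
    · simp [inputCell]
    · simp only [inputCell, Nat.add_eq_zero_iff, one_ne_zero, and_false, false_iff]
      cases (V w a)[i]? <;> simp
  | rightEnd =>
    refine (h0.not.and ((LSP.exists_fin hV).not.comp hp)).congr fun w x => ?_
    rcases x with ⟨a, _ | i⟩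
    · simp [inputCell]
    · simp only [inputCell]
      cases h : (V w a)[i]? <;> simp [h]
  | letter b =>
    refine (h0.not.and ((hV b).comp hp)).congr fun w x => ?_
    rcases x with ⟨a, _ | i⟩
    · simp [inputCell]
    · simp only [inputCell]
      cases h : (V w a)[i]? <;> simp [h]

/-- The tuples of numbers that encode the configurations of a machine with `t` work tapes: state,
position of the input head, left and right halves of the work tapes. -/
abbrev CfgCode (t : ℕ) := ℕ × (ℕ × ((Fin t → ℕ) × (Fin t → ℕ)))

namespace Machine

variable {B : Type v} (M : Machine B) (b : ℕ) (code : M.WorkSym → ℕ) (qcode : M.State → ℕ)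

/-- The effect of a transition of `M` on the encodings of configurations. -/
def codeStep (n : ℕ) (x : CfgCode M.tapes) :
    Option (M.State × Move × (Fin M.tapes → M.WorkSym × Move)) → CfgCode M.tapes
  | none => x
  | some r => (qcode r.1, (moveInput n r.2.1 x.2.1,
      (fun i => newLeft b (code (r.2.2 i).1) (x.2.2.1 i) (r.2.2 i).2,
        fun i => newRight b (code (r.2.2 i).1) (x.2.2.1 i) (x.2.2.2 i) (r.2.2 i).2)))

/-- The configuration `c`, all of whose heads are in range, is encoded by `x`. -/
def Encodes (n K : ℕ) (c : M.Cfg) (x : CfgCode M.tapes) : Prop :=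
  x.1 = qcode c.state ∧ x.2.1 = c.inputHead ∧ c.inputHead ≤ n + 1 ∧
    ∀ i, TapeEnc b code (c.work i) (c.workHead i) (x.2.2.1 i) (x.2.2.2 i) ∧
      TapeBound b K (c.workHead i) (x.2.2.1 i) (x.2.2.2 i)

variable {M b code qcode}

theorem Encodes.step (hb : ∀ s, code s < b) {w : List B} {K : ℕ} {c c' : M.Cfg}
    {x : CfgCode M.tapes} (H : M.Encodes b code qcode w.length K c x)
    (hc : ∀ i, (c.workHead i).natAbs ≤ K) (hs : M.step w c = some c')
    (hc' : ∀ i, (c'.workHead i).natAbs ≤ K) :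
    M.Encodes b code qcode w.length K c' (M.codeStep b code qcode w.length x
      (M.trans c.state (inputCell w c.inputHead) fun i => c.work i (c.workHead i))) := by
  obtain ⟨h1, h2, h3, h4⟩ := H
  unfold Machine.step at hs
  cases hr : M.trans c.state (inputCell w c.inputHead) fun i => c.work i (c.workHead i) with
  | none => simp [hr] at hs
  | some r =>
    rw [hr, Option.map_some, Option.some.injEq] at hs
    subst hs
    refine ⟨rfl, by simp [codeStep, h2], ?_, fun i => ⟨(h4 i).1.update hb _ _,
      (h4 i).2.update (hb _) (hc i) _ (hc' i)⟩⟩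
    simp only
    cases r.2.1 <;> simp only [moveInput] <;> omega

end Machine

/-- The languages in logspace are decidable in logarithmic space on virtual words whose length and
letters are computable in logarithmic space. -/
theorem InLogspace.lsp {A : Type u} {B : Type v} {α : Type*} [Ctx α] [Finite B] {X : Language B}
    (hX : InLogspace X) {V : List A → α → List B} (hl : LS fun w a => (V w a).length)
    (hV : ∀ b, LSP fun w (x : α × ℕ) => (V w x.1)[x.2]? = some b) : LSP fun w a => V w a ∈ X := by
  classical
  obtain ⟨M, hdec, C, hC⟩ := hX
  have := M.finite_state
  have := M.finite_workSym
  obtain ⟨b, code, sym, hb, hsym, hblank, hconst⟩ := exists_coding M.blank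
  obtain ⟨bq, qcode, state, hbq, hstate, -, hqconst⟩ := exists_coding M.start
  have : Finite (InSym B) := by
    refine Finite.of_injective (β := Option (Option B)) (fun
      | .leftEnd => none
      | .rightEnd => some none
      | .letter a => some (some a)) ?_
    rintro (_ | _ | a) (_ | _ | a') h <;> simp_all
  -- All that the transition function depends on. It ranges over a finite type, so `LS.cases` can
  -- tabulate the transition function.
  let view : List A → α × CfgCode M.tapes → M.State × InSym B × (Fin M.tapes → M.WorkSym) :=
    fun w y => (state y.2.1, inputCell (V w y.1) y.2.2.1, fun i => sym (y.2.2.2.2 i % b))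
  have hview : ∀ i, LSP fun w y => view w y = i := by
    rintro ⟨q, s, τ⟩
    have h1 : LSP fun (_ : List A) (y : α × CfgCode M.tapes) => state y.2.1 = q :=
      LSP.of_eventually_const (P := fun n => state n = q) bq (fun n hn => by rw [hqconst n hn])
        (LS.fst.comp LS.snd)
    have h2 : LSP fun (w : List A) (y : α × CfgCode M.tapes) =>
        inputCell (V w y.1) y.2.2.1 = s :=
      (LSP.virtualCell hV s).comp (LS.fst.pair (LS.fst.comp (LS.snd.comp LS.snd)))
    have h3 : ∀ i, LSP fun (_ : List A) (y : α × CfgCode M.tapes) =>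
        sym (y.2.2.2.2 i % b) = τ i := fun i =>
      LSP.of_eventually_const (P := fun n => sym n = τ i) b (fun n hn => by rw [hconst n hn])
        (LS.mod_const ((LS.proj i).comp (LS.snd.comp (LS.snd.comp (LS.snd.comp LS.snd)))) b)
    exact (h1.and (h2.and (LSP.forall_fin h3))).congr fun w y => by
      simp [view, Prod.ext_iff, funext_iff]
  have hlen : LS fun w (y : α × CfgCode M.tapes) => (V w y.1).length := hl.comp LS.fst
  have hstep : LS fun w (y : α × CfgCode M.tapes) =>
      M.codeStep b code qcode (V w y.1).length y.2
        (M.trans (view w y).1 (view w y).2.1 (view w y).2.2) := by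
    refine LS.cases hview (F := fun i w y => M.codeStep b code qcode (V w y.1).length y.2
        (M.trans i.1 i.2.1 i.2.2)) fun i => ?_
    cases M.trans i.1 i.2.1 i.2.2 with
    | none => exact LS.snd
    | some r =>
      have hL : ∀ i, LS fun (_ : List A) (y : α × CfgCode M.tapes) => y.2.2.2.1 i := fun i =>
        (LS.proj i).comp (LS.fst.comp (LS.snd.comp (LS.snd.comp LS.snd)))
      have hR : ∀ i, LS fun (_ : List A) (y : α × CfgCode M.tapes) => y.2.2.2.2 i := fun i =>
        (LS.proj i).comp (LS.snd.comp (LS.snd.comp (LS.snd.comp LS.snd)))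
      exact (LS.const_nat _).pair ((LS.moveInput hlen (LS.fst.comp (LS.snd.comp LS.snd)) _).pair
        ((LS.pi fun i => LS.newLeft b _ (hL i) _).pair
          (LS.pi fun i => LS.newRight b _ (hL i) (hR i) _)))
  have hcont : LS fun w (y : α × CfgCode M.tapes) =>
      if M.trans (view w y).1 (view w y).2.1 (view w y).2.2 = none then 0 else 1 :=
    LS.cases hview (F := fun i _ _ => if M.trans i.1 i.2.1 i.2.2 = none then 0 else 1)
      fun i => LS.const_nat _
  let f : List A → α → CfgCode M.tapes → CfgCode M.tapes := fun w a x =>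
    M.codeStep b code qcode (V w a).length x
        (M.trans (view w (a, x)).1 (view w (a, x)).2.1 (view w (a, x)).2.2)
  let x₀ : CfgCode M.tapes := (qcode M.start, (0, (fun _ => 0, fun _ => 0)))
  let K : List A → α → ℕ := fun w a => C * (Nat.log 2 (V w a).length + 1)
  have hview' : ∀ w a (c : M.Cfg) x, M.Encodes b code qcode (V w a).length (K w a) c x →
      view w (a, x) = (c.state, inputCell (V w a) c.inputHead,
        fun i => c.work i (c.workHead i)) := by
    rintro w a c x ⟨h1, h2, -, h4⟩
    have h5 : ∀ i, sym (x.2.2.2 i % b) = c.work i (c.workHead i) := fun i => by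
      have := (h4 i).1.1 0
      simp only [pow_zero, Nat.div_one, Nat.cast_zero, add_zero] at this
      rw [this, hsym]
    simp [view, h1, h2, hstate, h5]
  -- Every iterate up to time `t` encodes a configuration that the machine really visits. This makes
  -- the space bound of the machine available for all loop states, and it shows that the simulation
  -- has not halted before time `t`.
  have key : ∀ w a c, M.Visits (V w a) c →
      ∃ t, M.Encodes b code qcode (V w a).length (K w a) c ((f w a)^[t] x₀) ∧
        ∀ j ≤ t, ∃ c', M.Visits (V w a) c' ∧
          M.Encodes b code qcode (V w a).length (K w a) c' ((f w a)^[j] x₀) ∧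
            (j < t → M.step (V w a) c' ≠ none) := by
    intro w a c hc
    induction hc with
    | refl =>
      have h0 : M.Encodes b code qcode (V w a).length (K w a) M.initCfg x₀ := by
        refine ⟨rfl, rfl, Nat.zero_le _, fun i => ⟨⟨fun j => ?_, fun j => ?_⟩, ?_⟩⟩
        · simp [x₀, Machine.initCfg, hblank]
        · simp [x₀, Machine.initCfg, hblank]
        · have hb0 : 0 < b := (Nat.zero_le _).trans_lt (hb M.blank)
          exact ⟨K w a, K w a + 1, by simp [Machine.initCfg], by simp [Machine.initCfg],
            Nat.pow_pos hb0, Nat.pow_pos hb0⟩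
      refine ⟨0, h0, fun j hj => ⟨_, .refl, ?_, fun h => absurd h (by omega)⟩⟩
      obtain rfl : j = 0 := by omega
      exact h0
    | @tail c c' hc hs ih =>
      obtain ⟨t, h1, h2⟩ := ih
      have h3 : M.Encodes b code qcode (V w a).length (K w a) c' ((f w a)^[t + 1] x₀) := by
        have := h1.step hb (hC _ _ hc) hs (hC _ _ (hc.tail hs))
        rw [Function.iterate_succ_apply']
        simp only [f, hview' w a c _ h1]
        exact this
      refine ⟨t + 1, h3, fun j hj => ?_⟩
      rcases Nat.lt_or_ge j t with hjt | hjt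
      · obtain ⟨c₁, h4, h5, h6⟩ := h2 j hjt.le
        exact ⟨c₁, h4, h5, fun _ => h6 hjt⟩
      · rcases Nat.eq_or_lt_of_le hjt with rfl | hjt
        · exact ⟨c, hc, h1, fun _ => by simp [hs]⟩
        · obtain rfl : j = t + 1 := by omega
          exact ⟨c', hc.tail hs, h3, fun h => absurd h (lt_irrefl _)⟩
  have hfin : ∀ w a, ∃ t c, M.step (V w a) c = none ∧ (c.state ∈ M.accept ↔ V w a ∈ X) ∧
      M.Encodes b code qcode (V w a).length (K w a) c ((f w a)^[t] x₀) ∧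
        ∀ j ≤ t, ∃ c', M.Visits (V w a) c' ∧
          M.Encodes b code qcode (V w a).length (K w a) c' ((f w a)^[j] x₀) ∧
            (j < t → M.step (V w a) c' ≠ none) := by
    intro w a
    obtain ⟨c, h1, h2, h3⟩ := hdec (V w a)
    obtain ⟨t, h4, h5⟩ := key w a c h1
    exact ⟨t, c, h2, h3, h4, h5⟩
  choose t cfin hfin using hfin
  have hnone : ∀ w a c x, M.Encodes b code qcode (V w a).length (K w a) c x →
      (M.trans (view w (a, x)).1 (view w (a, x)).2.1 (view w (a, x)).2.2 = none ↔
        M.step (V w a) c = none) := by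
    intro w a c x h
    rw [hview' w a c x h]
    simp [Machine.step]
  obtain ⟨d, hd⟩ := hl.polyBdd
  have hr : LS fun w a => (f w a)^[t w a] x₀ := by
    refine LS.while (init := fun _ _ => x₀) ?_ hstep hcont
      -- The summands cover, in this order, the code of the state, the position of the virtual input
      -- head and the numbers for the tape halves.
      (bq + (d + 2) + (d + 2) * (b * (2 * C + 1))) fun w a => ?_
    · exact (LS.const_nat _).pair ((LS.const_nat 0).pair ((LS.pi fun i => LS.const_nat 0).pair
        (LS.pi fun i => LS.const_nat 0)))
    · obtain ⟨h1, -, h3, h4⟩ := hfin w a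
      refine ⟨t w a, rfl, if_pos ((hnone w a _ _ h3).2 h1), fun j hj => ?_, fun N hN ha j hj => ?_⟩
      · obtain ⟨c, -, h5, h6⟩ := h4 j hj.le
        have := mt (hnone w a _ _ h5).1 (h6 hj)
        show (if _ then 0 else 1) ≠ 0
        rw [if_neg]
        · exact one_ne_zero
        · exact this
      · obtain ⟨c, hc, ⟨h5, h6, h7, h8⟩, -⟩ := h4 j hj
        have hn : (V w a).length ≤ N ^ d := hd w N a hN ha 0 Nat.one_pos
        have hb0 : 0 < b := (Nat.zero_le _).trans_lt (hb M.blank)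
        have hp := pow_space_le (b := b) (C := C) (by omega : 2 ≤ N) hn
        have hN0 : 0 < N := by omega
        have hE : ∀ {k}, k ≤ bq + (d + 2) + (d + 2) * (b * (2 * C + 1)) →
            N ^ k ≤ N ^ (bq + (d + 2) + (d + 2) * (b * (2 * C + 1))) :=
          fun h => Nat.pow_le_pow_right hN0 h
        have htape : ∀ i, ((f w a)^[j] x₀).2.2.1 i ≤
              N ^ (bq + (d + 2) + (d + 2) * (b * (2 * C + 1))) ∧ ((f w a)^[j] x₀).2.2.2 i ≤
              N ^ (bq + (d + 2) + (d + 2) * (b * (2 * C + 1))) := fun i => by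
          have := (h8 i).2.le hb0
          exact ⟨(this.1.trans hp).trans (hE (by omega)), (this.2.trans hp).trans (hE (by omega))⟩
        refine get_pair_le (fun i _ => ?_) (get_pair_le (fun i _ => ?_)
          (get_pair_le (fun i hi => ?_) (fun i hi => ?_)))
        · rw [get_nat]
          refine le_trans ?_ (hE (k := bq) (by omega))
          refine (h5.trans_le (hbq _).le).trans ?_
          exact Nat.lt_two_pow_self.le.trans (Nat.pow_le_pow_left (by omega) _)
        · rw [get_nat]
          refine le_trans ?_ (hE (k := d + 1) (by omega))
          refine h6.trans_le (h7.trans ?_)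
          have : 1 ≤ N ^ d := Nat.one_le_pow _ _ hN0
          calc _ ≤ N ^ d * 2 := by omega
            _ ≤ N ^ (d + 1) := by rw [pow_succ]; exact Nat.mul_le_mul_left _ (by omega)
        · exact (dif_pos (c := i < M.tapes) hi).trans_le (htape _).1
        · exact (dif_pos (c := i < M.tapes) hi).trans_le (htape _).2
  refine (LSP.of_eventually_const (P := fun n => state n ∈ M.accept) bq
    (fun n hn => by rw [hqconst n hn]) (LS.fst.comp hr)).congr fun w a => ?_
  obtain ⟨-, h2, h3, -⟩ := hfin w a
  rw [← h2, h3.1, hstate]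

end Logspace

namespace GraphProduct

variable {L : Type u} {G : L → Type v} [∀ α, Group (G α)] {I : SimpleGraph L}

/-! ### Dependence graphs and projections -/

theorem DepEquiv.refl (w : List (Letter G)) : DepEquiv I w w :=
  ⟨Equiv.refl _, fun _ => rfl, fun _ _ => Iff.rfl⟩

theorem DepEquiv.trans {w w' w'' : List (Letter G)} (h : DepEquiv I w w')
    (h' : DepEquiv I w' w'') : DepEquiv I w w'' := by
  obtain ⟨e, h1, h2⟩ := h
  obtain ⟨e', h1', h2'⟩ := h'
  exact ⟨e.trans e', fun i => (h1' _).trans (h1 _), fun i j => (h2' _ _).trans (h2 _ _)⟩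

theorem DepEquiv.symm {w w' : List (Letter G)} (h : DepEquiv I w w') : DepEquiv I w' w := by
  obtain ⟨e, h1, h2⟩ := h
  exact ⟨e.symm, fun i => by rw [← h1, e.apply_symm_apply],
    fun i j => by rw [← h2, e.apply_symm_apply, e.apply_symm_apply]⟩

theorem DepEquiv.cons (a : Letter G) {w w' : List (Letter G)} (h : DepEquiv I w w') :
    DepEquiv I (a :: w) (a :: w') := by
  obtain ⟨e, h1, h2⟩ := h
  refine ⟨⟨Fin.cases (0 : Fin (w'.length + 1)) (fun i => (e i).succ),
    Fin.cases (0 : Fin (w.length + 1)) (fun i => (e.symm i).succ), fun i => ?_, fun i => ?_⟩,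
    fun i => ?_, fun i j => ?_⟩
  · refine Fin.cases ?_ (fun i => ?_) i <;> simp
  · refine Fin.cases ?_ (fun i => ?_) i <;> simp
  · refine Fin.cases ?_ (fun i => ?_) i
    · rfl
    · exact h1 i
  · refine Fin.cases ?_ (fun i => ?_) i <;> refine Fin.cases ?_ (fun j => ?_) j
    · simp [dependenceGraph]
    · have := h1 j
      simp only [List.get_eq_getElem] at this
      simp [dependenceGraph, this]
    · simp [dependenceGraph]
    · have := h2 i j
      simpa [dependenceGraph] using this

/-- The transposition of the first two positions changes the order of these two positions only, and
between independent letters there is no arc in either direction. -/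
theorem DepEquiv.swap {a b : Letter G} (hab : I.Adj a.node b.node) (w : List (Letter G)) :
    DepEquiv I (a :: b :: w) (b :: a :: w) := by
  have h2 : ∀ i : Fin w.length,
      Equiv.swap (0 : Fin (w.length + 2)) 1 i.succ.succ = i.succ.succ := fun i =>
    Equiv.swap_apply_of_ne_of_ne (Fin.succ_ne_zero _)
      (fun h => Fin.succ_ne_zero i (Fin.succ_injective _ h))
  refine ⟨Equiv.swap (0 : Fin (w.length + 2)) 1, fun i => ?_, fun i j => ?_⟩
  · refine Fin.cases ?_ (fun i => Fin.cases ?_ (fun i => ?_) i) i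
    · simp
    · simp
    · exact (congrArg (b :: a :: w).get (h2 i)).trans rfl
  · refine Fin.cases ?_ (fun i => Fin.cases ?_ (fun i => ?_) i) i <;>
      refine Fin.cases ?_ (fun j => Fin.cases ?_ (fun j => ?_) j) j
    · simp [dependenceGraph]
    · simp [dependenceGraph, hab]
    · simp only [dependenceGraph, Equiv.swap_apply_left, h2]
      simp
      exact fun _ => Nat.succ_lt_succ (Nat.succ_pos _)
    · simp [dependenceGraph, hab.symm]
    · simp [dependenceGraph]
    · simp only [dependenceGraph, h2]
      simp
      exact fun _ => Nat.succ_lt_succ (Nat.succ_pos _)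
    · simp [dependenceGraph, h2]
    · simp [dependenceGraph, h2]
    · simp [dependenceGraph, h2]

theorem DepEquiv.move {a : Letter G} {u : List (Letter G)} (hu : ∀ b ∈ u, I.Adj b.node a.node)
    (v : List (Letter G)) : DepEquiv I (u ++ a :: v) (a :: (u ++ v)) := by
  induction u with
  | nil => exact .refl _
  | cons b u ih =>
    exact ((ih fun c hc => hu c (List.mem_cons_of_mem _ hc)).cons b).trans
      (.swap (hu b List.mem_cons_self) _)

open Classical in
/-- The projection of a word to the letters of the nodes `α` and `β`. -/
noncomputable def proj (α β : L) (w : List (Letter G)) : List (Letter G) :=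
  w.filter fun a => a.node = α ∨ a.node = β

theorem proj_append (α β : L) (w w' : List (Letter G)) :
    proj α β (w ++ w') = proj α β w ++ proj α β w' := List.filter_append _ _

theorem filter_eq_map_get {X : Type*} (P : X → Bool) (w : List X) :
    w.filter P = ((List.finRange w.length).filter fun i => P (w.get i)).map w.get := by
  conv_lhs => rw [← List.map_get_finRange w, List.filter_map]
  rfl

/-- Any two positions with letters of the nodes `α`, `β` are joined by an arc from the smaller to
the larger. An isomorphism is thus increasing on these positions, and it maps them onto the
corresponding positions of `s`; two increasing lists with the same elements are equal. -/
theorem DepEquiv.proj_eq {t s : List (Letter G)} (h : DepEquiv I t s) {α β : L}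
    (hαβ : ¬ I.Adj α β) : proj α β t = proj α β s := by
  classical
  obtain ⟨e, h1, h2⟩ := h
  have hdep : ∀ γ δ, (γ = α ∨ γ = β) → (δ = α ∨ δ = β) → ¬ I.Adj γ δ := by
    rintro γ δ (rfl | rfl) (rfl | rfl)
    · exact I.loopless.irrefl _
    · exact hαβ
    · exact fun h => hαβ h.symm
    · exact I.loopless.irrefl _
  unfold proj
  rw [filter_eq_map_get _ t, filter_eq_map_get _ s]
  have key : ((List.finRange s.length).filter fun i => decide ((s.get i).node = α ∨
      (s.get i).node = β)) = ((List.finRange t.length).filter fun i => decide ((t.get i).node = α ∨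
      (t.get i).node = β)).map e := by
    refine List.Perm.eq_of_pairwise (le := (· < ·)) ?_ ?_ ?_ ?_
    · intro a b _ _ hab hba
      exact absurd hab (lt_asymm hba)
    · exact (List.pairwise_lt_finRange _).filter _
    · rw [List.pairwise_map]
      refine ((List.pairwise_lt_finRange _).filter _).imp_of_mem ?_
      intro i j hi hj hij
      have := (h2 i j).2 ⟨hij, hdep _ _ (by simpa using hi) (by simpa using hj)⟩
      exact this.1
    · rw [List.perm_ext_iff_of_nodup ((List.nodup_finRange _).filter _)
        (((List.nodup_finRange _).filter _).map e.injective)]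
      intro i
      simp only [List.mem_filter, List.mem_finRange, true_and, List.mem_map, decide_eq_true_eq]
      constructor
      · intro hi
        refine ⟨e.symm i, ?_, e.apply_symm_apply i⟩
        rwa [← h1, e.apply_symm_apply]
      · rintro ⟨j, hj, rfl⟩
        rwa [h1]
  rw [key, List.map_map]
  refine List.map_congr_left fun i _ => ?_
  exact (h1 i).symm

/-- Induction on `p = a :: p'`. The projection to the node of `a` shows that the first letter of
this node in `q` is `a` itself. All letters before it are independent of `a`, so `a` can be moved to
the front of `q` and cancelled on both sides. -/
theorem depEquiv_of_proj {p q : List (Letter G)}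
    (h : ∀ α β, ¬ I.Adj α β → proj α β p = proj α β q) : DepEquiv I p q := by
  classical
  induction p generalizing q with
  | nil =>
    cases q with
    | nil => exact .refl _
    | cons a q =>
      have := h a.node a.node (I.loopless.irrefl _)
      simp [proj] at this
  | cons a p ih =>
    have h0 := h a.node a.node (I.loopless.irrefl _)
    simp only [proj, or_self, List.filter_cons, decide_true, if_true] at h0
    obtain ⟨u, v, rfl, hu, -, -⟩ := List.filter_eq_cons_iff.1 h0.symm
    simp only [decide_eq_true_eq] at hu
    have hind : ∀ b ∈ u, I.Adj b.node a.node := by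
      intro b hb
      by_contra hab
      have h1 := h b.node a.node hab
      simp only [proj, List.filter_cons, or_true, decide_true, if_true, List.filter_append] at h1
      -- If `b` in front of `a` were dependent on `a`, the projection of `q` to their two nodes
      -- would begin with a letter of `u`, whereas that of `p` begins with `a`; but `u` has no
      -- letter of the node of `a`.
      cases h2 : u.filter (fun c => decide (c.node = b.node ∨ c.node = a.node)) with
      | nil =>
        rw [List.filter_eq_nil_iff] at h2
        exact h2 b hb (by simp)
      | cons c l =>
        rw [h2, List.cons_append, List.cons.injEq] at h1
        have hc : c ∈ u := (List.mem_filter.1 (h2 ▸ List.mem_cons_self)).1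
        exact hu c hc (by rw [h1.1])
    refine ((ih fun α β hαβ => ?_).cons a).trans (DepEquiv.move hind v).symm
    have h1 := h α β hαβ
    by_cases ha : a.node = α ∨ a.node = β
    · have h2 : u.filter (fun c => decide (c.node = α ∨ c.node = β)) = [] := by
        rw [List.filter_eq_nil_iff]
        intro b hb hb'
        have h3 := hind b hb
        rw [decide_eq_true_eq] at hb'
        rcases ha with ha | ha <;> rcases hb' with hb' | hb' <;> rw [ha, hb'] at h3
        · exact I.loopless.irrefl _ h3
        · exact hαβ h3.symm
        · exact hαβ h3
        · exact I.loopless.irrefl _ h3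
      simp only [proj, List.filter_append, List.filter_cons, ha, decide_true, if_true, h2,
        List.nil_append, List.cons.injEq, true_and] at h1 ⊢
      exact h1
    · simpa [proj, List.filter_cons, ha] using h1

/-! ### Cutting words by the number of letters of each node. -/

open Classical in
/-- The number of letters of the node `α` in a word. -/
noncomputable def nodeCount (α : L) (w : List (Letter G)) : ℕ := w.countP fun a => a.node = α

theorem nodeCount_append (α : L) (w w' : List (Letter G)) :
    nodeCount α (w ++ w') = nodeCount α w + nodeCount α w' := List.countP_append

open Classical in
theorem nodeCount_cons (α : L) (a : Letter G) (w : List (Letter G)) :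
    nodeCount α (a :: w) = nodeCount α w + if a.node = α then 1 else 0 := by
  simp [nodeCount, List.countP_cons]

theorem nodeCount_proj {α β γ : L} (h : γ = α ∨ γ = β) (w : List (Letter G)) :
    nodeCount γ (proj α β w) = nodeCount γ w := by
  unfold nodeCount proj
  rw [List.countP_filter]
  refine List.countP_congr fun a _ => ?_
  simp only [Bool.and_eq_true, decide_eq_true_eq, and_iff_left_iff_imp]
  rintro rfl
  exact h

open Classical in
/-- The first `κ α` letters of each node `α` in a word. -/
noncomputable def takeCount (κ : L → ℕ) : List (Letter G) → List (Letter G)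
  | [] => []
  | a :: w => if κ a.node = 0 then takeCount κ w else
      a :: takeCount (Function.update κ a.node (κ a.node - 1)) w

open Classical in
/-- What is left of a word when the first `κ α` letters of each node `α` are deleted. -/
noncomputable def dropCount (κ : L → ℕ) : List (Letter G) → List (Letter G)
  | [] => []
  | a :: w => if κ a.node = 0 then a :: dropCount κ w else
      dropCount (Function.update κ a.node (κ a.node - 1)) w

theorem takeCount_dropCount_congr {κ κ' : L → ℕ} {w : List (Letter G)}
    (h : ∀ a ∈ w, κ a.node = κ' a.node) :
    takeCount κ w = takeCount κ' w ∧ dropCount κ w = dropCount κ' w := by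
  classical
  induction w generalizing κ κ' with
  | nil => exact ⟨rfl, rfl⟩
  | cons a w ih =>
    have h1 := ih fun b hb => h b (List.mem_cons_of_mem _ hb)
    have h2 := ih (κ := Function.update κ a.node (κ a.node - 1))
      (κ' := Function.update κ' a.node (κ' a.node - 1)) fun b hb => by
        simp only [Function.update_apply, h b (List.mem_cons_of_mem _ hb), h a List.mem_cons_self]
    rw [h a List.mem_cons_self] at h2
    simp only [takeCount, dropCount, h1, h2, h a List.mem_cons_self, and_self]

/-- Each node has its own budget, so erasing the letters of the other nodes does not affect which
letters of `α` and `β` are taken. -/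
theorem proj_takeCount_dropCount (α β : L) (κ : L → ℕ) (w : List (Letter G)) :
    proj α β (takeCount κ w) = takeCount κ (proj α β w) ∧
      proj α β (dropCount κ w) = dropCount κ (proj α β w) := by
  classical
  induction w generalizing κ with
  | nil => exact ⟨rfl, rfl⟩
  | cons a w ih =>
    by_cases ha : a.node = α ∨ a.node = β
    · have h1 : ∀ w, proj α β (a :: w) = a :: proj α β w := fun w => by simp [proj, ha]
      rw [h1]
      simp only [takeCount, dropCount]
      split_ifs
      · exact ⟨(ih κ).1, by rw [h1, (ih κ).2]⟩
      · exact ⟨by rw [h1, (ih _).1], (ih _).2⟩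
    · have h1 : ∀ w, proj α β (a :: w) = proj α β w := fun w => by simp [proj, ha]
      have h2 := takeCount_dropCount_congr (κ := Function.update κ a.node (κ a.node - 1)) (κ' := κ)
        (w := proj α β w) fun b hb => by
          refine Function.update_of_ne (fun h => ha ?_) _ _
          rw [← h]
          simpa using (List.mem_filter.1 hb).2
      rw [h1]
      simp only [takeCount, dropCount]
      split_ifs
      · exact ⟨(ih κ).1, by rw [h1, (ih κ).2]⟩
      · exact ⟨by rw [h1, (ih _).1, h2.1], by rw [(ih _).2, h2.2]⟩

/-- The counts need to agree only for nodes that occur in the word: in a projection to `α` and `β`,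
nothing is known about `κ` at other nodes. -/
theorem takeCount_dropCount_append {κ : L → ℕ} {x y : List (Letter G)}
    (h : ∀ a ∈ x ++ y, nodeCount a.node x = κ a.node) :
    takeCount κ (x ++ y) = x ∧ dropCount κ (x ++ y) = y := by
  classical
  induction x generalizing κ with
  | nil =>
    induction y with
    | nil => exact ⟨rfl, rfl⟩
    | cons a y ih =>
      have h1 : κ a.node = 0 := (h a List.mem_cons_self).symm
      have h2 := ih fun b hb => h b (List.mem_cons_of_mem _ hb)
      rw [List.nil_append] at h2 ⊢
      simp only [takeCount, dropCount, h1, if_true, h2, and_self]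
  | cons a x ih =>
    have h1 := h a List.mem_cons_self
    rw [nodeCount_cons, if_pos rfl] at h1
    have h2 := ih (κ := Function.update κ a.node (κ a.node - 1)) fun b hb => by
      have h3 := h b (List.mem_cons_of_mem _ hb)
      rw [nodeCount_cons] at h3
      by_cases hab : b.node = a.node
      · rw [hab, Function.update_self]
        omega
      · rw [Function.update_of_ne hab]
        rw [if_neg (Ne.symm hab)] at h3
        exact h3
    simp only [List.cons_append, takeCount, dropCount, if_neg (show ¬ κ a.node = 0 by omega), h2,
      and_self]

/-- Factors of dependence graphs in terms of projections. -/
theorem exists_depEquiv_append_iff {p t : List (Letter G)} :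
    (∃ x y, DepEquiv I t (x ++ p ++ y)) ↔ ∃ κ : L → ℕ, ∀ α β, ¬ I.Adj α β →
      ∃ x y, proj α β t = x ++ proj α β p ++ y ∧ nodeCount α x = κ α ∧ nodeCount β x = κ β := by
  constructor
  · rintro ⟨x, y, h⟩
    refine ⟨fun α => nodeCount α x, fun α β hαβ => ⟨proj α β x, proj α β y, ?_,
      nodeCount_proj (Or.inl rfl) x, nodeCount_proj (Or.inr rfl) x⟩⟩
    rw [h.proj_eq hαβ, proj_append, proj_append]
  · rintro ⟨κ, h⟩
    -- The factors for the various pairs are glued by cutting `t` once, with the common budgets `κ`.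
    -- On each dependent pair this cut projects to the given local one, and `depEquiv_of_proj`
    -- concludes.
    refine ⟨takeCount κ t, dropCount (fun α => κ α + nodeCount α p) t,
      depEquiv_of_proj fun α β hαβ => ?_⟩
    obtain ⟨x, y, hxy, hα, hβ⟩ := h α β hαβ
    have hnode : ∀ a ∈ proj α β t, a.node = α ∨ a.node = β := fun a ha => by
      simpa using (List.mem_filter.1 ha).2
    have hx : ∀ a ∈ proj α β t, nodeCount a.node x = κ a.node := fun a ha => by
      rcases hnode a ha with h | h <;> rw [h] <;> assumption
    have h1 : takeCount κ (proj α β t) = x := by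
      rw [hxy, List.append_assoc] at hx ⊢
      exact (takeCount_dropCount_append hx).1
    have h2 : dropCount (fun α => κ α + nodeCount α p) (proj α β t) = y := by
      have h3 : ∀ a ∈ proj α β t,
          nodeCount a.node (x ++ proj α β p) = κ a.node + nodeCount a.node p := fun a ha => by
        rw [nodeCount_append, nodeCount_proj (hnode a ha), hx a ha]
      rw [hxy] at h3 ⊢
      exact (takeCount_dropCount_append h3).2
    rw [proj_append, proj_append, (proj_takeCount_dropCount α β _ t).1,
      (proj_takeCount_dropCount α β _ t).2, h1, h2, hxy]

end GraphProduct

set_option linter.unusedSectionVars false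

/-! ### Lists of the defined values of a partial function -/

/-- The defined values among `f 0, …, f (n - 1)`. -/
def valuesBelow {X : Type*} (f : ℕ → Option X) (n : ℕ) : List X := (List.range n).filterMap f

section valuesBelow

variable {X : Type*} {f g : ℕ → Option X}

theorem valuesBelow_succ (f : ℕ → Option X) (n : ℕ) :
    valuesBelow f (n + 1) = valuesBelow f n ++ (f n).toList := by
  cases h : f n <;> simp [valuesBelow, List.range_succ, List.filterMap_append, h]

theorem valuesBelow_add (f : ℕ → Option X) (m n : ℕ) :
    valuesBelow f (m + n) = valuesBelow f m ++ valuesBelow (fun i => f (m + i)) n := by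
  induction n with
  | zero => simp [valuesBelow]
  | succ n ih => rw [← add_assoc, valuesBelow_succ, ih, valuesBelow_succ, List.append_assoc]

theorem valuesBelow_congr {n : ℕ} (h : ∀ i < n, f i = g i) : valuesBelow f n = valuesBelow g n :=
  List.filterMap_congr fun i hi => h i (List.mem_range.1 hi)

theorem valuesBelow_filter (P : X → Bool) (f : ℕ → Option X) (n : ℕ) :
    (valuesBelow f n).filter P = valuesBelow (fun i => (f i).filter P) n := by
  simp [valuesBelow, List.filter_filterMap]

open Classical in
theorem length_valuesBelow (f : ℕ → Option X) (n : ℕ) :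
    (valuesBelow f n).length = Nat.count (fun i => (f i).isSome) n := by
  induction n with
  | zero => simp [valuesBelow]
  | succ n ih =>
    rw [valuesBelow_succ, List.length_append, ih, Nat.count_succ]
    cases f n <;> simp

open Classical in
-- The index of an entry is the number of defined values before it. In this way a list that cannot
-- be stored is accessed by counting.
theorem getElem?_valuesBelow {n k : ℕ} {x : X} : (valuesBelow f n)[k]? = some x ↔
    ∃ i < n, f i = some x ∧ Nat.count (fun i => (f i).isSome) i = k := by
  induction n with
  | zero => simp [valuesBelow]
  | succ n ih =>
    rw [valuesBelow_succ]
    constructor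
    · intro h
      rcases lt_or_ge k (valuesBelow f n).length with hk | hk
      · rw [List.getElem?_append_left hk, ih] at h
        obtain ⟨i, hi, h⟩ := h
        exact ⟨i, by omega, h⟩
      · rw [List.getElem?_append_right hk] at h
        cases hf : f n with
        | none => simp [hf] at h
        | some y =>
          rw [hf, Option.toList_some, List.getElem?_singleton] at h
          split_ifs at h with h0
          refine ⟨n, Nat.lt_succ_self n, hf.trans h, ?_⟩
          rw [← length_valuesBelow]
          omega
    · rintro ⟨i, hi, h1, h2⟩
      rcases Nat.lt_succ_iff_lt_or_eq.1 hi with hi | rfl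
      · have h3 := ih.2 ⟨i, hi, h1, h2⟩
        rw [List.getElem?_append_left (List.getElem?_eq_some_iff.1 h3).1, h3]
      · rw [List.getElem?_append_right (by rw [length_valuesBelow]; omega), length_valuesBelow, h2,
          h1]
        simp

open Classical in
theorem valuesBelow_prefix_iff {n m : ℕ} : valuesBelow f n <+: valuesBelow g m ↔
    ∀ i < n, (f i).isSome → ∃ j < m, g j = f i ∧
      Nat.count (fun i => (g i).isSome) j = Nat.count (fun i => (f i).isSome) i := by
  rw [List.prefix_iff_getElem?]
  constructor
  · intro h i hi hf
    obtain ⟨x, hx⟩ := Option.isSome_iff_exists.1 hf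
    have h1 := getElem?_valuesBelow.2 ⟨i, hi, hx, rfl⟩
    obtain ⟨h2, h3⟩ := List.getElem?_eq_some_iff.1 h1
    have h4 := h _ h2
    rw [h3, getElem?_valuesBelow] at h4
    obtain ⟨j, hj, h5, h6⟩ := h4
    exact ⟨j, hj, h5.trans hx.symm, h6⟩
  · intro h k hk
    obtain ⟨i, hi, h1, h2⟩ := getElem?_valuesBelow.1 (List.getElem?_eq_getElem hk)
    obtain ⟨j, hj, h3, h4⟩ := h i hi (by rw [h1]; rfl)
    exact getElem?_valuesBelow.2 ⟨j, hj, h3.trans h1, h4.trans h2⟩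

/-- The length of `valuesBelow f r` grows by at most one with `r`, so it attains the length of `x`;
every cut of the list comes from a cut of the positions. -/
theorem valuesBelow_eq_append {n : ℕ} {x y : List X} (h : valuesBelow f n = x ++ y) :
    ∃ r ≤ n, valuesBelow f r = x ∧ valuesBelow (fun i => f (r + i)) (n - r) = y := by
  have key : ∃ r ≤ n, (valuesBelow f r).length = x.length := by
    have hx : x.length ≤ (valuesBelow f n).length := by simp [h]
    clear h
    induction n with
    | zero =>
      refine ⟨0, le_rfl, ?_⟩
      simp [valuesBelow] at hx ⊢
      simp [hx]
    | succ n ih =>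
      rcases le_or_gt x.length (valuesBelow f n).length with h1 | h1
      · obtain ⟨r, hr, h2⟩ := ih h1
        exact ⟨r, by omega, h2⟩
      · refine ⟨n + 1, le_rfl, ?_⟩
        rw [valuesBelow_succ, List.length_append] at hx ⊢
        have := Option.length_toList_le (o := f n)
        omega
  obtain ⟨r, hr, h1⟩ := key
  have h2 := valuesBelow_add f r (n - r)
  rw [Nat.add_sub_cancel' hr, h] at h2
  obtain ⟨h3, h4⟩ := List.append_inj h2 h1.symm
  exact ⟨r, hr, h3.symm, h4.symm⟩

end valuesBelow

namespace GraphProduct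

variable {L : Type u} {G : L → Type v} [∀ α, Group (G α)] {S : ∀ α, Finset (G α)}

/-! ### Well-formed inputs -/

/-- The pairs of tokens that may follow each other in the input; `none` is a margin. -/
def Follows : Option (Token S) → Option (Token S) → Prop
  | some .opening, some (.gen _ _) => True
  | some .opening, _ => False
  | some (.gen α _), some (.gen β _) => α = β
  | some (.gen _ _), some .closing => True
  | some (.gen _ _), _ => False
  | _, some .opening => True
  | _, some .sep => True
  | _, none => True
  | _, _ => False

/-- Any two consecutive tokens of `z` may follow each other, when `z` is preceded by `p`. -/
def Ok : Option (Token S) → List (Token S) → Prop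
  | p, [] => Follows p none
  | p, a :: z => Follows p (some a) ∧ Ok (some a) z

theorem ok_iff {p : Option (Token S)} {z : List (Token S)} :
    Ok p z ↔ ∀ i < z.length + 1, Follows (if i = 0 then p else z[i - 1]?) z[i]? := by
  induction z generalizing p with
  | nil => simp [Ok]
  | cons a z ih =>
    rw [Ok, ih]
    constructor
    · rintro ⟨h1, h2⟩ i hi
      cases i with
      | zero => simpa using h1
      | succ i =>
        have := h2 i (by simpa using hi)
        cases i <;> simpa using this
    · intro h
      refine ⟨by simpa using h 0 (by omega), fun i hi => ?_⟩
      have := h (i + 1) (by simpa using hi)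
      cases i <;> simpa using this

theorem Ok.of_append {p : Option (Token S)} {x : List (Token S)} {a : Token S}
    {y : List (Token S)} (h : Ok p (x ++ a :: y)) : Ok (some a) y := by
  induction x generalizing p with
  | nil => exact h.2
  | cons b x ih => exact ih h.2

/-- The margins, closing brackets and separators are the tokens between blocks. -/
def IsTop (p : Option (Token S)) : Prop := p = none ∨ p = some .closing ∨ p = some .sep

theorem code_cons (α : L) (w : List (S α)) (b : List (Σ α, List (S α))) :
    code (⟨α, w⟩ :: b) = Token.opening :: (w.map (Token.gen α) ++ Token.closing :: code b) := by
  simp [code]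

/-- The clauses describe the states of a finite automaton: between blocks, just after an opening
bracket, and inside a block of the node `α`. What comes after `l` is a margin or a separator, and
neither may follow an unfinished block. -/
theorem Ok.exists_code {l r : List (Token S)} (hl : Token.sep ∉ l)
    (hr : r = [] ∨ ∃ r', r = .sep :: r') {p : Option (Token S)} (h : Ok p (l ++ r)) :
    (IsTop p → ∃ b, l = code b) ∧
    (p = some .opening → ∃ (α : L) (u : List (S α)) (b : List (Σ α, List (S α))),
      l = u.map (Token.gen α) ++ .closing :: code b) ∧
    ∀ α s, p = some (.gen α s) → ∃ (u : List (S α)) (b : List (Σ α, List (S α))),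
      l = u.map (Token.gen α) ++ .closing :: code b := by
  induction l generalizing p with
  | nil =>
    refine ⟨fun _ => ⟨[], rfl⟩, ?_, ?_⟩
    · rintro rfl
      rcases hr with rfl | ⟨r', rfl⟩ <;> simp [Ok, Follows] at h
    · rintro α s rfl
      rcases hr with rfl | ⟨r', rfl⟩ <;> simp [Ok, Follows] at h
  | cons a l ih =>
    obtain ⟨h1, h2⟩ := h
    have ih := ih (fun h => hl (List.mem_cons_of_mem _ h)) h2
    refine ⟨?_, ?_, ?_⟩
    · intro hp
      cases a with
      | gen => rcases hp with rfl | rfl | rfl <;> simp [Follows] at h1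
      | opening =>
        obtain ⟨α, u, b, rfl⟩ := ih.2.1 rfl
        exact ⟨⟨α, u⟩ :: b, (code_cons _ _ _).symm⟩
      | closing => rcases hp with rfl | rfl | rfl <;> simp [Follows] at h1
      | sep => exact absurd List.mem_cons_self hl
    · rintro rfl
      cases a with
      | gen α s =>
        obtain ⟨u, b, rfl⟩ := ih.2.2 α s rfl
        exact ⟨α, s :: u, b, rfl⟩
      | opening => simp [Follows] at h1
      | closing => simp [Follows] at h1
      | sep => simp [Follows] at h1
    · rintro α s rfl
      cases a with
      | gen β s' =>
        obtain rfl : α = β := h1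
        obtain ⟨u, b, rfl⟩ := ih.2.2 α s' rfl
        exact ⟨s' :: u, b, rfl⟩
      | opening => simp [Follows] at h1
      | closing =>
        obtain ⟨b, rfl⟩ := ih.1 (Or.inr (Or.inl rfl))
        exact ⟨[], b, rfl⟩
      | sep => exact absurd List.mem_cons_self hl

theorem ok_gens {α : L} {r : List (Token S)} (hr : Ok (some .closing) r) (s : S α)
    (w : List (S α)) : Ok (some (.gen α s)) (w.map (Token.gen α) ++ .closing :: r) := by
  induction w generalizing s with
  | nil => exact ⟨trivial, hr⟩
  | cons s' w ih => exact ⟨rfl, ih s'⟩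

/-- Empty blocks must be excluded because `Follows` forbids a closing bracket right after an opening
one. Nothing is lost, as an empty block has value 1 and represents no letter. -/
theorem ok_code {r : List (Token S)} (hr : ∀ p, IsTop p → Ok p r) {b : List (Σ α, List (S α))}
    (hb : ∀ x ∈ b, x.2 ≠ []) {p : Option (Token S)} (hp : IsTop p) : Ok p (code b ++ r) := by
  induction b generalizing p with
  | nil => exact hr p hp
  | cons x b ih =>
    obtain ⟨α, w⟩ := x
    rw [code_cons]
    cases w with
    | nil => exact absurd rfl (hb _ List.mem_cons_self)
    | cons s w =>
      refine ⟨?_, trivial, ?_⟩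
      · rcases hp with rfl | rfl | rfl <;> trivial
      · simp only [List.append_eq, List.append_assoc, List.cons_append]
        exact ok_gens (ih (fun x hx => hb x (List.mem_cons_of_mem _ hx)) (Or.inr (Or.inl rfl))) s w

theorem sep_notMem_code (b : List (Σ α, List (S α))) : Token.sep ∉ code b := by
  simp [code]

/-! ### The letters of an input word -/

open Classical in
/-- The generator of `G α` given by a token. -/
noncomputable def toGen (α : L) : Token S → Option (S α)
  | .gen β s => if h : β = α then some (h ▸ s) else none
  | _ => none

theorem toGen_eq_some {α : L} {a : Token S} {s : S α} : toGen α a = some s ↔ a = .gen α s := by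
  cases a with
  | gen β s' =>
    constructor
    · intro h
      by_cases hβ : β = α
      · subst hβ
        simp [toGen] at h
        rw [h]
      · simp [toGen, hβ] at h
    · intro h
      cases h
      simp [toGen]
  | opening => simp [toGen]
  | closing => simp [toGen]
  | sep => simp [toGen]

/-- The generators of `G α` at the beginning of a string of tokens. -/
noncomputable def leading (α : L) : List (Token S) → List (S α)
  | [] => []
  | a :: z =>
    match toGen α a with
    | some s => s :: leading α z
    | none => []

theorem leading_gens (α : L) (w : List (S α)) (r : List (Token S)) :
    leading α (w.map (Token.gen α) ++ .closing :: r) = w := by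
  induction w with
  | nil => simp [leading, toGen]
  | cons s w ih => simp [leading, toGen, ih]

theorem leading_getElem? {α : L} {z : List (Token S)} {k : ℕ} {s : S α} :
    (leading α z)[k]? = some s ↔
      (∀ j < k, ∃ s' : S α, z[j]? = some (.gen α s')) ∧ z[k]? = some (.gen α s) := by
  induction z generalizing k with
  | nil => simp [leading]
  | cons a z ih =>
    cases h : toGen α a with
    | none =>
      have h' : ∀ s, a ≠ .gen α s := fun s hs => by rw [toGen_eq_some.2 hs] at h; cases h
      simp only [leading, h, List.getElem?_nil, reduceCtorEq, false_iff, not_and]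
      intro h1 h2
      cases k with
      | zero => exact h' s (by simpa using h2)
      | succ k =>
        obtain ⟨s', hs'⟩ := h1 0 (by omega)
        exact h' s' (by simpa using hs')
    | some s₀ =>
      have h' := toGen_eq_some.1 h
      subst h'
      simp only [leading, h]
      cases k with
      | zero => simp
      | succ k =>
        rw [List.getElem?_cons_succ, List.getElem?_cons_succ, ih]
        refine and_congr_left fun _ => ⟨fun h j hj => ?_, fun h j hj => ?_⟩
        · cases j with
          | zero => exact ⟨s₀, rfl⟩
          | succ j => exact h j (by omega)
        · exact h (j + 1) (by omega)

open Classical in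
/-- The letter whose block begins at the beginning of a string of tokens. -/
noncomputable def labelOf (z : List (Token S)) : Option (Letter G) :=
  if h : ∃ a : Letter G, z.head? = some .opening ∧
    ((leading a.node z.tail).map Subtype.val).prod = a.1.2 then some h.choose else none

/-- The letter is unique: a value other than 1 requires at least one generator, and the first
generator after the bracket determines the node. -/
theorem labelOf_eq_some {z : List (Token S)} {a : Letter G} :
    labelOf z = some a ↔ z.head? = some .opening ∧
      ((leading a.node z.tail).map Subtype.val).prod = a.1.2 := by
  have huniq : ∀ a b : Letter G, ((leading a.node z.tail).map Subtype.val).prod = a.1.2 →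
      ((leading b.node z.tail).map Subtype.val).prod = b.1.2 → a = b := by
    have hne : ∀ a : Letter G, ((leading a.node z.tail).map Subtype.val).prod = a.1.2 →
        ∃ s : S a.node, z.tail[0]? = some (.gen a.node s) := by
      intro a ha
      cases h : leading a.node z.tail with
      | nil => rw [h] at ha; exact absurd ha.symm a.2
      | cons s l => exact ⟨s, (leading_getElem?.1 (show (leading a.node z.tail)[0]? = some s by
          rw [h]; rfl)).2⟩
    intro a b ha hb
    obtain ⟨s, hs⟩ := hne a ha
    obtain ⟨s', hs'⟩ := hne b hb
    rw [hs, Option.some.injEq, Token.gen.injEq] at hs'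
    have hab := hs'.1
    obtain ⟨⟨α, x⟩, hx⟩ := a
    obtain ⟨⟨β, y⟩, hy⟩ := b
    obtain rfl : α = β := hab
    exact Subtype.ext (Sigma.ext rfl (heq_of_eq (ha.symm.trans hb)))
  unfold labelOf
  split_ifs with h
  · rw [Option.some.injEq]
    constructor
    · rintro rfl
      exact h.choose_spec
    · intro h'
      exact huniq _ _ h.choose_spec.2 h'.2
  · simp only [false_iff]
    exact fun h' => h ⟨a, h'⟩

theorem labelOf_eq_none {z : List (Token S)} (h : z.head? ≠ some .opening) : labelOf z = none := by
  by_contra h'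
  obtain ⟨a, ha⟩ := Option.ne_none_iff_exists'.1 h'
  exact h (labelOf_eq_some.1 ha).1

open Classical in
/-- The letter represented by a block. -/
noncomputable def blockLabel (x : Σ α, List (S α)) : Option (Letter G) :=
  if h : (x.2.map Subtype.val).prod ≠ 1 then some ⟨⟨x.1, (x.2.map Subtype.val).prod⟩, h⟩ else none

theorem blockLabel_eq_some {x : Σ α, List (S α)} {a : Letter G} :
    blockLabel x = some a ↔ (⟨x.1, (x.2.map Subtype.val).prod⟩ : Σ α, G α) = a.1 := by
  unfold blockLabel
  split_ifs with h
  · exact (Option.some_inj (α := {x : Σ α, G α // x.2 ≠ 1})).trans Subtype.ext_iff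
  · refine ⟨False.elim, fun h' => ?_⟩
    have := a.2
    rw [← h'] at this
    exact (h this).elim

theorem labelOf_block (α : L) (w : List (S α)) (r : List (Token S)) :
    labelOf (Token.opening :: (w.map (Token.gen α) ++ .closing :: r)) = blockLabel ⟨α, w⟩ := by
  refine Option.ext fun a => ?_
  change _ = some a ↔ _ = some a
  rw [labelOf_eq_some, blockLabel_eq_some]
  simp only [List.head?_cons, List.tail_cons, true_and]
  obtain ⟨⟨β, x⟩, hx⟩ := a
  by_cases hβ : α = β
  · subst hβ
    change ((leading α _).map Subtype.val).prod = x ↔ _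
    rw [leading_gens]
    constructor
    · rintro rfl
      rfl
    · intro h
      exact eq_of_heq (Sigma.mk.inj h).2
  · have h0 : leading β (w.map (Token.gen α) ++ .closing :: r) = [] := by
      cases w <;> simp [leading, toGen, hβ]
    change ((leading β _).map Subtype.val).prod = x ↔ _
    rw [h0]
    exact ⟨fun h => (hx h.symm).elim, fun h => (hβ (Sigma.mk.inj h).1).elim⟩

theorem represents_iff {b : List (Σ α, List (S α))} {w : List (Letter G)} :
    Represents b w ↔ b.map blockLabel = w.map some := by
  change b.map _ = w.map (fun a : Letter G => a.1) ↔ _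
  induction b generalizing w with
  | nil => cases w <;> simp
  | cons x b ih =>
    cases w with
    | nil => simp
    | cons a w =>
      rw [List.map_cons, List.map_cons, List.map_cons, List.map_cons, List.cons.injEq,
        List.cons.injEq, ih, blockLabel_eq_some]

/-- Only opening brackets carry a label. Scanning all token positions thus yields the letters of the
blocks in order, without decoding the string. -/
theorem valuesBelow_code (b : List (Σ α, List (S α))) (r : List (Token S)) :
    valuesBelow (fun i => labelOf ((code b ++ r).drop i)) (code b).length =
      b.filterMap blockLabel := by
  induction b with
  | nil => rfl
  | cons x b ih =>
    obtain ⟨α, w⟩ := x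
    have h1 : (code (⟨α, w⟩ :: b)).length = 1 + ((w.length + 1) + (code b).length) := by
      rw [code_cons]
      simp
      omega
    have h2 : ∀ i < w.length + 1,
        labelOf ((code (⟨α, w⟩ :: b) ++ r).drop (1 + i)) = none := by
      intro i hi
      refine labelOf_eq_none ?_
      rw [List.head?_drop, code_cons, add_comm 1 i, List.cons_append, List.getElem?_cons_succ,
        List.append_assoc]
      rcases lt_or_ge i w.length with h | h
      · rw [List.getElem?_append_left (by simpa using h)]
        simp [h]
      · obtain rfl : i = w.length := by omega
        rw [List.getElem?_append_right (by simp)]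
        simp
    have h3 : ∀ i, (code (⟨α, w⟩ :: b) ++ r).drop (1 + ((w.length + 1) + i)) =
        (code b ++ r).drop i := by
      intro i
      rw [code_cons, ← List.drop_drop, ← List.drop_drop]
      congr 1
      have h : (w.map (Token.gen α) ++ [Token.closing]).length = w.length + 1 := by simp
      rw [← h, List.cons_append, List.drop_succ_cons, List.drop_zero]
      simpa using List.drop_left' (l₂ := code b ++ r) h
    rw [h1, valuesBelow_add, valuesBelow_add, valuesBelow_congr (g := fun _ => none) h2]
    simp only [h3, ih]
    have h4 : labelOf (code (⟨α, w⟩ :: b) ++ r) = blockLabel ⟨α, w⟩ := by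
      rw [code_cons, List.cons_append, List.append_assoc, List.cons_append, labelOf_block]
    cases h : blockLabel ⟨α, w⟩ <;> simp [valuesBelow, h4, h]

/-- Every opening bracket is the beginning of a block with a nontrivial value. -/
def Labelled (z : List (Token S)) : Prop :=
  ∀ i < z.length, z[i]? = some .opening → (labelOf (z.drop i)).isSome

theorem labelled_cons {a : Token S} {z : List (Token S)} :
    Labelled (a :: z) ↔ (a = .opening → (labelOf (a :: z)).isSome) ∧ Labelled z := by
  constructor
  · intro h
    refine ⟨fun ha => h 0 (by simp) (by simp [ha]), fun i hi hz => ?_⟩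
    exact h (i + 1) (by simpa using hi) (by simpa using hz)
  · rintro ⟨h1, h2⟩ i hi hz
    cases i with
    | zero => exact h1 (by simpa using hz)
    | succ i => exact h2 i (by simpa using hi) (by simpa using hz)

theorem labelled_gens {α : L} {w : List (S α)} {r : List (Token S)} :
    Labelled (w.map (Token.gen α) ++ .closing :: r) ↔ Labelled r := by
  induction w with
  | nil => simp [labelled_cons]
  | cons s w ih => simp [labelled_cons, ih]

theorem labelled_code {b : List (Σ α, List (S α))} {r : List (Token S)} :
    Labelled (code b ++ r) ↔ (∀ x ∈ b, (blockLabel x).isSome) ∧ Labelled r := by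
  induction b with
  | nil => simp [code]
  | cons x b ih =>
    obtain ⟨α, w⟩ := x
    rw [code_cons, List.cons_append, labelled_cons, List.append_assoc, List.cons_append,
      labelled_gens, ih, labelOf_block]
    simp [and_assoc]

end GraphProduct

namespace GraphProduct

variable {L : Type u} {G : L → Type v} [∀ α, Group (G α)] {S : ∀ α, Finset (G α)}

/-! ### Pattern matching in terms of positions of the input -/

/-- A block of the node `α` with a nontrivial value begins at the position `i`. -/
def NodeAt (α : L) (z : List (Token S)) (i : ℕ) : Prop :=
  z[i]? = some .opening ∧ ((leading α (z.drop (i + 1))).map Subtype.val).prod ≠ 1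

/-- Blocks of the node `α` that represent the same letter begin at the positions `i` and `j`. -/
def SameAt (α : L) (z : List (Token S)) (i j : ℕ) : Prop :=
  NodeAt α z i ∧ NodeAt α z j ∧ ((leading α (z.drop (i + 1))).map Subtype.val).prod =
    ((leading α (z.drop (j + 1))).map Subtype.val).prod

theorem nodeAt_iff {α : L} {z : List (Token S)} {i : ℕ} :
    NodeAt α z i ↔ ∃ a : Letter G, labelOf (z.drop i) = some a ∧ a.node = α := by
  constructor
  · rintro ⟨h1, h2⟩
    refine ⟨⟨⟨α, _⟩, h2⟩, labelOf_eq_some.2 ⟨by rwa [List.head?_drop], ?_⟩, rfl⟩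
    rw [List.tail_drop]
    rfl
  · rintro ⟨a, h, rfl⟩
    obtain ⟨h1, h2⟩ := labelOf_eq_some.1 h
    rw [List.head?_drop] at h1
    rw [List.tail_drop] at h2
    exact ⟨h1, by rw [h2]; exact a.2⟩

theorem sameAt_iff {α : L} {z : List (Token S)} {i j : ℕ} : SameAt α z i j ↔
    ∃ a : Letter G, labelOf (z.drop i) = some a ∧ labelOf (z.drop j) = some a ∧ a.node = α := by
  constructor
  · rintro ⟨h1, h2, h3⟩
    obtain ⟨a, ha, rfl⟩ := nodeAt_iff.1 h1
    refine ⟨a, ha, labelOf_eq_some.2 ⟨by rw [List.head?_drop]; exact h2.1, ?_⟩, rfl⟩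
    have := (labelOf_eq_some.1 ha).2
    rw [List.tail_drop] at this ⊢
    rw [← h3, this]
  · rintro ⟨a, h1, h2, rfl⟩
    refine ⟨nodeAt_iff.2 ⟨a, h1, rfl⟩, nodeAt_iff.2 ⟨a, h2, rfl⟩, ?_⟩
    have h3 := (labelOf_eq_some.1 h1).2
    have h4 := (labelOf_eq_some.1 h2).2
    rw [List.tail_drop] at h3 h4
    rw [h3, h4]

open Classical in
/-- The letter whose block begins at the position `i`, if it belongs to one of the nodes `α`, `β`. -/
noncomputable def pairAt (α β : L) (z : List (Token S)) (i : ℕ) : Option (Letter G) :=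
  (labelOf (z.drop i)).filter fun a => a.node = α ∨ a.node = β

theorem pairAt_eq_some {α β : L} {z : List (Token S)} {i : ℕ} {a : Letter G} :
    pairAt α β z i = some a ↔ labelOf (z.drop i) = some a ∧ (a.node = α ∨ a.node = β) := by
  simp [pairAt, Option.filter_eq_some_iff]

theorem isSome_pairAt {α β : L} {z : List (Token S)} {i : ℕ} :
    (pairAt α β z i).isSome ↔ NodeAt α z i ∨ NodeAt β z i := by
  simp only [Option.isSome_iff_exists, pairAt_eq_some, nodeAt_iff, ← exists_or, ← and_or_left]

theorem pairAt_eq_iff {α β : L} {z : List (Token S)} {i j : ℕ} (h : (pairAt α β z i).isSome) :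
    pairAt α β z j = pairAt α β z i ↔ SameAt α z i j ∨ SameAt β z i j := by
  simp only [sameAt_iff, ← exists_or, ← and_or_left]
  obtain ⟨a, ha⟩ := Option.isSome_iff_exists.1 h
  rw [ha]
  rw [pairAt_eq_some] at ha ⊢
  constructor
  · exact fun h => ⟨a, ha.1, h⟩
  · rintro ⟨b, h1, h2⟩
    obtain rfl : a = b := Option.some_injective _ (ha.1.symm.trans h1)
    exact h2

open Classical in
theorem nodeCount_valuesBelow (α : L) (f : ℕ → Option (Letter G)) (n : ℕ) :
    nodeCount α (valuesBelow f n) = Nat.count (fun i => ∃ a, f i = some a ∧ a.node = α) n := by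
  induction n with
  | zero => simp [valuesBelow, nodeCount]
  | succ n ih =>
    rw [valuesBelow_succ, Nat.count_succ, ← ih]
    cases h : f n <;> simp [nodeCount, List.countP_append, List.countP_singleton]

open Classical in
/-- The letters of the nodes `α` and `β` before the position `s` occur as a factor after the
position `s`, and this factor is preceded by `k` letters of the node `α` and `l` letters of the node
`β`. -/
def Occurs (α β : L) (z : List (Token S)) (s k l : ℕ) : Prop :=
  ∃ r < z.length + 1, s + 1 + r ≤ z.length ∧
    Nat.count (fun i => NodeAt α z (s + 1 + i)) r = k ∧
    Nat.count (fun i => NodeAt β z (s + 1 + i)) r = l ∧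
    ∀ i < s, (NodeAt α z i ∨ NodeAt β z i) → ∃ j < z.length, s + 1 + (r + j) < z.length ∧
      (SameAt α z i (s + 1 + (r + j)) ∨ SameAt β z i (s + 1 + (r + j))) ∧
      Nat.count (fun i => NodeAt α z (s + 1 + (r + i)) ∨ NodeAt β z (s + 1 + (r + i))) j =
        Nat.count (fun i => NodeAt α z i ∨ NodeAt β z i) i

/-- The number `r` marks the end of `x` within the part after the separator. From there on the
projection of the pattern has to be a prefix, which `valuesBelow_prefix_iff` expresses by matching
letters of equal rank. -/
theorem occurs_iff {α β : L} {z : List (Token S)} {s k l : ℕ} (hs : s < z.length) :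
    Occurs α β z s k l ↔ ∃ x y,
      proj α β (valuesBelow (fun i => labelOf (z.drop (s + 1 + i))) (z.length - (s + 1))) =
        x ++ proj α β (valuesBelow (fun i => labelOf (z.drop i)) s) ++ y ∧
      nodeCount α x = k ∧ nodeCount β x = l := by
  classical
  have h1 : ∀ f n, proj α β (valuesBelow f n) =
      valuesBelow (fun i => (f i).filter fun a : Letter G => a.node = α ∨ a.node = β) n :=
    fun f n => valuesBelow_filter _ f n
  rw [h1, h1]
  change _ ↔ ∃ x y, valuesBelow (fun i => pairAt α β z (s + 1 + i)) _ =
    x ++ valuesBelow (pairAt α β z) s ++ y ∧ _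
  have h2 : ∀ γ r, γ = α ∨ γ = β →
      nodeCount γ (valuesBelow (fun i => pairAt α β z (s + 1 + i)) r) =
        Nat.count (fun i => NodeAt γ z (s + 1 + i)) r := by
    intro γ r hγ
    rw [nodeCount_valuesBelow]
    congr 1
    funext i
    rw [nodeAt_iff]
    refine propext (exists_congr fun a => ?_)
    rw [pairAt_eq_some]
    constructor
    · exact fun h => ⟨h.1.1, h.2⟩
    · rintro ⟨h, rfl⟩
      exact ⟨⟨h, hγ⟩, rfl⟩
  have h3 : ∀ r, s + 1 + r ≤ z.length → (valuesBelow (pairAt α β z) s <+: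
      valuesBelow (fun i => pairAt α β z (s + 1 + (r + i))) (z.length - (s + 1) - r) ↔
      ∀ i < s, (NodeAt α z i ∨ NodeAt β z i) → ∃ j < z.length, s + 1 + (r + j) < z.length ∧
      (SameAt α z i (s + 1 + (r + j)) ∨ SameAt β z i (s + 1 + (r + j))) ∧
      Nat.count (fun i => NodeAt α z (s + 1 + (r + i)) ∨ NodeAt β z (s + 1 + (r + i))) j =
        Nat.count (fun i => NodeAt α z i ∨ NodeAt β z i) i) := by
    intro r hr
    rw [valuesBelow_prefix_iff]
    simp only [isSome_pairAt]
    refine forall_congr' fun i => forall_congr' fun _ => forall_congr' fun hi => ?_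
    have hi := isSome_pairAt.2 hi
    constructor
    · rintro ⟨j, hj, h4, h5⟩
      exact ⟨j, by omega, by omega, (pairAt_eq_iff hi).1 h4, h5⟩
    · rintro ⟨j, hj, hj', h4, h5⟩
      exact ⟨j, by omega, (pairAt_eq_iff hi).2 h4, h5⟩
  constructor
  · rintro ⟨r, hr, hr', rfl, rfl, h⟩
    obtain ⟨y, hy⟩ := (h3 r hr').2 h
    refine ⟨_, y, ?_, h2 α r (.inl rfl), h2 β r (.inr rfl)⟩
    rw [List.append_assoc, hy, ← valuesBelow_add]
    congr 1
    omega
  · rintro ⟨x, y, h, rfl, rfl⟩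
    rw [List.append_assoc] at h
    obtain ⟨r, hr, rfl, h4⟩ := valuesBelow_eq_append h
    exact ⟨r, by omega, by omega, (h2 α r (.inl rfl)).symm, (h2 β r (.inr rfl)).symm,
      (h3 r (by omega)).1 ⟨y, h4.symm⟩⟩

theorem valuesBelow_code_sep (b b' : List (Σ α, List (S α))) :
    valuesBelow (fun i => labelOf ((code b ++ Token.sep :: code b').drop i)) (code b).length =
      b.filterMap blockLabel ∧
    valuesBelow (fun i => labelOf ((code b ++ Token.sep :: code b').drop ((code b).length + 1 + i)))
      ((code b ++ Token.sep :: code b').length - ((code b).length + 1)) =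
      b'.filterMap blockLabel := by
  refine ⟨valuesBelow_code _ _, ?_⟩
  rw [← valuesBelow_code b' []]
  have h1 : (code b ++ Token.sep :: code b').length - ((code b).length + 1) = (code b').length := by
    simp
    omega
  rw [h1]
  refine valuesBelow_congr fun i _ => ?_
  rw [← List.drop_drop, ← List.drop_drop, List.drop_left]
  simp

/-! ### Recognising well-formed inputs and assembling the criterion. -/

theorem represents_iff_isSome {b : List (Σ α, List (S α))} {w : List (Letter G)} :
    Represents b w ↔ (∀ x ∈ b, (blockLabel x).isSome) ∧ w = b.filterMap blockLabel := by
  rw [represents_iff]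
  induction b generalizing w with
  | nil => cases w <;> simp
  | cons x b ih =>
    cases h : blockLabel x with
    | none => cases w <;> simp [h]
    | some a =>
      cases w with
      | nil => simp [h]
      | cons a' w =>
        simp only [List.map_cons, List.cons.injEq, ih, List.mem_cons, forall_eq_or_imp, h,
          Option.isSome_some, true_and, List.filterMap_cons_some h, Option.some.injEq]
        constructor
        · rintro ⟨rfl, h1, rfl⟩
          exact ⟨h1, rfl, rfl⟩
        · rintro ⟨h1, rfl, rfl⟩
          exact ⟨rfl, h1, rfl⟩

theorem exists_code_sep_iff {z : List (Token S)} {s : ℕ} :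
    (∃ b b' : List (Σ α, List (S α)), z = code b ++ .sep :: code b' ∧ s = (code b).length ∧
      (∀ x ∈ b, (blockLabel x).isSome) ∧ ∀ x ∈ b', (blockLabel x).isSome) ↔
    Ok none z ∧ Labelled z ∧ s < z.length ∧ z[s]? = some .sep ∧
      ∀ j < z.length, z[j]? = some .sep → j = s := by
  constructor
  · rintro ⟨b, b', rfl, rfl, h1, h2⟩
    have hne : ∀ b : List (Σ α, List (S α)), (∀ x ∈ b, (blockLabel x).isSome) →
        ∀ x ∈ b, x.2 ≠ [] := by
      intro b hb x hx h
      obtain ⟨a, ha⟩ := Option.isSome_iff_exists.1 (hb x hx)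
      obtain ⟨α, w⟩ := x
      obtain rfl : w = [] := h
      rw [blockLabel_eq_some] at ha
      have := a.2
      rw [← ha] at this
      exact this rfl
    refine ⟨ok_code ?_ (hne b h1) (Or.inl rfl), ?_, by simp, by simp, ?_⟩
    · intro p hp
      refine ⟨by rcases hp with rfl | rfl | rfl <;> trivial, ?_⟩
      rw [← List.append_nil (code b')]
      exact ok_code (fun p hp => by rcases hp with rfl | rfl | rfl <;> trivial) (hne b' h2)
        (Or.inr (Or.inr rfl))
    · rw [labelled_code, labelled_cons, ← List.append_nil (code b'), labelled_code]
      exact ⟨h1, by simp, h2, by simp [Labelled]⟩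
    · intro j _ hj
      rcases lt_trichotomy j (code b).length with h | h | h
      · rw [List.getElem?_append_left h] at hj
        exact absurd (List.mem_of_getElem? hj) (sep_notMem_code b)
      · exact h
      · rw [List.getElem?_append_right h.le] at hj
        obtain ⟨k, hk⟩ : ∃ k, j - (code b).length = k + 1 := ⟨j - (code b).length - 1, by omega⟩
        rw [hk, List.getElem?_cons_succ] at hj
        exact absurd (List.mem_of_getElem? hj) (sep_notMem_code b')
  · rintro ⟨h1, h2, hs, h3, h4⟩
    obtain ⟨hs', h3'⟩ := List.getElem?_eq_some_iff.1 h3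
    have hz : z = z.take s ++ .sep :: z.drop (s + 1) := by
      rw [← h3', ← List.drop_eq_getElem_cons, List.take_append_drop]
    have h5 : Token.sep ∉ z.take s := by
      intro h
      obtain ⟨j, hj, h⟩ := List.mem_take_iff_getElem.1 h
      have := h4 j (by omega) (List.getElem?_eq_some_iff.2 ⟨_, h⟩)
      omega
    have h6 : Token.sep ∉ z.drop (s + 1) := by
      intro h
      obtain ⟨j, hj, h⟩ := List.mem_drop_iff_getElem.1 h
      have := h4 (s + 1 + j) (by omega) (List.getElem?_eq_some_iff.2 ⟨_, h⟩)
      omega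
    have hlen : s = (z.take s).length := by simp [hs.le]
    rw [hz] at h1
    obtain ⟨b, hb⟩ := (Ok.exists_code h5 (Or.inr ⟨_, rfl⟩) h1).1 (Or.inl rfl)
    have h7 := h1.of_append
    rw [← List.append_nil (z.drop (s + 1))] at h7
    obtain ⟨b', hb'⟩ := (Ok.exists_code h6 (Or.inl rfl) h7).1 (Or.inr (Or.inr rfl))
    rw [hb] at hz hlen
    rw [hb'] at hz
    rw [hz, labelled_code, labelled_cons, ← List.append_nil (code b'), labelled_code] at h2
    exact ⟨b, b', hz, hlen, h2.1, h2.2.2.1⟩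

theorem mem_patternMatching_iff {I : SimpleGraph L} {z : List (Token S)} :
    z ∈ patternMatching I S ↔ Ok none z ∧ Labelled z ∧ ∃ s < z.length, z[s]? = some .sep ∧
      (∀ j < z.length, z[j]? = some .sep → j = s) ∧ ∃ κ : L → ℕ, (∀ α, κ α < z.length + 1) ∧
        ∀ α β, ¬ I.Adj α β → Occurs α β z s (κ α) (κ β) := by
  have key : z ∈ patternMatching I S ↔ ∃ s, (∃ b b' : List (Σ α, List (S α)),
      z = code b ++ .sep :: code b' ∧ s = (code b).length ∧
      (∀ x ∈ b, (blockLabel x).isSome) ∧ ∀ x ∈ b', (blockLabel x).isSome) ∧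
      ∃ κ : L → ℕ, ∀ α β, ¬ I.Adj α β → Occurs α β z s (κ α) (κ β) := by
    constructor
    · rintro ⟨b, b', p, t, rfl, hp, ht, h⟩
      rw [represents_iff_isSome] at hp ht
      refine ⟨_, ⟨b, b', rfl, rfl, hp.1, ht.1⟩, ?_⟩
      obtain ⟨κ, hκ⟩ := exists_depEquiv_append_iff.1 h
      refine ⟨κ, fun α β hαβ => (occurs_iff (by simp)).2 ?_⟩
      rw [(valuesBelow_code_sep b b').1, (valuesBelow_code_sep b b').2, ← hp.2, ← ht.2]
      exact hκ α β hαβ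
    · rintro ⟨_, ⟨b, b', rfl, rfl, h1, h2⟩, κ, hκ⟩
      refine ⟨b, b', _, _, rfl, represents_iff_isSome.2 ⟨h1, rfl⟩, represents_iff_isSome.2
        ⟨h2, rfl⟩, exists_depEquiv_append_iff.2 ⟨κ, fun α β hαβ => ?_⟩⟩
      rw [← (valuesBelow_code_sep b b').1, ← (valuesBelow_code_sep b b').2]
      exact (occurs_iff (by simp)).1 (hκ α β hαβ)
  rw [key]
  constructor
  · rintro ⟨s, h, κ, hκ⟩
    obtain ⟨h1, h2, h3, h4, h5⟩ := exists_code_sep_iff.1 h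
    refine ⟨h1, h2, s, h3, h4, h5, κ, fun α => ?_, hκ⟩
    -- Each node is dependent on itself, so the pair `(α, α)` bounds `κ α` by a count of positions.
    -- This makes the search for `κ` finite.
    obtain ⟨r, hr, -, h6, -⟩ := hκ α α (I.loopless.irrefl α)
    rw [← h6]
    classical
    exact (Nat.count_le _).trans_lt hr
  · rintro ⟨h1, h2, s, h3, h4, h5, κ, -, hκ⟩
    exact ⟨s, exists_code_sep_iff.2 ⟨h1, h2, h3, h4, h5⟩, κ, hκ⟩

end GraphProduct

namespace Logspace

variable {A : Type u} {α : Type*} [Ctx α]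

theorem LSP.getElem? (p : Option A → Prop) {f : List A → α → ℕ} (hf : LS f) :
    LSP fun w a => p w[f w a]? := by
  refine (LSP.cell (fun c => p (match c with | .letter a => some a | _ => none))
    (LS.succ.comp hf)).congr fun w a => ?_
  simp only [inputCell]
  cases w[f w a]? <;> rfl

theorem LSP.exists_eq_and {ι : Type*} [Finite ι] {h : List A → α → ι} {P : ι → List A → α → Prop}
    (hh : ∀ i, LSP fun w a => h w a = i) (hP : ∀ i, LSP (P i)) : LSP fun w a => P (h w a) w a :=
  (LSP.exists_fin fun i => (hh i).and (hP i)).congr fun w a => by simp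

end Logspace

namespace GraphProduct

open Logspace

variable {L : Type u} [Finite L] {G : L → Type v} [∀ α, Group (G α)] {S : ∀ α, Finset (G α)}
  {X : Type*} [Ctx X]

/-! ### Pattern matching in logarithmic space -/

theorem lsp_ok : LSP fun (w : List (Token S)) (_ : X) => Ok none w := by
  have h : LSP fun (w : List (Token S)) (x : X × ℕ) =>
      Follows (if x.2 = 0 then none else w[x.2 - 1]?) w[x.2]? := by
    refine LSP.exists_eq_and (h := fun w (x : X × ℕ) => w[x.2]?)
      (P := fun o w (x : X × ℕ) => Follows (if x.2 = 0 then none else w[x.2 - 1]?) o)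
      (fun o => LSP.getElem? (· = o) LS.snd) fun o => ?_
    refine (((LS.eq_zero LS.snd).and (LSP.const (Follows none o))).or
      ((LS.eq_zero LS.snd).not.and (LSP.getElem? (Follows · o) (LS.pred.comp LS.snd)))).congr
      fun w x => ?_
    by_cases hx : x.2 = 0 <;> simp [hx]
  exact (LSP.forall_lt (P := fun w _ i => Follows (if i = 0 then none else w[i - 1]?) w[i]?) h
    (LS.succ.comp LS.length)).congr fun w _ => ok_iff.symm

/-! ### Blocks as virtual inputs for the word problem. -/

theorem count_lt_eq {m n : ℕ} (h : m ≤ n) {p : ℕ → Prop} [DecidablePred p]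
    (hp : ∀ k, p k ↔ k < m) : Nat.count p n = m := by
  have : (Finset.range n).filter p = Finset.range m := by
    ext k
    simp only [Finset.mem_filter, Finset.mem_range, hp]
    omega
  rw [Nat.count_eq_card_filter_range, this, Finset.card_range]

theorem lt_length_leading {α : L} {z : List (Token S)} {k : ℕ} :
    (∀ j < k + 1, ∃ s : S α, z[j]? = some (.gen α s)) ↔ k < (leading α z).length := by
  constructor
  · intro h
    obtain ⟨s, hs⟩ := h k (Nat.lt_succ_self k)
    exact (List.getElem?_eq_some_iff.1
      (leading_getElem?.2 ⟨fun j hj => h j (hj.trans (Nat.lt_succ_self k)), hs⟩)).1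
  · intro h j hj
    have := leading_getElem?.1 (List.getElem?_eq_getElem h)
    rcases Nat.lt_succ_iff_lt_or_eq.1 hj with hj | rfl
    · exact this.1 j hj
    · exact ⟨_, this.2⟩

theorem length_leading_le (α : L) (z : List (Token S)) : (leading α z).length ≤ z.length := by
  induction z with
  | nil => simp [leading]
  | cons a z ih =>
    cases h : toGen α a with
    | none => simp [leading, h]
    | some s => simpa [leading, h] using ih

theorem lsp_gen (α : L) {f : List (Token S) → X → ℕ} (hf : LS f) :
    LSP fun w x => ∃ s : S α, w[f w x]? = some (.gen α s) :=
  LSP.getElem? (fun o => ∃ s : S α, o = some (.gen α s)) hf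

/-- The length is the number of `k` such that the first `k + 1` tokens are all generators of `G α`,
and counting is available. -/
theorem ls_length_leading (α : L) {f : List (Token S) → X → ℕ} (hf : LS f) :
    LS fun w x => (leading α (w.drop (f w x))).length := by
  classical
  have h1 : LSP fun (w : List (Token S)) (y : X × ℕ) =>
      ∀ j < y.2 + 1, ∃ s : S α, w[f w y.1 + j]? = some (.gen α s) :=
    LSP.forall_lt (P := fun w y j => ∃ s : S α, w[f w y.1 + j]? = some (.gen α s))
      (lsp_gen α ((hf.comp (LS.fst.comp LS.fst)).add LS.snd)) (LS.succ.comp LS.snd)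
  have h2 := LSP.count (P := fun w x k => ∀ j < k + 1, ∃ s : S α,
    w[f w x + j]? = some (.gen α s)) h1 LS.length
  refine h2.congr fun w x i _ => ?_
  rw [Ctx.get_nat, Ctx.get_nat]
  refine @count_lt_eq _ _ ((length_leading_le _ _).trans (by simp)) _ _ fun k => ?_
  rw [← lt_length_leading]
  simp only [List.getElem?_drop]

theorem lsp_leading_getElem? {α : L} (s : S α) {f g : List (Token S) → X → ℕ} (hf : LS f)
    (hg : LS g) : LSP fun w x => (leading α (w.drop (f w x)))[g w x]? = some s := by
  have h1 : LSP fun (w : List (Token S)) (x : X) =>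
      ∀ j < g w x, ∃ s : S α, w[f w x + j]? = some (.gen α s) :=
    LSP.forall_lt (P := fun w x j => ∃ s : S α, w[f w x + j]? = some (.gen α s))
      (lsp_gen α ((hf.comp LS.fst).add LS.snd)) hg
  refine (h1.and (LSP.getElem? (· = some (.gen α s)) (hf.add hg))).congr fun w x => ?_
  rw [leading_getElem?]
  simp only [List.getElem?_drop]

/-- The generators following the bracket are the virtual input of the word problem; the answer is
negated. -/
theorem lsp_nodeAt {α : L} (hwp : InLogspace (wordProblem (S α)))
    {f : List (Token S) → X → ℕ} (hf : LS f) : LSP fun w x => NodeAt α w (f w x) := by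
  have h := hwp.lsp (V := fun w x => leading α (w.drop (f w x + 1)))
    (ls_length_leading α (LS.succ.comp hf))
    fun s => lsp_leading_getElem? s (LS.succ.comp (hf.comp LS.fst)) LS.snd
  exact (LSP.getElem? (· = some .opening) hf).and h.not

theorem getElem?_append_reverse_map {B : Type*} {i : B → B} (hi : Function.Involutive i)
    (u v : List B) (k : ℕ) (s : B) : (u ++ (v.reverse.map i))[k]? = some s ↔
      k < u.length ∧ u[k]? = some s ∨ ¬ k < u.length ∧ k - u.length < v.length ∧
        v[v.length - 1 - (k - u.length)]? = some (i s) := by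
  by_cases hk : k < u.length
  · rw [List.getElem?_append_left hk]
    simp only [hk, true_and, not_true_eq_false, false_and, or_false]
  · rw [List.getElem?_append_right (by omega)]
    simp only [hk, false_and, not_false_eq_true, true_and, false_or, List.getElem?_map]
    by_cases hk' : k - u.length < v.length
    · rw [List.getElem?_reverse hk']
      simp only [hk', true_and, Option.map_eq_some_iff]
      constructor
      · rintro ⟨a, h, rfl⟩
        rw [h, hi]
      · exact fun h => ⟨_, h, hi s⟩
    · simp [hk']

/-- Two blocks `u`, `v` have equal values if and only if `u v⁻¹` is in the word problem. Its letters
are computable in place: first those of `u`, then the inverses of those of `v`, read backwards. -/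
theorem lsp_sameAt {α : L} (hinv : ∀ g ∈ S α, g⁻¹ ∈ S α)
    (hwp : InLogspace (wordProblem (S α))) {f g : List (Token S) → X → ℕ} (hf : LS f) (hg : LS g) :
    LSP fun w x => SameAt α w (f w x) (g w x) := by
  let i : S α → S α := fun s => ⟨s.1⁻¹, hinv s.1 s.2⟩
  have hi : Function.Involutive i := fun s => Subtype.ext (inv_inv _)
  have hprod : ∀ v : List (S α), ((v.reverse.map i).map Subtype.val).prod =
      ((v.map Subtype.val).prod)⁻¹ := by
    intro v
    rw [List.prod_inv_reverse, List.map_map, List.map_map, List.map_reverse]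
    rfl
  have h1 := ls_length_leading α (LS.succ.comp hf)
  have h2 := ls_length_leading α (LS.succ.comp hg)
  have h := hwp.lsp (V := fun w x => leading α (w.drop (f w x + 1)) ++
      (leading α (w.drop (g w x + 1))).reverse.map i)
    ((h1.add h2).congr fun w x _ _ => by simp) fun s => by
      simp only [getElem?_append_reverse_map hi]
      have h3 := LS.snd.lt (h1.comp LS.fst)
      refine (h3.and (lsp_leading_getElem? s (LS.succ.comp (hf.comp LS.fst)) LS.snd)).or
        (h3.not.and (((LS.snd.sub (h1.comp LS.fst)).lt (h2.comp LS.fst)).and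
        (lsp_leading_getElem? (i s) (LS.succ.comp (hg.comp LS.fst))
          ((LS.pred.comp (h2.comp LS.fst)).sub (LS.snd.sub (h1.comp LS.fst))))))
  refine (lsp_nodeAt hwp hf).and ((lsp_nodeAt hwp hg).and (h.congr fun w x => ?_))
  change (List.map Subtype.val (_ ++ _)).prod = 1 ↔ _
  rw [List.map_append, List.prod_append, hprod, mul_inv_eq_one]

theorem lsp_labelled (hwp : ∀ α, InLogspace (wordProblem (S α))) :
    LSP fun (w : List (Token S)) (_ : X) => Labelled w := by
  refine (LSP.forall_lt (P := fun w _ i => w[i]? = some Token.opening → ∃ α, NodeAt α w i)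
    ((LSP.getElem? (· = some Token.opening) LS.snd).imp
      (LSP.exists_fin fun α => lsp_nodeAt (hwp α) LS.snd)) LS.length).congr fun w _ => ?_
  refine forall_congr' fun i => forall_congr' fun _ => forall_congr' fun _ => ?_
  rw [Option.isSome_iff_exists]
  simp only [nodeAt_iff]
  constructor
  · rintro ⟨_, a, h, -⟩
    exact ⟨a, h⟩
  · rintro ⟨a, h⟩
    exact ⟨_, a, h, rfl⟩

theorem lsp_occurs (hinv : ∀ α, ∀ g ∈ S α, g⁻¹ ∈ S α)
    (hwp : ∀ α, InLogspace (wordProblem (S α))) (α β : L) {s k l : List (Token S) → X → ℕ}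
    (hs : LS s) (hk : LS k) (hl : LS l) : LSP fun w x => Occurs α β w (s w x) (k w x) (l w x) := by
  classical
  have node : ∀ {Y : Type _} [Ctx Y] {f : List (Token S) → Y → ℕ}, LS f →
      LSP fun w y => NodeAt α w (f w y) ∨ NodeAt β w (f w y) := fun hf =>
    (lsp_nodeAt (hwp α) hf).or (lsp_nodeAt (hwp β) hf)
  have count : ∀ γ, LS fun (w : List (Token S)) (x : X × ℕ) =>
      Nat.count (fun i => NodeAt γ w (s w x.1 + 1 + i)) x.2 := fun γ =>
    LSP.count (P := fun w x i => NodeAt γ w (s w x.1 + 1 + i))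
      (lsp_nodeAt (hwp γ) ((LS.succ.comp (hs.comp (LS.fst.comp LS.fst))).add LS.snd)) LS.snd
  -- The nested context lists the parameter `x`, the offset `r`, the pattern position `i` and the
  -- text position `j`, in the order of quantification.
  have hs1 : LS fun (w : List (Token S)) (y : ((X × ℕ) × ℕ) × ℕ) =>
      s w y.1.1.1 + 1 + (y.1.1.2 + y.2) :=
    (LS.succ.comp (hs.comp (LS.fst.comp (LS.fst.comp LS.fst)))).add
      ((LS.snd.comp (LS.fst.comp LS.fst)).add LS.snd)
  have count₁ : LS fun (w : List (Token S)) (y : ((X × ℕ) × ℕ) × ℕ) =>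
      Nat.count (fun i => NodeAt α w (s w y.1.1.1 + 1 + (y.1.1.2 + i)) ∨
        NodeAt β w (s w y.1.1.1 + 1 + (y.1.1.2 + i))) y.2 :=
    LSP.count (P := fun w (y : ((X × ℕ) × ℕ) × ℕ) i => NodeAt α w (s w y.1.1.1 + 1 + (y.1.1.2 + i)) ∨
        NodeAt β w (s w y.1.1.1 + 1 + (y.1.1.2 + i)))
      (node (hs1.comp ((LS.fst.comp LS.fst).pair LS.snd))) LS.snd
  have count₂ : LS fun (w : List (Token S)) (y : ((X × ℕ) × ℕ) × ℕ) =>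
      Nat.count (fun i => NodeAt α w i ∨ NodeAt β w i) y.1.2 :=
    LSP.count (P := fun w (_ : ((X × ℕ) × ℕ) × ℕ) i => NodeAt α w i ∨ NodeAt β w i) (node LS.snd) (LS.snd.comp LS.fst)
  have same : ∀ γ, LSP fun (w : List (Token S)) (y : ((X × ℕ) × ℕ) × ℕ) =>
      SameAt γ w y.1.2 (s w y.1.1.1 + 1 + (y.1.1.2 + y.2)) := fun γ =>
    lsp_sameAt (hinv γ) (hwp γ) (LS.snd.comp LS.fst) hs1
  have inner := LSP.exists_lt (P := fun w (y : (X × ℕ) × ℕ) j =>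
    s w y.1.1 + 1 + (y.1.2 + j) < w.length ∧ (SameAt α w y.2 (s w y.1.1 + 1 + (y.1.2 + j)) ∨
      SameAt β w y.2 (s w y.1.1 + 1 + (y.1.2 + j))) ∧
      Nat.count (fun i => NodeAt α w (s w y.1.1 + 1 + (y.1.2 + i)) ∨
        NodeAt β w (s w y.1.1 + 1 + (y.1.2 + i))) j =
        Nat.count (fun i => NodeAt α w i ∨ NodeAt β w i) y.2)
    ((hs1.lt LS.length).and (((same α).or (same β)).and (count₁.eq count₂))) LS.length
  have outer := LSP.forall_lt (P := fun w (x : X × ℕ) i => (NodeAt α w i ∨ NodeAt β w i) →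
      ∃ j < w.length, s w x.1 + 1 + (x.2 + j) < w.length ∧
      (SameAt α w i (s w x.1 + 1 + (x.2 + j)) ∨ SameAt β w i (s w x.1 + 1 + (x.2 + j))) ∧
      Nat.count (fun i => NodeAt α w (s w x.1 + 1 + (x.2 + i)) ∨
        NodeAt β w (s w x.1 + 1 + (x.2 + i))) j =
        Nat.count (fun i => NodeAt α w i ∨ NodeAt β w i) i)
    ((node LS.snd).imp inner) (hs.comp LS.fst)
  exact LSP.exists_lt (P := fun w (x : X) r => s w x + 1 + r ≤ w.length ∧
    Nat.count (fun i => NodeAt α w (s w x + 1 + i)) r = k w x ∧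
    Nat.count (fun i => NodeAt β w (s w x + 1 + i)) r = l w x ∧
    ∀ i < s w x, (NodeAt α w i ∨ NodeAt β w i) → ∃ j < w.length,
      s w x + 1 + (r + j) < w.length ∧
      (SameAt α w i (s w x + 1 + (r + j)) ∨ SameAt β w i (s w x + 1 + (r + j))) ∧
      Nat.count (fun i => NodeAt α w (s w x + 1 + (r + i)) ∨ NodeAt β w (s w x + 1 + (r + i))) j =
        Nat.count (fun i => NodeAt α w i ∨ NodeAt β w i) i)
    ((((LS.succ.comp (hs.comp LS.fst)).add LS.snd).le LS.length).and
      (((count α).eq (hk.comp LS.fst)).and (((count β).eq (hl.comp LS.fst)).and outer)))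
    (LS.succ.comp LS.length)

theorem lsp_patternMatching (I : SimpleGraph L) (hinv : ∀ α, ∀ g ∈ S α, g⁻¹ ∈ S α)
    (hwp : ∀ α, InLogspace (wordProblem (S α))) :
    LSP fun (w : List (Token S)) (_ : Unit) => w ∈ patternMatching I S := by
  -- Numbering the nodes turns `κ` into a tuple of fixed length `n`, over which bounded
  -- quantification is available.
  obtain ⟨n, ⟨e⟩⟩ := Finite.exists_equiv_fin L
  have h1 := LSP.exists_fun (P := fun w (x : Unit × ℕ) (κ : Fin n → ℕ) =>
      ∀ α β, ¬ I.Adj α β → Occurs α β w x.2 (κ (e α)) (κ (e β)))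
    (LSP.forall_fin fun α => LSP.forall_fin fun β => (LSP.const _).imp
      (lsp_occurs hinv hwp α β (LS.snd.comp LS.fst) ((LS.proj (e α)).comp LS.snd)
        ((LS.proj (e β)).comp LS.snd))) (LS.succ.comp LS.length)
  have h2 : LSP fun (w : List (Token S)) (x : Unit × ℕ) =>
      ∀ j < w.length, w[j]? = some .sep → j = x.2 :=
    LSP.forall_lt (P := fun (w : List (Token S)) (x : Unit × ℕ) j => w[j]? = some .sep → j = x.2)
      ((LSP.getElem? (· = some Token.sep) LS.snd).imp (LS.snd.eq (LS.snd.comp LS.fst))) LS.length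
  have h3 := LSP.exists_lt (P := fun (w : List (Token S)) (_ : Unit) s => w[s]? = some .sep ∧
      (∀ j < w.length, w[j]? = some .sep → j = s) ∧ ∃ κ : Fin n → ℕ,
        (∀ i, κ i < w.length + 1) ∧
        ∀ α β, ¬ I.Adj α β → Occurs α β w s (κ (e α)) (κ (e β)))
    ((LSP.getElem? (· = some .sep) LS.snd).and (h2.and h1)) LS.length
  refine (lsp_ok.and ((lsp_labelled hwp).and h3)).congr fun w _ => ?_
  rw [mem_patternMatching_iff]
  refine and_congr_right fun _ => and_congr_right fun _ => exists_congr fun s =>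
    and_congr_right fun _ => and_congr_right fun _ => and_congr_right fun _ => ?_
  constructor
  · rintro ⟨κ, h, h'⟩
    exact ⟨fun α => κ (e α), fun α => h _, h'⟩
  · rintro ⟨κ, h, h'⟩
    exact ⟨fun i => κ (e.symm i), fun i => h _, by simpa using h'⟩

end GraphProduct

theorem mainTheorem10 {L : Type u} [Finite L] (I : SimpleGraph L)
    (G : L → Type v) [∀ α, Group (G α)] (S : ∀ α, Finset (G α))
    (hone : ∀ α, (1 : G α) ∉ S α)
    (hinv : ∀ α, ∀ g ∈ S α, g⁻¹ ∈ S α)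
    (hgen : ∀ α, Subgroup.closure (S α : Set (G α)) = ⊤)
    (hwp : ∀ α, Logspace.InLogspace (GraphProduct.wordProblem (S α))) :
    Logspace.InLogspace (GraphProduct.patternMatching I S) := by
  classical
  exact Logspace.LS.inLogspace (GraphProduct.lsp_patternMatching I hinv hwp) fun w => by simp
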